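/- Let $d\ge 1$ be an integer, $\beta>0$ and $R>0$. Let $B_R$ be the open ball of radius $R$ centred at $0$ in $\mathbb R^d$, $\mathbb S$ the unit sphere of $\mathbb R^d$, $d\sigma$ its surface measure (the counting measure on $\{\pm1\}$ if $d=1$) and $|\mathbb S|$ its total mass. Consider the Fokker--Planck (Kramers) operator $Qf(v)=\nabla\cdot\big(\nabla f(v)+\beta f(v)v\big)$ on isotropic functions of $L^2(B_R,e^{|v|^2/2}dv)$ vanishing on $\partial B_R$. That is, $\mu\in\mathbb R$ is an eigenvalue if there is a function $f\not\equiv 0$ of this kind, depending on $|v|$ only, $C^2$ in $B_R$ and continuous on $\overline{B_R}$, with $f=0$ on $\partial B_R$ and $Qf=\mu f$ in $B_R$; such an $f$ is an eigenfunction for $\mu$. For every $R>0$ there is a largest nonzero eigenvalue, denoted by $\lambda(R)$. For $v\in\mathbb R^d$ and $u\in[0,1)$ put $$G(v,u)=\frac{1}{(2\pi)^d}\,\frac1{|\mathbb S|}\left(\frac{2\pi\beta}{1-u^2}\right)^{d/2}\int_{\mathbb S}\exp\left(-\frac{\beta\,|Ru\sigma+v|^2}{2(1-u^2)}\right)d\sigma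 .$$ (i) $\lambda=\lambda(R)$ is negative for every $R>0$. One has $\lambda(R)+2\beta>0$ for all sufficiently large $R$, and for every $R>0$ with $\lambda(R)+2\beta>0$, $$G(R\omega,0)+\frac{\lambda}{\beta}\int_0^1\big(G(R\omega,u)-G(R\omega,0)\big)u^{\frac{\lambda}{\beta}-1}\,du=0\qquad\text{for all }\omega\in\mathbb S,$$ where the integral converges absolutely. Moreover, for every $R>0$ and every $u\in[0,1)$, $G(R\omega,u)$ does not depend on $\omega\in\mathbb S$, so the relation can be averaged over $\omega$. (ii) For every $R>0$ with $\lambda=\lambda(R)$ satisfying $\lambda+2\beta>0$, every eigenfunction $f_\lambda$ for $\lambda$ satisfies, for all $v\in\overline{B_R}$, $$f_\lambda(v)=M_\lambda\left\{G(v,0)+\frac{\lambda}{\beta}\int_0^1\big[G(v,u)-G(v,0)\big]u^{\frac{\lambda}{\beta}-1}\,du\right\},\qquad M_\lambda=\int_{B_R}f_\lambda(v)\,dv,$$ where the integral over $u$ converges absolutely. (iii) As $R\to+\infty$, $$\lambda(R)\ \sim\ -\frac{2\beta}{\Gamma(d/2)}\left(\frac{\beta R^2}{2}\right)^{d/2}\exp\left(-\frac{\beta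 R^2}{2}\right).$$ -/

import Mathlib

open MeasureTheory Filter Asymptotics

noncomputable section

/-- Velocity space `ℝ^d` with its Euclidean norm. -/
abbrev Vel (d : ℕ) : Type := EuclideanSpace ℝ (Fin d)

/-- Divergence of a vector field on `ℝ^d`: `∑ᵢ ∂ᵢ Xᵢ`. -/
def vdiv {d : ℕ} (X : Vel d → Vel d) (v : Vel d) : ℝ :=
  ∑ i : Fin d, (fderiv ℝ X v (EuclideanSpace.single i 1)) i

/-- The Fokker-Planck (Kramers) operator with unit diffusion coefficient and inverse
temperature `β`: `Q f = ∇ · (∇ f + β f v)`. -/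
def fpOperator {d : ℕ} (β : ℝ) (f : Vel d → ℝ) (v : Vel d) : ℝ :=
  vdiv (fun w => gradient f w + (β * f w) • w) v

/-- `f`, a function on the closed ball of radius `R`, is an isotropic eigenfunction, with
eigenvalue `μ`, of the Fokker-Planck operator on the ball with vanishing Dirichlet boundary
condition. The values of `f` outside the closed ball play no role. -/
structure IsFPEigenfunction (d : ℕ) (β R μ : ℝ) (f : Vel d → ℝ) : Prop where
  /-- `f` belongs to `L²(exp(|v|²/2) dv)` on the ball. -/
  memLp : MemLp f 2 ((volume.restrict (Metric.ball (0 : Vel d) R)).withDensity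
    (fun v => ENNReal.ofReal (Real.exp (‖v‖ ^ 2 / 2))))
  isotropic : ∀ v ∈ Metric.closedBall (0 : Vel d) R, ∀ w ∈ Metric.closedBall (0 : Vel d) R,
    ‖v‖ = ‖w‖ → f v = f w
  contDiffOn : ContDiffOn ℝ 2 f (Metric.ball (0 : Vel d) R)
  continuousOn : ContinuousOn f (Metric.closedBall (0 : Vel d) R)
  boundary : ∀ v ∈ Metric.sphere (0 : Vel d) R, f v = 0
  nontrivial : ∃ v ∈ Metric.ball (0 : Vel d) R, f v ≠ 0
  eigen : ∀ v ∈ Metric.ball (0 : Vel d) R, fpOperator β f v = μ * f v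

/-- The set of nonzero eigenvalues of the Dirichlet Fokker-Planck operator on isotropic
functions on the ball of radius `R`. -/
def fpNonzeroEigenvalues (d : ℕ) (β R : ℝ) : Set ℝ :=
  {μ | μ ≠ 0 ∧ ∃ f : Vel d → ℝ, IsFPEigenfunction d β R μ f}

/-- `λ(R)`: the largest nonzero eigenvalue. -/
def fpLambda (d : ℕ) (β R : ℝ) : ℝ := sSup (fpNonzeroEigenvalues d β R)

/-- The surface measure `dσ` of the unit sphere of `ℝ^d`. -/
abbrev surfaceMeasure (d : ℕ) : Measure (Metric.sphere (0 : Vel d) 1) :=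
  (volume : Measure (Vel d)).toSphere

/-- The kernel
`G(v,u) = (2π)^{-d} |S|⁻¹ (2πβ/(1-u²))^{d/2} ∫_S exp(-β |R u σ + v|² / (2(1-u²))) dσ`. -/
def fpG (d : ℕ) (β R : ℝ) (v : Vel d) (u : ℝ) : ℝ :=
  1 / (2 * Real.pi) ^ d * (1 / (surfaceMeasure d).real Set.univ) *
    (2 * Real.pi * β / (1 - u ^ 2)) ^ ((d : ℝ) / 2) *
    ∫ σ : Metric.sphere (0 : Vel d) 1,
      Real.exp (-(β * ‖(R * u) • (σ : Vel d) + v‖ ^ 2) / (2 * (1 - u ^ 2)))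
      ∂(surfaceMeasure d)

/-- The integrand `(G(v,u) - G(v,0)) u^{μ/β - 1}`. -/
def fpIntegrand (d : ℕ) (β R μ : ℝ) (v : Vel d) (u : ℝ) : ℝ :=
  (fpG d β R v u - fpG d β R v 0) * u ^ (μ / β - 1)

end

/-! Put `b = d/2`, `s = β|v|²/2`, `x = βR²/2`. A radial function written as `e^{-s} g(s)` satisfies
`Q f = μ f` exactly when `s g'' + (b - s) g' = a g` with `a = μ/(2β)`. The solution regular at the
origin is Kummer's `M(a,b,s)`, so eigenvalues correspond to zeros of `a ↦ M(a,b,x)` and `λ = 2βa`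
for the greatest such zero (`mem_fpNonzeroEigenvalues_iff`, `fpLambda_spec`). It exists and is
negative because `M > 0` for `a ≥ 0`, while the Laguerre generating function forces `M(-n,b,x) < 0`
for some `n`.

The spherical integral in `G` evaluates to a `₀F₁` function, which makes `G(v,u)` a Gaussian in `v`
times the Hille-Hardy kernel `K(u²,x,s)` (`fpG_eq_hilleHardy`). This kernel solves `q ∂_q K = -L K`
with `L = s ∂² + (b - s) ∂`, and it concentrates at the diagonal as `q → 1`. For a zero `a` of
`M(·,b,x)`, let `I(q)` be the integral of `K(q,y,·) M(a,b,·)` over `[0,x]` against the weight that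
makes `L` symmetric, and `I₀ = I(0)`. Green's identity gives `q I' = -a (I - I₀ K(q,x,y))`, that is,
`(q^a I)' = a I₀ q^{a-1} K(q,x,y)`. Subtracting the same relation with `K` replaced by 1,
substituting `q = u²` and integrating over `(0,1)` represents `M(a,b,y)` (`kummerM_representation`).
The condition `a > -1`, equivalent to `λ + 2β > 0`, kills the boundary term at 0. This is (ii), and
at `|v| = R`, where `M` vanishes, it is the relation in (i).

For (iii), `M(-t,b,x) = 1 - tN(x)` up to a controlled `t²` error, with `N(x) ~ Γ(b) x^{-b} e^x`. The
greatest zero is therefore asymptotic to `-1/N(x)` (`eventually_kummerM_zero`). -/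

open scoped Topology

/-! ### Entire power series, Kummer's function and `₀F₁` -/

noncomputable section

/-- The sum of the power series with coefficients `c`. -/
def entireSum (c : ℕ → ℝ) (x : ℝ) : ℝ := ∑' k, c k * x ^ k

/-- The power series with coefficients `c` converges on the whole real line. -/
def EntireCoeff (c : ℕ → ℝ) : Prop := ∀ r : ℝ, Summable fun k => c k * r ^ k

/-- The coefficients of the derivative of a power series. -/
def derivCoeff (c : ℕ → ℝ) (k : ℕ) : ℝ := (k + 1) * c (k + 1)

namespace EntireCoeff

variable {c : ℕ → ℝ}

lemma hasSum (hc : EntireCoeff c) (x : ℝ) : HasSum (fun k => c k * x ^ k) (entireSum c x) :=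
  (hc x).hasSum

lemma summable_abs (hc : EntireCoeff c) (r : ℝ) : Summable fun k => |c k| * |r| ^ k := by
  simpa [abs_mul, abs_pow] using (hc r).abs

/-- Since `k + 1 ≤ 2^(k+1)`, the differentiated series at `r` is dominated by the original one at
`2(|r| + 1)`. -/
lemma deriv (hc : EntireCoeff c) : EntireCoeff (derivCoeff c) := by
  intro r
  have h := (summable_nat_add_iff 1).2 (hc.summable_abs (2 * (|r| + 1)))
  refine Summable.of_norm_bounded h fun k => ?_
  have h1 : ((k : ℝ) + 1) ≤ 2 ^ (k + 1) := by
    exact_mod_cast (Nat.lt_two_pow_self (n := k + 1)).le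
  have h2 : |r| ^ k ≤ (|r| + 1) ^ (k + 1) :=
    calc |r| ^ k ≤ (|r| + 1) ^ k := by gcongr; linarith
      _ ≤ (|r| + 1) ^ (k + 1) := pow_le_pow_right₀ (by linarith [abs_nonneg r]) (by omega)
  have h3 : |2 * (|r| + 1)| = 2 * (|r| + 1) := abs_of_nonneg (by positivity)
  rw [Real.norm_eq_abs, derivCoeff, abs_mul, abs_mul, abs_pow, h3, mul_pow,
    abs_of_nonneg (by positivity : (0 : ℝ) ≤ (k : ℝ) + 1)]
  calc (k + 1 : ℝ) * |c (k + 1)| * |r| ^ k = |c (k + 1)| * ((k + 1 : ℝ) * |r| ^ k) := by ring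
    _ ≤ |c (k + 1)| * (2 ^ (k + 1) * (|r| + 1) ^ (k + 1)) := by gcongr

lemma hasDerivAt (hc : EntireCoeff c) (x : ℝ) :
    HasDerivAt (entireSum c) (entireSum (derivCoeff c) x) x := by
  set r := |x| + 1 with hr
  have hr0 : 0 ≤ r := by positivity
  have hu : Summable fun k : ℕ => |(k : ℝ) * c k| * r ^ (k - 1) := by
    rw [← summable_nat_add_iff 1]
    have := hc.deriv.summable_abs r
    rw [abs_of_nonneg hr0] at this
    simpa [derivCoeff] using this
  have h := hasDerivAt_tsum_of_isPreconnected (t := Metric.ball (0 : ℝ) r)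
    (g := fun k y => c k * y ^ k) (g' := fun k y => (k : ℝ) * c k * y ^ (k - 1)) (y₀ := 0) (y := x)
    hu Metric.isOpen_ball (convex_ball _ _).isPreconnected ?_ ?_ ?_ (hc 0) ?_
  · have e : ∑' k : ℕ, (k : ℝ) * c k * x ^ (k - 1) = entireSum (derivCoeff c) x := by
      have hs : Summable fun k : ℕ => (k : ℝ) * c k * x ^ (k - 1) := by
        rw [← summable_nat_add_iff 1]
        simpa [derivCoeff] using hc.deriv x
      rw [hs.tsum_eq_zero_add]
      simp [entireSum, derivCoeff]
    rw [e] at h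
    exact h
  · intro k y _
    have := (hasDerivAt_pow k y).const_mul (c k)
    rwa [← mul_assoc, mul_comm (c k)] at this
  · intro k y hy
    have hy' : |y| ≤ r := by simpa using (mem_ball_zero_iff.1 hy).le
    rw [Real.norm_eq_abs, abs_mul, abs_pow]
    gcongr
  · exact Metric.mem_ball_self (by positivity)
  · simp [hr]

lemma continuous (hc : EntireCoeff c) : Continuous (entireSum c) :=
  continuous_iff_continuousAt.2 fun x => (hc.hasDerivAt x).continuousAt

/-- The Euler operator `x d/dx` multiplies the `k`-th coefficient by `k`. In this form the
differential equations below reduce to coefficient recursions without index shifts. -/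
lemma hasSum_euler (hc : EntireCoeff c) (x : ℝ) :
    HasSum (fun k : ℕ => k * c k * x ^ k) (x * entireSum (derivCoeff c) x) := by
  rw [← hasSum_nat_add_iff' 1]
  have := (hc.deriv.hasSum x).mul_left x
  simp only [derivCoeff] at this
  simp only [Finset.range_one, Finset.sum_singleton, Nat.cast_zero, zero_mul, sub_zero]
  refine this.congr_fun fun k => ?_
  push_cast
  ring

end EntireCoeff

@[simp]
lemma entireSum_zero (c : ℕ → ℝ) : entireSum c 0 = c 0 := by
  rw [entireSum, tsum_eq_single 0]
  · simp
  · intro k hk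
    simp [hk]

/-- The coefficients with `c 0 = 1` and `c (k + 1) * ((b + k) * (k + 1)) = p k * c k`. -/
def kummerCoeff (p : ℕ → ℝ) (b : ℝ) (k : ℕ) : ℝ :=
  ∏ j ∈ Finset.range k, p j / ((b + j) * (j + 1))

@[simp]
lemma kummerCoeff_zero (p : ℕ → ℝ) (b : ℝ) : kummerCoeff p b 0 = 1 := by simp [kummerCoeff]

lemma kummerCoeff_succ (p : ℕ → ℝ) (b : ℝ) (k : ℕ) :
    kummerCoeff p b (k + 1) = kummerCoeff p b k * (p k / ((b + k) * (k + 1))) := by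
  rw [kummerCoeff, kummerCoeff, Finset.prod_range_succ]

lemma kummerCoeff_rec {b : ℝ} (hb : 0 < b) (p : ℕ → ℝ) (k : ℕ) :
    (b + k) * derivCoeff (kummerCoeff p b) k = p k * kummerCoeff p b k := by
  have h1 : b + k ≠ 0 := by positivity
  have h2 : (k : ℝ) + 1 ≠ 0 := by positivity
  rw [derivCoeff, kummerCoeff_succ]
  field_simp

lemma kummerCoeff_nonneg {b : ℝ} (hb : 0 < b) {p : ℕ → ℝ} (hp : ∀ k, 0 ≤ p k) (k : ℕ) :
    0 ≤ kummerCoeff p b k :=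
  Finset.prod_nonneg fun j _ => div_nonneg (hp j) (by positivity)

lemma abs_kummerCoeff_le {b : ℝ} (hb : 0 < b) {p p' : ℕ → ℝ} (hp : ∀ k, |p k| ≤ p' k) (k : ℕ) :
    |kummerCoeff p b k| ≤ kummerCoeff p' b k := by
  rw [kummerCoeff, kummerCoeff, Finset.abs_prod]
  refine Finset.prod_le_prod (fun j _ => abs_nonneg _) fun j _ => ?_
  have : 0 < (b + j) * ((j : ℝ) + 1) := by positivity
  rw [abs_div, abs_of_pos this]
  gcongr
  exact hp j

/-- Ratio test: `(A + k)/(b + k)` stays below `A/b + 1`, so the ratio of consecutive terms is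
`O(1/k)`. -/
lemma entireCoeff_kummerCoeff {b : ℝ} (hb : 0 < b) {p : ℕ → ℝ} {A : ℝ} (hp : ∀ k, |p k| ≤ A + k) :
    EntireCoeff (kummerCoeff p b) := by
  intro r
  have hA : 0 ≤ A := by simpa using (abs_nonneg _).trans (hp 0)
  have hlim : Tendsto (fun k : ℕ => (A + k) / (b + k) * (|r| / ((k : ℝ) + 1))) atTop (𝓝 0) := by
    have h1 : Tendsto (fun k : ℕ => |r| / ((k : ℝ) + 1)) atTop (𝓝 0) :=
      tendsto_const_div_atTop_nhds_zero_nat |r| |>.comp (tendsto_add_atTop_nat 1) |>.congr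
        (fun k => by simp)
    refine squeeze_zero (fun k => by positivity) (g := fun k : ℕ => (A / b + 1) * (|r| / ((k : ℝ) + 1)))
      (fun k => ?_) (by simpa using h1.const_mul (A / b + 1))
    gcongr
    rw [div_le_iff₀ (by positivity)]
    have : A / b * b = A := by field_simp
    have h3 : 0 ≤ A / b * k := by positivity
    nlinarith
  refine summable_of_ratio_norm_eventually_le (r := 1 / 2) (by norm_num) ?_
  filter_upwards [hlim.eventually (gt_mem_nhds (by norm_num : (0 : ℝ) < 1 / 2))] with k hk
  have hpos : 0 < (b + k) * ((k : ℝ) + 1) := by positivity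
  rw [kummerCoeff_succ, pow_succ, show kummerCoeff p b k * (p k / ((b + k) * (k + 1))) * (r ^ k * r)
    = (p k * r / ((b + k) * (k + 1))) * (kummerCoeff p b k * r ^ k) by ring, norm_mul]
  gcongr
  rw [Real.norm_eq_abs, abs_div, abs_mul, abs_of_pos hpos]
  calc |p k| * |r| / ((b + k) * (k + 1)) ≤ (A + k) * |r| / ((b + k) * (k + 1)) := by
        gcongr; exact hp k
    _ = (A + k) / (b + k) * (|r| / ((k : ℝ) + 1)) := by
        field_simp
    _ ≤ 1 / 2 := hk.le

/-- The power series with coefficients `kummerCoeff p b` satisfies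
`x F'' + b F' = ∑ p k * c k * x ^ k`. -/
lemma hasSum_kummer_ode {b : ℝ} (hb : 0 < b) {p : ℕ → ℝ} (hc : EntireCoeff (kummerCoeff p b))
    (x : ℝ) :
    HasSum (fun k => p k * kummerCoeff p b k * x ^ k)
      (x * entireSum (derivCoeff (derivCoeff (kummerCoeff p b))) x
        + b * entireSum (derivCoeff (kummerCoeff p b)) x) := by
  have h := (hc.deriv.hasSum_euler x).add ((hc.deriv.hasSum x).mul_left b)
  refine h.congr_fun fun k => ?_
  rw [← kummerCoeff_rec hb]
  ring

/-- Kummer's function `₁F₁(a; b; x)`. -/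
def kummerM (a b x : ℝ) : ℝ := entireSum (kummerCoeff (fun j => a + j) b) x

/-- The derivative in `x` of Kummer's function. -/
def kummerM' (a b x : ℝ) : ℝ := entireSum (derivCoeff (kummerCoeff (fun j => a + j) b)) x

/-- The second derivative in `x` of Kummer's function. -/
def kummerM'' (a b x : ℝ) : ℝ :=
  entireSum (derivCoeff (derivCoeff (kummerCoeff (fun j => a + j) b))) x

/-- The function `₀F₁(; b; x)`. -/
def besselPhi (b x : ℝ) : ℝ := entireSum (kummerCoeff (fun _ => 1) b) x

/-- The derivative of `₀F₁(; b; x)`. -/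
def besselPhi' (b x : ℝ) : ℝ := entireSum (derivCoeff (kummerCoeff (fun _ => 1) b)) x

/-- The second derivative of `₀F₁(; b; x)`. -/
def besselPhi'' (b x : ℝ) : ℝ :=
  entireSum (derivCoeff (derivCoeff (kummerCoeff (fun _ => 1) b))) x

section

variable {b : ℝ} (hb : 0 < b)

include hb

lemma entireCoeff_kummerM (a : ℝ) : EntireCoeff (kummerCoeff (fun j => a + j) b) :=
  entireCoeff_kummerCoeff hb (A := |a|) fun k =>
    (abs_add_le _ _).trans (by simp)

lemma entireCoeff_besselPhi : EntireCoeff (kummerCoeff (fun _ => 1) b) :=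
  entireCoeff_kummerCoeff hb (A := 1) fun k => by simp

lemma hasDerivAt_kummerM (a x : ℝ) : HasDerivAt (kummerM a b) (kummerM' a b x) x :=
  (entireCoeff_kummerM hb a).hasDerivAt x

lemma hasDerivAt_kummerM' (a x : ℝ) : HasDerivAt (kummerM' a b) (kummerM'' a b x) x :=
  (entireCoeff_kummerM hb a).deriv.hasDerivAt x

lemma continuous_kummerM (a : ℝ) : Continuous (kummerM a b) := (entireCoeff_kummerM hb a).continuous

lemma continuous_kummerM' (a : ℝ) : Continuous (kummerM' a b) :=
  (entireCoeff_kummerM hb a).deriv.continuous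

lemma continuous_kummerM'' (a : ℝ) : Continuous (kummerM'' a b) :=
  (entireCoeff_kummerM hb a).deriv.deriv.continuous

/-- With `p k = a + k`, the right side of `hasSum_kummer_ode` splits into `a M` and the Euler term
`x M'`. -/
lemma kummerM_ode (a x : ℝ) :
    x * kummerM'' a b x + (b - x) * kummerM' a b x = a * kummerM a b x := by
  have h := hasSum_kummer_ode hb (entireCoeff_kummerM hb a) x
  have h2 := (((entireCoeff_kummerM hb a).hasSum x).mul_left a).add
    ((entireCoeff_kummerM hb a).hasSum_euler x)
  have h3 := h.unique (h2.congr_fun fun k => by ring)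
  simp only [kummerM, kummerM', kummerM'']
  linarith

lemma hasDerivAt_besselPhi (x : ℝ) : HasDerivAt (besselPhi b) (besselPhi' b x) x :=
  (entireCoeff_besselPhi hb).hasDerivAt x

lemma hasDerivAt_besselPhi' (x : ℝ) : HasDerivAt (besselPhi' b) (besselPhi'' b x) x :=
  (entireCoeff_besselPhi hb).deriv.hasDerivAt x

lemma continuous_besselPhi : Continuous (besselPhi b) := (entireCoeff_besselPhi hb).continuous

lemma continuous_besselPhi' : Continuous (besselPhi' b) :=
  (entireCoeff_besselPhi hb).deriv.continuous

lemma besselPhi_ode (x : ℝ) : x * besselPhi'' b x + b * besselPhi' b x = besselPhi b x := by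
  have h := hasSum_kummer_ode hb (entireCoeff_besselPhi hb) x
  exact h.unique (((entireCoeff_besselPhi hb).hasSum x).congr_fun fun k => by ring)

lemma besselPhi_nonneg {x : ℝ} (hx : 0 ≤ x) : 0 ≤ besselPhi b x :=
  tsum_nonneg fun k => mul_nonneg (kummerCoeff_nonneg hb (fun _ => zero_le_one) k) (by positivity)

end

@[simp]
lemma kummerM_zero_right (a b : ℝ) : kummerM a b 0 = 1 := by simp [kummerM]

@[simp]
lemma besselPhi_zero (b : ℝ) : besselPhi b 0 = 1 := by simp [besselPhi]

end

/-! ### Exponential integrals over the sphere, and `G` as a Hille-Hardy kernel -/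

noncomputable section

open scoped Nat RealInnerProductSpace

lemma EntireCoeff.ext_of_entireSum_eq (n : ℕ) : ∀ {c c' : ℕ → ℝ}, EntireCoeff c → EntireCoeff c' →
    (∀ x, entireSum c x = entireSum c' x) → c n = c' n := by
  induction n with
  | zero =>
    intro c c' _ _ h
    simpa using h 0
  | succ n ih =>
    intro c c' hc hc' h
    have hd : ∀ x, entireSum (derivCoeff c) x = entireSum (derivCoeff c') x := fun x =>
      (hc.hasDerivAt x).unique ((hc'.hasDerivAt x).congr_of_eventuallyEq (.of_forall h))
    have := ih hc.deriv hc'.deriv hd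
    simp only [derivCoeff] at this
    exact mul_left_cancel₀ (by positivity) this

lemma powerSeries_coeff_unique {c c' : ℕ → ℝ} {f : ℝ → ℝ}
    (h : ∀ w, HasSum (fun n => c n * w ^ n) (f w)) (h' : ∀ w, HasSum (fun n => c' n * w ^ n) (f w))
    (n : ℕ) : c n = c' n :=
  EntireCoeff.ext_of_entireSum_eq n (fun r => (h r).summable) (fun r => (h' r).summable)
    fun x => (h x).tsum_eq.trans (h' x).tsum_eq.symm

lemma kummerCoeff_one_eq {b : ℝ} (hb : 0 < b) (k : ℕ) :
    kummerCoeff (fun _ => 1) b k = Real.Gamma b / (Real.Gamma (b + k) * k !) := by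
  induction k with
  | zero => simp [(Real.Gamma_pos_of_pos hb).ne']
  | succ k ih =>
    have h0 : b + k ≠ 0 := by positivity
    have h1 : Real.Gamma (b + k) ≠ 0 := (Real.Gamma_pos_of_pos (by positivity)).ne'
    rw [kummerCoeff_succ, ih, Nat.factorial_succ]
    push_cast
    rw [← add_assoc, Real.Gamma_add_one h0]
    field_simp

section Sphere

variable {d : ℕ}

lemma integrable_exp_neg_sq_add_inner (w : ℝ) (e : Vel d) :
    Integrable fun v : Vel d => Real.exp (-‖v‖ ^ 2 + w * ⟪e, v⟫) := by
  have h := (GaussianFourier.integrable_cexp_neg_mul_sq_norm_add (V := Vel d) (b := 1) (by simp)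
    (w : ℂ) e).re
  refine h.congr (.of_forall fun v => ?_)
  have : (-1 * (‖v‖ : ℂ) ^ 2 + (w : ℂ) * ((⟪e, v⟫ : ℝ) : ℂ)) =
      ((-‖v‖ ^ 2 + w * ⟪e, v⟫ : ℝ) : ℂ) := by push_cast; ring
  simp only [this]
  exact Complex.exp_ofReal_re _

lemma integral_exp_neg_sq_add_inner (w : ℝ) (e : Vel d) :
    ∫ v : Vel d, Real.exp (-‖v‖ ^ 2 + w * ⟪e, v⟫)
      = Real.pi ^ ((d : ℝ) / 2) * Real.exp (w ^ 2 * ‖e‖ ^ 2 / 4) := by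
  have h := GaussianFourier.integral_cexp_neg_mul_sq_norm_add (V := Vel d) (b := 1) (by simp)
    (w : ℂ) e
  have h1 : ∀ v : Vel d, Complex.exp (-1 * (‖v‖ : ℂ) ^ 2 + (w : ℂ) * ((⟪e, v⟫ : ℝ) : ℂ)) =
      ((Real.exp (-‖v‖ ^ 2 + w * ⟪e, v⟫) : ℝ) : ℂ) := fun v => by push_cast; ring_nf
  rw [integral_congr_ae (.of_forall h1), integral_complex_ofReal] at h
  have h2 : ((Real.pi : ℂ) / 1) ^ (Module.finrank ℝ (Vel d) / 2 : ℂ) *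
      Complex.exp ((w : ℂ) ^ 2 * (‖e‖ : ℂ) ^ 2 / (4 * 1)) =
      ((Real.pi ^ ((d : ℝ) / 2) * Real.exp (w ^ 2 * ‖e‖ ^ 2 / 4) : ℝ) : ℂ) := by
    rw [Complex.ofReal_mul, Complex.ofReal_cpow Real.pi_pos.le]
    push_cast
    simp
  rw [h2] at h
  exact_mod_cast h

lemma hasSum_exp_mul (x y : ℝ) : HasSum (fun n : ℕ => x ^ n / n ! * y ^ n) (Real.exp (x * y)) := by
  have := NormedSpace.expSeries_div_hasSum_exp (x * y)
  rw [← Real.exp_eq_exp_ℝ] at this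
  refine this.congr_fun fun n => ?_
  rw [mul_pow]
  ring

/-- Expand `exp(w⟪e,v⟫)` under the Gaussian integral. Every partial sum is dominated using `exp |z|
≤ exp z + exp (-z)`, whose two terms are integrable Gaussians. -/
lemma hasSum_gaussian_moments (w : ℝ) (e : Vel d) :
    HasSum (fun n : ℕ => w ^ n / n ! * ∫ v : Vel d, ⟪e, v⟫ ^ n * Real.exp (-‖v‖ ^ 2))
      (Real.pi ^ ((d : ℝ) / 2) * Real.exp (w ^ 2 * ‖e‖ ^ 2 / 4)) := by
  rw [← integral_exp_neg_sq_add_inner]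
  have hs : ∀ v : Vel d, HasSum
      (fun n : ℕ => |w| ^ n / n ! * |⟪e, v⟫| ^ n * Real.exp (-‖v‖ ^ 2))
      (Real.exp (|w| * |⟪e, v⟫|) * Real.exp (-‖v‖ ^ 2)) := fun v =>
    (hasSum_exp_mul _ _).mul_right _
  have key := hasSum_integral_of_dominated_convergence (μ := (volume : Measure (Vel d)))
    (F := fun (n : ℕ) (v : Vel d) => w ^ n / n ! * (⟪e, v⟫ ^ n * Real.exp (-‖v‖ ^ 2)))
    (f := fun v => Real.exp (-‖v‖ ^ 2 + w * ⟪e, v⟫))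
    (fun n v => |w| ^ n / n ! * |⟪e, v⟫| ^ n * Real.exp (-‖v‖ ^ 2)) ?_ ?_ ?_ ?_ ?_
  · simpa only [integral_const_mul] using key
  · intro n
    exact (by fun_prop : Continuous fun v : Vel d =>
      w ^ n / n ! * (⟪e, v⟫ ^ n * Real.exp (-‖v‖ ^ 2))).aestronglyMeasurable
  · refine fun n => .of_forall fun v => le_of_eq ?_
    simp [mul_assoc]
  · exact .of_forall fun v => (hs v).summable
  · have h1 := (integrable_exp_neg_sq_add_inner w e).add (integrable_exp_neg_sq_add_inner (-w) e)
    refine h1.mono' ?_ (.of_forall fun v => ?_)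
    · refine Continuous.aestronglyMeasurable ?_
      simp only [fun v => (hs v).tsum_eq]
      fun_prop
    · rw [(hs v).tsum_eq, ← abs_mul, Real.norm_of_nonneg (by positivity), ← Real.exp_add]
      rcases abs_cases (w * ⟪e, v⟫) with h | h <;> rw [h.1]
      · simp only [Pi.add_apply]
        have := Real.exp_pos (-‖v‖ ^ 2 + -w * ⟪e, v⟫)
        rw [add_comm (w * _)]
        linarith
      · simp only [Pi.add_apply]
        have := Real.exp_pos (-‖v‖ ^ 2 + w * ⟪e, v⟫)
        rw [add_comm (-(w * _)), ← neg_mul]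
        linarith
  · refine .of_forall fun v => ?_
    rw [Real.exp_add, mul_comm]
    exact ((hasSum_exp_mul _ _).mul_right _).congr_fun fun n => by ring

/-- Both the moment series and the series of `exp(w²‖e‖²/4)` represent the same function of `w`, so
their coefficients agree. -/
lemma gaussian_moments (k : ℕ) (e : Vel d) :
    ∫ v : Vel d, ⟪e, v⟫ ^ (2 * k) * Real.exp (-‖v‖ ^ 2)
      = (2 * k)! * (Real.pi ^ ((d : ℝ) / 2) * (‖e‖ ^ 2 / 4) ^ k / k !) ∧
    ∫ v : Vel d, ⟪e, v⟫ ^ (2 * k + 1) * Real.exp (-‖v‖ ^ 2) = 0 := by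
  obtain ⟨m, hm⟩ : ∃ m : ℕ → ℝ, ∀ n, m n = ∫ v : Vel d, ⟪e, v⟫ ^ n * Real.exp (-‖v‖ ^ 2) :=
    ⟨_, fun _ => rfl⟩
  obtain ⟨P, hP⟩ : ∃ P : ℝ, P = Real.pi ^ ((d : ℝ) / 2) := ⟨_, rfl⟩
  obtain ⟨c', hc', hc''⟩ : ∃ c' : ℕ → ℝ, (∀ k, c' (2 * k) = P * (‖e‖ ^ 2 / 4) ^ k / k !) ∧
      ∀ k, c' (2 * k + 1) = 0 :=
    ⟨fun n => if Even n then P * (‖e‖ ^ 2 / 4) ^ (n / 2) / (n / 2)! else 0,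
      fun k => by simp, fun k => by simp⟩
  rw [← hm, ← hm, ← hP]
  have h1 : ∀ w, HasSum (fun n : ℕ => m n / n ! * w ^ n) (P * Real.exp (w ^ 2 * ‖e‖ ^ 2 / 4)) := by
    intro w
    have := hasSum_gaussian_moments w e
    simp only [← hm, ← hP] at this
    exact this.congr_fun fun n => by ring
  have h2 : ∀ w, HasSum (fun n => c' n * w ^ n) (P * Real.exp (w ^ 2 * ‖e‖ ^ 2 / 4)) := by
    intro w
    have he : HasSum (fun k => c' (2 * k) * w ^ (2 * k))
        (P * Real.exp (w ^ 2 * (‖e‖ ^ 2 / 4))) := by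
      refine ((hasSum_exp_mul (w ^ 2) (‖e‖ ^ 2 / 4)).mul_left _).congr_fun fun k => ?_
      rw [hc', pow_mul]
      ring
    have ho : HasSum (fun k => c' (2 * k + 1) * w ^ (2 * k + 1)) 0 :=
      hasSum_zero.congr_fun fun k => by simp [hc'']
    have := HasSum.even_add_odd (f := fun n => c' n * w ^ n) he ho
    rwa [add_zero, ← mul_div_assoc] at this
  have hcc : ∀ n, m n / n ! = c' n := fun n =>
    powerSeries_coeff_unique (c := fun n => m n / n !) h1 h2 n
  have hfac : ∀ n : ℕ, (n ! : ℝ) ≠ 0 := fun n => by positivity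
  constructor
  · have := hcc (2 * k)
    rw [hc', div_eq_iff (hfac _)] at this
    rw [this, mul_comm]
  · have := hcc (2 * k + 1)
    rw [hc'', div_eq_zero_iff] at this
    exact this.resolve_right (hfac _)

/-- Integration in polar coordinates of a function that is a product of an angular and of a radial
part. -/
lemma integral_polar_mul (hd : 1 ≤ d) (F : Vel d → ℝ) (g : Metric.sphere (0 : Vel d) 1 → ℝ)
    (h : ℝ → ℝ) (hF : ∀ σ : Metric.sphere (0 : Vel d) 1, ∀ r : ℝ, 0 < r →
      F (r • (σ : Vel d)) = g σ * h r) :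
    ∫ v, F v = (∫ σ, g σ ∂(surfaceMeasure d)) * ∫ r in Set.Ioi (0 : ℝ), r ^ (d - 1) * h r := by
  have : Nonempty (Fin d) := ⟨⟨0, hd⟩⟩
  calc ∫ v, F v = ∫ x : ({(0)}ᶜ : Set (Vel d)), F x ∂((volume : Measure (Vel d)).comap (↑)) := by
        rw [integral_subtype_comap (measurableSet_singleton _).compl F, restrict_compl_singleton]
    _ = ∫ p, g p.1 * h p.2 ∂((surfaceMeasure d).prod (.volumeIoiPow (d - 1))) := by
        have h1 := (volume : Measure (Vel d)).measurePreserving_homeomorphUnitSphereProd.integral_comp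
          (Homeomorph.measurableEmbedding _) (fun p => g p.1 * h p.2)
        rw [finrank_euclideanSpace_fin] at h1
        rw [← h1]
        refine integral_congr_ae (.of_forall fun x => ?_)
        simp only
        rw [← hF _ _ (homeomorphUnitSphereProd (Vel d) x).2.2]
        congr 1
        have := congrArg Subtype.val ((homeomorphUnitSphereProd (Vel d)).symm_apply_apply x)
        rw [homeomorphUnitSphereProd_symm_apply_coe] at this
        exact this.symm
    _ = (∫ σ, g σ ∂(surfaceMeasure d)) *
        ∫ r : Set.Ioi (0 : ℝ), h r ∂(Measure.volumeIoiPow (d - 1)) :=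
      integral_prod_mul g (fun r : Set.Ioi (0 : ℝ) => h r)
    _ = _ := by
        congr 1
        simp only [Measure.volumeIoiPow, ENNReal.ofReal]
        rw [integral_withDensity_eq_integral_smul,
          integral_subtype_comap measurableSet_Ioi fun a ↦ Real.toNNReal (a ^ (d - 1)) • h a,
          setIntegral_congr_fun measurableSet_Ioi fun x hx ↦ ?_]
        · rw [NNReal.smul_def, Real.coe_toNNReal _ (pow_nonneg hx.out.le _), smul_eq_mul]
        · exact (measurable_subtype_coe.pow_const _).real_toNNReal

lemma integral_pow_mul_exp_neg_mul_sq {τ : ℝ} (hτ : 0 < τ) (n : ℕ) :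
    ∫ r in Set.Ioi (0 : ℝ), r ^ n * Real.exp (-(r ^ 2 / τ)) =
      Real.Gamma (((n : ℝ) + 1) / 2) / 2 * τ ^ (((n : ℝ) + 1) / 2) := by
  have h := integral_rpow_mul_exp_neg_mul_rpow (p := 2) (q := n) (b := 1 / τ) two_pos
    (by have : (0 : ℝ) ≤ n := by positivity
        linarith) (by positivity)
  have e : ∀ r : ℝ, r ^ n * Real.exp (-(r ^ 2 / τ)) =
      r ^ (n : ℝ) * Real.exp (-(1 / τ) * r ^ (2 : ℝ)) := fun r => by
    rw [Real.rpow_natCast, Real.rpow_two]; ring_nf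
  simp only [e]
  rw [h, one_div τ, Real.inv_rpow hτ.le, neg_div, Real.rpow_neg hτ.le, inv_inv]
  ring

lemma integrableOn_pow_mul_exp_neg_mul_sq {τ : ℝ} (hτ : 0 < τ) (n : ℕ) :
    IntegrableOn (fun r : ℝ => r ^ n * Real.exp (-(r ^ 2 / τ))) (Set.Ioi 0) := by
  have h := (integrable_rpow_mul_exp_neg_mul_sq (b := 1 / τ) (by positivity) (s := n)
    (by have : (0 : ℝ) ≤ n := by positivity
        linarith)).integrableOn (s := Set.Ioi 0)
  refine h.congr_fun (fun r _ => ?_) measurableSet_Ioi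
  simp only [Real.rpow_natCast]
  ring_nf

/-- In polar coordinates a Gaussian moment is the spherical moment times a radial Gamma integral;
dividing by the latter leaves a quotient `Γ(b)/Γ(b+k)`, which is a `₀F₁` coefficient. -/
lemma integral_sphere_inner_pow (hd : 1 ≤ d) (e : Vel d) (k : ℕ) :
    ∫ σ : Metric.sphere (0 : Vel d) 1, ⟪e, (σ : Vel d)⟫ ^ (2 * k) ∂(surfaceMeasure d)
      = (2 * k)! * (2 * Real.pi ^ ((d : ℝ) / 2) / Real.Gamma ((d : ℝ) / 2)) * (‖e‖ ^ 2 / 4) ^ k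
        * kummerCoeff (fun _ => 1) ((d : ℝ) / 2) k ∧
    ∫ σ : Metric.sphere (0 : Vel d) 1, ⟪e, (σ : Vel d)⟫ ^ (2 * k + 1) ∂(surfaceMeasure d) = 0 := by
  have key : ∀ n : ℕ, ∫ v : Vel d, ⟪e, v⟫ ^ n * Real.exp (-‖v‖ ^ 2) =
      (∫ σ : Metric.sphere (0 : Vel d) 1, ⟪e, (σ : Vel d)⟫ ^ n ∂(surfaceMeasure d)) *
        (Real.Gamma (((d + n : ℕ) : ℝ) / 2) / 2) := by
    intro n
    rw [integral_polar_mul hd _ (fun σ => ⟪e, (σ : Vel d)⟫ ^ n)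
      (fun r => r ^ n * Real.exp (-(r ^ 2 / 1)))]
    · congr 1
      simp only [← mul_assoc, ← pow_add]
      rw [integral_pow_mul_exp_neg_mul_sq one_pos, Real.one_rpow, mul_one]
      congr 3
      have : d - 1 + n + 1 = d + n := by omega
      exact_mod_cast congrArg (Nat.cast : ℕ → ℝ) this
    · intro σ r hr
      have : ‖(σ : Vel d)‖ = 1 := by simp
      rw [inner_smul_right, norm_smul, this, Real.norm_of_nonneg hr.le]
      ring_nf
  have hb : (0 : ℝ) < (d : ℝ) / 2 := by
    have : (1 : ℝ) ≤ d := by exact_mod_cast hd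
    linarith
  have hG : ∀ n : ℕ, Real.Gamma (((d + n : ℕ) : ℝ) / 2) ≠ 0 := fun n =>
    (Real.Gamma_pos_of_pos (by push_cast; positivity)).ne'
  constructor
  · have h := (gaussian_moments k e).1
    rw [key] at h
    have hG' := hG (2 * k)
    have e1 : (((d + 2 * k : ℕ) : ℝ) / 2) = (d : ℝ) / 2 + k := by push_cast; ring
    rw [e1] at h hG'
    have hG0 := (Real.Gamma_pos_of_pos hb).ne'
    rw [kummerCoeff_one_eq hb]
    rw [← eq_div_iff (by positivity)] at h
    rw [h]
    field_simp
  · have h := (gaussian_moments k e).2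
    rw [key] at h
    exact (mul_eq_zero.1 h).resolve_right (by have := hG (2 * k + 1); positivity)

lemma integral_sphere_exp_inner (hd : 1 ≤ d) (e : Vel d) :
    ∫ σ : Metric.sphere (0 : Vel d) 1, Real.exp ⟪e, (σ : Vel d)⟫ ∂(surfaceMeasure d)
      = 2 * Real.pi ^ ((d : ℝ) / 2) / Real.Gamma ((d : ℝ) / 2)
        * besselPhi ((d : ℝ) / 2) (‖e‖ ^ 2 / 4) := by
  have hs : ∀ σ : Metric.sphere (0 : Vel d) 1, HasSum (fun n : ℕ => 1 ^ n / n ! * ‖e‖ ^ n)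
      (Real.exp (1 * ‖e‖)) := fun σ => hasSum_exp_mul _ _
  have key := hasSum_integral_of_dominated_convergence (μ := surfaceMeasure d)
    (F := fun (n : ℕ) (σ : Metric.sphere (0 : Vel d) 1) => 1 ^ n / (n ! : ℝ) * ⟪e, (σ : Vel d)⟫ ^ n)
    (f := fun σ => Real.exp ⟪e, (σ : Vel d)⟫)
    (fun n σ => 1 ^ n / n ! * ‖e‖ ^ n) ?_ ?_ ?_ ?_ ?_
  · refine key.unique ?_
    simp only [integral_const_mul]
    -- Odd spherical moments vanish, so the sum is reindexed over the even integers.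
    rw [← (mul_right_injective₀ (two_ne_zero (α := ℕ))).hasSum_iff]
    · refine (((entireCoeff_besselPhi (b := (d : ℝ) / 2) (by
        have : (1 : ℝ) ≤ d := by exact_mod_cast hd
        linarith)).hasSum (‖e‖ ^ 2 / 4)).mul_left _).congr_fun fun k => ?_
      simp only [Function.comp_apply]
      rw [(integral_sphere_inner_pow hd e k).1, one_pow]
      field_simp
    · intro n hn
      obtain ⟨k, rfl⟩ : Odd n := by
        rw [← Nat.not_even_iff_odd]
        rintro ⟨j, rfl⟩
        exact hn ⟨j, by ring⟩
      rw [(integral_sphere_inner_pow hd e k).2, mul_zero]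
  · intro n
    exact (by fun_prop : Continuous fun σ : Metric.sphere (0 : Vel d) 1 =>
      1 ^ n / (n ! : ℝ) * ⟪e, (σ : Vel d)⟫ ^ n).aestronglyMeasurable
  · refine fun n => .of_forall fun σ => ?_
    have h1 : ‖(σ : Vel d)‖ = 1 := by simp
    have h2 : |⟪e, (σ : Vel d)⟫| ≤ ‖e‖ := by
      simpa [h1] using abs_real_inner_le_norm e (σ : Vel d)
    rw [norm_mul, norm_pow, Real.norm_eq_abs, Real.norm_eq_abs, abs_of_nonneg (by positivity)]
    gcongr
  · exact .of_forall fun σ => (hs σ).summable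
  · exact integrable_const _
  · refine .of_forall fun σ => ?_
    simpa using hasSum_exp_mul 1 ⟪e, (σ : Vel d)⟫

lemma surfaceMeasure_real_univ (hd : 1 ≤ d) :
    (surfaceMeasure d).real Set.univ = 2 * Real.pi ^ ((d : ℝ) / 2) / Real.Gamma ((d : ℝ) / 2) := by
  simpa using integral_sphere_exp_inner hd (0 : Vel d)

end Sphere

/-- The Hille-Hardy kernel. -/
def hilleHardy (b q x s : ℝ) : ℝ :=
  (1 - q) ^ (-b) * Real.exp (-(q / (1 - q) * (x + s))) * besselPhi b (q * x / (1 - q) ^ 2 * s)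

/-- Expanding `‖Ruσ + v‖²` leaves one term depending on `σ`, linear in it; its exponential
integrates to `|S|` times `₀F₁`, and `|S|` cancels the normalisation of `G`. The identity needs `u <
1` to divide by `1 - u²`. -/
lemma fpG_eq_hilleHardy {d : ℕ} (hd : 1 ≤ d) {β : ℝ} (hβ : 0 < β) (R : ℝ) (v : Vel d) {u : ℝ}
    (hu : u ∈ Set.Ico (0 : ℝ) 1) :
    fpG d β R v u = (β / (2 * Real.pi)) ^ ((d : ℝ) / 2) * Real.exp (-(β * ‖v‖ ^ 2 / 2)) *
      hilleHardy ((d : ℝ) / 2) (u ^ 2) (β * R ^ 2 / 2) (β * ‖v‖ ^ 2 / 2) := by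
  have hu2 : 0 < 1 - u ^ 2 := by nlinarith [hu.1, hu.2]
  have hexp : ∀ σ : Metric.sphere (0 : Vel d) 1,
      Real.exp (-(β * ‖(R * u) • (σ : Vel d) + v‖ ^ 2) / (2 * (1 - u ^ 2))) =
      Real.exp (-(β * (R ^ 2 * u ^ 2 + ‖v‖ ^ 2)) / (2 * (1 - u ^ 2))) *
        Real.exp ⟪(-(β * R * u / (1 - u ^ 2))) • v, (σ : Vel d)⟫ := by
    intro σ
    have h1 : ‖(σ : Vel d)‖ = 1 := by simp
    rw [← Real.exp_add, norm_add_sq_real, norm_smul, h1, inner_smul_left, inner_smul_left,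
      real_inner_comm]
    congr 1
    simp only [Real.norm_eq_abs, mul_one, sq_abs, conj_trivial]
    field_simp
    ring
  have hπ := Real.pi_pos
  have hS : 0 < 2 * Real.pi ^ ((d : ℝ) / 2) / Real.Gamma ((d : ℝ) / 2) := by
    have : 0 < Real.Gamma ((d : ℝ) / 2) := Real.Gamma_pos_of_pos (by
      have : (1 : ℝ) ≤ d := by exact_mod_cast hd
      linarith)
    positivity
  rw [fpG, surfaceMeasure_real_univ hd]
  simp only [hexp]
  rw [integral_const_mul, integral_sphere_exp_inner hd, hilleHardy]
  have e1 : 1 / (2 * Real.pi) ^ d * (2 * Real.pi * β / (1 - u ^ 2)) ^ ((d : ℝ) / 2) =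
      (β / (2 * Real.pi)) ^ ((d : ℝ) / 2) * (1 - u ^ 2) ^ (-((d : ℝ) / 2)) := by
    have h2 : (2 * Real.pi) ^ d = ((2 * Real.pi) ^ 2) ^ ((d : ℝ) / 2) := by
      rw [← Real.rpow_natCast (2 * Real.pi) 2, ← Real.rpow_mul (by positivity),
        ← Real.rpow_natCast]
      congr 1
      push_cast
      ring
    rw [h2, Real.rpow_neg hu2.le, ← Real.inv_rpow hu2.le, one_div, ← Real.inv_rpow (by positivity),
      ← Real.mul_rpow (by positivity) (by positivity),
      ← Real.mul_rpow (by positivity) (by positivity)]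
    congr 1
    field_simp
  have e2 : Real.exp (-(β * (R ^ 2 * u ^ 2 + ‖v‖ ^ 2)) / (2 * (1 - u ^ 2))) =
      Real.exp (-(β * ‖v‖ ^ 2 / 2)) *
        Real.exp (-(u ^ 2 / (1 - u ^ 2) * (β * R ^ 2 / 2 + β * ‖v‖ ^ 2 / 2))) := by
    rw [← Real.exp_add]
    congr 1
    field_simp
    ring
  have e3 : ‖(-(β * R * u / (1 - u ^ 2))) • v‖ ^ 2 / 4 =
      u ^ 2 * (β * R ^ 2 / 2) / (1 - u ^ 2) ^ 2 * (β * ‖v‖ ^ 2 / 2) := by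
    rw [norm_smul, mul_pow, Real.norm_eq_abs, sq_abs]
    field_simp
    ring
  rw [e2, e3]
  set S := 2 * Real.pi ^ ((d : ℝ) / 2) / Real.Gamma ((d : ℝ) / 2)
  rw [mul_right_comm (1 / (2 * Real.pi) ^ d), e1]
  field_simp

end

/-! ### The Hille-Hardy kernel: derivatives, evolution equation, Green's identity -/

noncomputable section

open scoped Nat

lemma hilleHardy_comm (b q x s : ℝ) : hilleHardy b q x s = hilleHardy b q s x := by
  rw [hilleHardy, hilleHardy, add_comm x s]
  congr 2
  ring

@[simp]
lemma hilleHardy_zero (b x s : ℝ) : hilleHardy b 0 x s = 1 := by simp [hilleHardy]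

lemma hilleHardy_nonneg {b : ℝ} (hb : 0 < b) {q x s : ℝ} (hq : 0 ≤ q) (hq1 : q < 1) (hx : 0 ≤ x)
    (hs : 0 ≤ s) : 0 ≤ hilleHardy b q x s :=
  mul_nonneg (mul_nonneg (Real.rpow_nonneg (by linarith) _) (Real.exp_nonneg _))
    (besselPhi_nonneg hb (by positivity))

/-- The derivative of the Hille-Hardy kernel in its last variable. -/
def hilleHardyS (b q x s : ℝ) : ℝ :=
  (1 - q) ^ (-b) * Real.exp (-(q / (1 - q) * (x + s))) *
    (-(q / (1 - q)) * besselPhi b (q * x / (1 - q) ^ 2 * s)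
      + q * x / (1 - q) ^ 2 * besselPhi' b (q * x / (1 - q) ^ 2 * s))

/-- The second derivative of the Hille-Hardy kernel in its last variable. -/
def hilleHardySS (b q x s : ℝ) : ℝ :=
  (1 - q) ^ (-b) * Real.exp (-(q / (1 - q) * (x + s))) *
    ((q / (1 - q)) ^ 2 * besselPhi b (q * x / (1 - q) ^ 2 * s)
      - 2 * (q / (1 - q)) * (q * x / (1 - q) ^ 2) * besselPhi' b (q * x / (1 - q) ^ 2 * s)
      + (q * x / (1 - q) ^ 2) ^ 2 * besselPhi'' b (q * x / (1 - q) ^ 2 * s))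

/-- The derivative of the Hille-Hardy kernel in `q`. -/
def hilleHardyQ (b q x s : ℝ) : ℝ :=
  (1 - q) ^ (-b) * Real.exp (-(q / (1 - q) * (x + s))) *
    ((b / (1 - q) - (x + s) / (1 - q) ^ 2) * besselPhi b (q * x / (1 - q) ^ 2 * s)
      + s * x * (1 + q) / (1 - q) ^ 3 * besselPhi' b (q * x / (1 - q) ^ 2 * s))

section

variable {b : ℝ} (hb : 0 < b)

include hb

lemma hasDerivAt_hilleHardy_s (q x s : ℝ) :
    HasDerivAt (hilleHardy b q x) (hilleHardyS b q x s) s := by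
  have h1 : HasDerivAt (fun s => Real.exp (-(q / (1 - q) * (x + s))))
      (Real.exp (-(q / (1 - q) * (x + s))) * (-(q / (1 - q) * 1))) s :=
    (((hasDerivAt_id s).const_add x).const_mul (q / (1 - q))).neg.exp
  have h2 : HasDerivAt (fun s => besselPhi b (q * x / (1 - q) ^ 2 * s))
      (besselPhi' b (q * x / (1 - q) ^ 2 * s) * (q * x / (1 - q) ^ 2 * 1)) s :=
    (hasDerivAt_besselPhi hb _).comp s ((hasDerivAt_id s).const_mul _)
  refine ((h1.const_mul ((1 - q) ^ (-b))).mul h2).congr_deriv ?_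
  rw [hilleHardyS]
  ring

lemma hasDerivAt_hilleHardyS (q x s : ℝ) :
    HasDerivAt (hilleHardyS b q x) (hilleHardySS b q x s) s := by
  have h1 : HasDerivAt (fun s => Real.exp (-(q / (1 - q) * (x + s))))
      (Real.exp (-(q / (1 - q) * (x + s))) * (-(q / (1 - q) * 1))) s :=
    (((hasDerivAt_id s).const_add x).const_mul (q / (1 - q))).neg.exp
  have h2 : HasDerivAt (fun s => besselPhi b (q * x / (1 - q) ^ 2 * s))
      (besselPhi' b (q * x / (1 - q) ^ 2 * s) * (q * x / (1 - q) ^ 2 * 1)) s :=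
    (hasDerivAt_besselPhi hb _).comp s ((hasDerivAt_id s).const_mul _)
  have h3 : HasDerivAt (fun s => besselPhi' b (q * x / (1 - q) ^ 2 * s))
      (besselPhi'' b (q * x / (1 - q) ^ 2 * s) * (q * x / (1 - q) ^ 2 * 1)) s :=
    (hasDerivAt_besselPhi' hb _).comp s ((hasDerivAt_id s).const_mul _)
  refine ((h1.const_mul ((1 - q) ^ (-b))).mul
    ((h2.const_mul (-(q / (1 - q)))).add (h3.const_mul (q * x / (1 - q) ^ 2)))).congr_deriv ?_
  rw [hilleHardySS]
  simp only [Pi.add_apply]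
  ring

lemma hasDerivAt_hilleHardy_q {q : ℝ} (hq : q < 1) (x s : ℝ) :
    HasDerivAt (fun q => hilleHardy b q x s) (hilleHardyQ b q x s) q := by
  have hτ : 0 < 1 - q := by linarith
  have h0 : HasDerivAt (fun q : ℝ => 1 - q) (-1) q := (hasDerivAt_id q).const_sub 1
  have h1 : HasDerivAt (fun q : ℝ => (1 - q) ^ (-b)) ((-1) * (-b) * (1 - q) ^ (-b - 1)) q :=
    h0.rpow_const (Or.inl hτ.ne')
  have h2 : HasDerivAt (fun q : ℝ => q / (1 - q)) ((1 * (1 - q) - q * (-1)) / (1 - q) ^ 2) q :=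
    (hasDerivAt_id q).div h0 hτ.ne'
  have h3 := (h2.mul_const (x + s)).neg.exp
  have h4 : HasDerivAt (fun q : ℝ => q * x / (1 - q) ^ 2 * s)
      ((1 * x * (1 - q) ^ 2 - q * x * ((2 : ℕ) * (1 - q) ^ (2 - 1) * (-1))) / ((1 - q) ^ 2) ^ 2 * s)
      q :=
    (((hasDerivAt_id q).mul_const x).div (h0.pow 2) (pow_ne_zero 2 hτ.ne')).mul_const s
  have h5 := (hasDerivAt_besselPhi hb (q * x / (1 - q) ^ 2 * s)).comp q h4
  refine ((h1.mul h3).mul h5).congr_deriv ?_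
  rw [hilleHardyQ, Real.rpow_sub_one hτ.ne']
  simp only [Function.comp_apply, Pi.mul_apply, Pi.neg_apply]
  push_cast
  field_simp
  ring

lemma hilleHardy_pde {q : ℝ} (hq : q < 1) (x s : ℝ) :
    q * hilleHardyQ b q x s
      = -(s * hilleHardySS b q x s + (b - s) * hilleHardyS b q x s) := by
  have hτ : 1 - q ≠ 0 := by linarith
  have hode := besselPhi_ode hb (q * x / (1 - q) ^ 2 * s)
  rw [hilleHardyQ, hilleHardyS, hilleHardySS]
  set E := (1 - q) ^ (-b) * Real.exp (-(q / (1 - q) * (x + s)))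
  rw [← hode]
  field_simp
  ring

lemma continuousOn_hilleHardy (x : ℝ) :
    ContinuousOn (fun p : ℝ × ℝ => hilleHardy b p.1 x p.2) (Set.Iio 1 ×ˢ Set.univ) := by
  have hτ : ∀ p ∈ (Set.Iio 1 ×ˢ Set.univ : Set (ℝ × ℝ)), 1 - p.1 ≠ 0 := fun p hp => by
    have : p.1 < 1 := hp.1
    linarith
  have h1 := continuous_besselPhi hb
  unfold hilleHardy
  refine ContinuousOn.mul (ContinuousOn.mul ?_ ?_) (h1.comp_continuousOn ?_)
  · exact ContinuousOn.rpow_const (by fun_prop) fun p hp => Or.inl (hτ p hp)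
  · exact (ContinuousOn.mul (ContinuousOn.div (by fun_prop) (by fun_prop) hτ)
      (by fun_prop)).neg.rexp
  · exact ContinuousOn.mul (ContinuousOn.div (by fun_prop) (by fun_prop)
      fun p hp => pow_ne_zero _ (hτ p hp)) (by fun_prop)

lemma continuousOn_hilleHardyQ (x : ℝ) :
    ContinuousOn (fun p : ℝ × ℝ => hilleHardyQ b p.1 x p.2) (Set.Iio 1 ×ˢ Set.univ) := by
  have hτ : ∀ p ∈ (Set.Iio 1 ×ˢ Set.univ : Set (ℝ × ℝ)), 1 - p.1 ≠ 0 := fun p hp => by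
    have : p.1 < 1 := hp.1
    linarith
  have h1 := continuous_besselPhi hb
  have h2 := continuous_besselPhi' hb
  have harg : ContinuousOn (fun p : ℝ × ℝ => p.1 * x / (1 - p.1) ^ 2 * p.2)
      (Set.Iio 1 ×ˢ Set.univ) :=
    ContinuousOn.mul (ContinuousOn.div (by fun_prop) (by fun_prop)
      fun p hp => pow_ne_zero _ (hτ p hp)) (by fun_prop)
  unfold hilleHardyQ
  refine ContinuousOn.mul (ContinuousOn.mul ?_ ?_) (ContinuousOn.add (ContinuousOn.mul
    (ContinuousOn.sub ?_ ?_) (h1.comp_continuousOn harg)) (ContinuousOn.mul ?_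
      (h2.comp_continuousOn harg)))
  · exact ContinuousOn.rpow_const (by fun_prop) fun p hp => Or.inl (hτ p hp)
  · exact (ContinuousOn.mul (ContinuousOn.div (by fun_prop) (by fun_prop) hτ)
      (by fun_prop)).neg.rexp
  · exact ContinuousOn.div (by fun_prop) (by fun_prop) hτ
  · exact ContinuousOn.div (by fun_prop) (by fun_prop) fun p hp => pow_ne_zero _ (hτ p hp)
  · exact ContinuousOn.div (by fun_prop) (by fun_prop) fun p hp => pow_ne_zero _ (hτ p hp)

lemma continuous_hilleHardy {q : ℝ} (hq : q < 1) (x : ℝ) : Continuous (hilleHardy b q x) :=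
  (continuousOn_hilleHardy hb x).comp_continuous (f := fun s => (q, s)) (by fun_prop)
    fun s => ⟨hq, trivial⟩

lemma continuous_hilleHardyQ {q : ℝ} (hq : q < 1) (x : ℝ) : Continuous (hilleHardyQ b q x) :=
  (continuousOn_hilleHardyQ hb x).comp_continuous (f := fun s => (q, s)) (by fun_prop)
    fun s => ⟨hq, trivial⟩

end

/-- Green's identity for the operator `L g = s g'' + (b - s) g'`, in the variable `ρ` with
`s = ρ ^ 2`, `b = d / 2`. -/
lemma integral_green {d : ℕ} (hd : 1 ≤ d) {g g' g'' h h' h'' : ℝ → ℝ}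
    (hg : ∀ s, HasDerivAt g (g' s) s) (hg' : ∀ s, HasDerivAt g' (g'' s) s)
    (hh : ∀ s, HasDerivAt h (h' s) s) (hh' : ∀ s, HasDerivAt h' (h'' s) s)
    (hcont : Continuous fun ρ : ℝ => ρ ^ (d - 1) * Real.exp (-ρ ^ 2) *
        ((ρ ^ 2 * g'' (ρ ^ 2) + ((d : ℝ) / 2 - ρ ^ 2) * g' (ρ ^ 2)) * h (ρ ^ 2)
          - g (ρ ^ 2) * (ρ ^ 2 * h'' (ρ ^ 2) + ((d : ℝ) / 2 - ρ ^ 2) * h' (ρ ^ 2)))) (X : ℝ) :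
    ∫ ρ in (0 : ℝ)..X, ρ ^ (d - 1) * Real.exp (-ρ ^ 2) *
        ((ρ ^ 2 * g'' (ρ ^ 2) + ((d : ℝ) / 2 - ρ ^ 2) * g' (ρ ^ 2)) * h (ρ ^ 2)
          - g (ρ ^ 2) * (ρ ^ 2 * h'' (ρ ^ 2) + ((d : ℝ) / 2 - ρ ^ 2) * h' (ρ ^ 2)))
      = X ^ d * Real.exp (-X ^ 2) / 2 * (g' (X ^ 2) * h (X ^ 2) - g (X ^ 2) * h' (X ^ 2)) := by
  -- The factor `s^b e^{-s}`, which puts `L` in divergence form, is `ρ^d exp(-ρ²)` at `s = ρ²`. The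
  -- factor 1/2 comes from `ds = 2ρ dρ`.
  have hderiv : ∀ ρ : ℝ, HasDerivAt (fun ρ : ℝ => ρ ^ d * Real.exp (-ρ ^ 2) / 2 *
      (g' (ρ ^ 2) * h (ρ ^ 2) - g (ρ ^ 2) * h' (ρ ^ 2)))
      (ρ ^ (d - 1) * Real.exp (-ρ ^ 2) *
        ((ρ ^ 2 * g'' (ρ ^ 2) + ((d : ℝ) / 2 - ρ ^ 2) * g' (ρ ^ 2)) * h (ρ ^ 2)
          - g (ρ ^ 2) * (ρ ^ 2 * h'' (ρ ^ 2) + ((d : ℝ) / 2 - ρ ^ 2) * h' (ρ ^ 2)))) ρ := by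
    intro ρ
    have h2 : HasDerivAt (fun ρ : ℝ => ρ ^ 2) (2 * ρ) ρ := by simpa using hasDerivAt_pow 2 ρ
    have c : ∀ {f f' : ℝ → ℝ}, (∀ s, HasDerivAt f (f' s) s) →
        HasDerivAt (fun ρ : ℝ => f (ρ ^ 2)) (f' (ρ ^ 2) * (2 * ρ)) ρ :=
      fun {f f'} hf => (hf (ρ ^ 2)).comp ρ h2
    have h3 := (((hasDerivAt_pow d ρ).mul h2.neg.exp).div_const 2).mul
      (((c hg').mul (c hh)).sub ((c hg).mul (c hh')))
    refine h3.congr_deriv ?_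
    have hpow : ρ ^ d = ρ ^ (d - 1) * ρ := by rw [← pow_succ]; congr; omega
    simp only [Pi.mul_apply, Pi.neg_apply, Pi.sub_apply, hpow]
    ring
  rw [intervalIntegral.integral_eq_sub_of_hasDerivAt (fun ρ _ => hderiv ρ)
    (hcont.intervalIntegrable _ _)]
  simp [show d ≠ 0 by omega]

/-- Differentiation under the integral sign: `F'` is continuous up to but not including `q = c`, so
it is bounded on the compact rectangle `[q - 1, (q + c)/2] × [0, X]`, which suffices for a local
dominating constant. -/
lemma hasDerivAt_intervalIntegral_param {F F' : ℝ → ℝ → ℝ} {c X : ℝ}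
    (hF : ∀ q < c, ∀ ρ, HasDerivAt (fun q => F q ρ) (F' q ρ) q)
    (hFc : ∀ q < c, Continuous (F q))
    (hF' : ContinuousOn (fun p : ℝ × ℝ => F' p.1 p.2) (Set.Iio c ×ˢ Set.univ)) {q : ℝ}
    (hq : q < c) :
    HasDerivAt (fun q => ∫ ρ in (0 : ℝ)..X, F q ρ) (∫ ρ in (0 : ℝ)..X, F' q ρ) q := by
  set q1 := (q + c) / 2 with hq1
  set q0 := q - 1 with hq0
  have hsub : Set.Icc q0 q1 ×ˢ Set.uIcc 0 X ⊆ Set.Iio c ×ˢ (Set.univ : Set ℝ) := by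
    refine Set.prod_mono (fun p hp => ?_) (Set.subset_univ _)
    have := hp.2
    simp only [Set.mem_Iio]
    linarith
  obtain ⟨C, hC⟩ := (isCompact_Icc.prod isCompact_uIcc).exists_bound_of_continuousOn
    (hF'.mono hsub)
  have hmem : Set.Icc q0 q1 ∈ 𝓝 q := Icc_mem_nhds (by linarith) (by linarith)
  refine (intervalIntegral.hasDerivAt_integral_of_dominated_loc_of_deriv_le (bound := fun _ => C)
    hmem ?_ ((hFc q hq).intervalIntegrable _ _) ?_ ?_ intervalIntegrable_const ?_).2
  · filter_upwards [Iio_mem_nhds hq] with p hp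
    exact (hFc p hp).aestronglyMeasurable
  · have : Continuous (F' q) := hF'.comp_continuous (f := fun s => (q, s)) (by fun_prop)
      fun s => ⟨hq, trivial⟩
    exact this.aestronglyMeasurable
  · refine .of_forall fun ρ hρ p hp => hC (p, ρ) ⟨hp, Set.uIoc_subset_uIcc hρ⟩
  · refine .of_forall fun ρ hρ p hp => hF p ?_ ρ
    have := hp.2
    linarith

/-! ### Moments of the Hille-Hardy kernel and its concentration as `q → 1` -/

section Moments

lemma hasSum_exp_euler (θ : ℝ) :
    HasSum (fun k : ℕ => θ ^ k / k !) (Real.exp θ) ∧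
    HasSum (fun k : ℕ => θ ^ k / k ! * k) (θ * Real.exp θ) ∧
    HasSum (fun k : ℕ => θ ^ k / k ! * k ^ 2) (θ * (θ + 1) * Real.exp θ) := by
  have h0 : ∀ θ : ℝ, HasSum (fun k : ℕ => (1 / k ! : ℝ) * θ ^ k) (Real.exp θ) := fun θ => by
    simpa using (hasSum_exp_mul 1 θ)
  have hc : EntireCoeff fun k : ℕ => (1 / k ! : ℝ) := fun r => (h0 r).summable
  have hd : derivCoeff (fun k : ℕ => (1 / k ! : ℝ)) = fun k : ℕ => (1 / k ! : ℝ) := by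
    ext k
    rw [derivCoeff, Nat.factorial_succ]
    push_cast
    field_simp
  have hs : ∀ θ, entireSum (fun k : ℕ => (1 / k ! : ℝ)) θ = Real.exp θ := fun θ => (h0 θ).tsum_eq
  have h1 : ∀ θ : ℝ, HasSum (fun k : ℕ => (k * (1 / k !) : ℝ) * θ ^ k) (θ * Real.exp θ) :=
    fun θ => by
      have := hc.hasSum_euler θ
      rwa [hd, hs] at this
  have hc1 : EntireCoeff fun k : ℕ => (k * (1 / k !) : ℝ) := fun r => (h1 r).summable
  have hs1 : entireSum (derivCoeff fun k : ℕ => (k * (1 / k !) : ℝ)) θ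
      = (θ + 1) * Real.exp θ := by
    have := ((h1 θ).add (h0 θ))
    rw [← add_one_mul] at this
    refine HasSum.tsum_eq (this.congr_fun fun k => ?_)
    rw [derivCoeff, Nat.factorial_succ]
    push_cast
    field_simp
  refine ⟨(h0 θ).congr_fun fun k => by ring, (h1 θ).congr_fun fun k => by ring, ?_⟩
  have := hc1.hasSum_euler θ
  rw [hs1, ← mul_assoc] at this
  exact this.congr_fun fun k => by ring

/-- Termwise integration gives `Γ(b+j+k)/Γ(b+k)` times a Poisson weight. The sequence `r` records
this ratio, a polynomial in `k`, so that `S` is a factor `exp θ` times a Poisson moment computable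
by `hasSum_exp_euler`. -/
lemma integral_besselPhi_moment {d : ℕ} (hd : 1 ≤ d) {τ θ : ℝ} (hτ : 0 < τ) (hθ : 0 ≤ θ) (j : ℕ)
    {r : ℕ → ℝ} {S : ℝ} (hr : ∀ k : ℕ, Real.Gamma ((d : ℝ) / 2 + j + k)
      = r k * Real.Gamma ((d : ℝ) / 2 + k)) (hS : HasSum (fun k : ℕ => θ ^ k / k ! * r k) S) :
    ∫ ρ in Set.Ioi (0 : ℝ), ρ ^ (d - 1) * ρ ^ (2 * j) *
        (Real.exp (-(ρ ^ 2 / τ)) * besselPhi ((d : ℝ) / 2) (θ / τ * ρ ^ 2))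
      = Real.Gamma ((d : ℝ) / 2) / 2 * τ ^ ((d : ℝ) / 2 + j) * S := by
  set b : ℝ := (d : ℝ) / 2 with hbdef
  have hb : 0 < b := by
    have : (1 : ℝ) ≤ d := by exact_mod_cast hd
    simp only [hbdef]
    linarith
  set c := kummerCoeff (fun _ => 1) b with hc
  have hc0 : ∀ k, 0 ≤ c k := kummerCoeff_nonneg hb fun _ => zero_le_one
  set F : ℕ → ℝ → ℝ := fun k ρ =>
    c k * (θ / τ) ^ k * (ρ ^ (d - 1 + 2 * j + 2 * k) * Real.exp (-(ρ ^ 2 / τ))) with hF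
  have hFint : ∀ k, IntegrableOn (F k) (Set.Ioi 0) := fun k =>
    (integrableOn_pow_mul_exp_neg_mul_sq hτ _).const_mul _
  have hFval : ∀ k, ∫ ρ in Set.Ioi (0 : ℝ), F k ρ
      = Real.Gamma b / 2 * τ ^ (b + j) * (θ ^ k / k ! * r k) := by
    intro k
    have e1 : ((((d - 1 + 2 * j + 2 * k : ℕ) : ℝ) + 1) / 2) = b + j + k := by
      have : d - 1 + 2 * j + 2 * k + 1 = d + 2 * j + 2 * k := by omega
      have : (((d - 1 + 2 * j + 2 * k : ℕ) : ℝ) + 1) = d + 2 * j + 2 * k := by exact_mod_cast this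
      rw [this, hbdef]
      ring
    simp only [hF]
    rw [integral_const_mul, integral_pow_mul_exp_neg_mul_sq hτ, e1, hr, hc, kummerCoeff_one_eq hb,
      Real.rpow_add hτ _ (k : ℝ), Real.rpow_natCast, div_pow]
    have hG : Real.Gamma (b + k) ≠ 0 := (Real.Gamma_pos_of_pos (by positivity)).ne'
    field_simp
  have key := hasSum_integral_of_summable_integral_norm (μ := volume.restrict (Set.Ioi (0 : ℝ)))
    hFint ?_
  · rw [funext hFval] at key
    have h2 := key.unique (hS.mul_left _)
    rw [← h2]
    refine setIntegral_congr_fun measurableSet_Ioi fun ρ _ => ?_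
    simp only [hF, besselPhi, entireSum]
    rw [← tsum_mul_left, ← tsum_mul_left]
    refine tsum_congr fun k => ?_
    rw [mul_pow, ← pow_mul, pow_add, pow_add]
    ring
  · have : (fun k => ∫ ρ in Set.Ioi (0 : ℝ), ‖F k ρ‖) =
        fun k : ℕ => Real.Gamma b / 2 * τ ^ (b + j) * (θ ^ k / k ! * r k) := by
      ext k
      rw [← hFval]
      refine setIntegral_congr_fun measurableSet_Ioi fun ρ hρ => ?_
      have hρ' : 0 < ρ := hρ
      exact Real.norm_of_nonneg (mul_nonneg (mul_nonneg (hc0 k) (by positivity)) (by positivity))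
    rw [this]
    exact (hS.mul_left _).summable

/-- The first moments of the Hille-Hardy kernel. -/
lemma integral_hilleHardy_moment {d : ℕ} (hd : 1 ≤ d) {q y : ℝ} (hq : 0 ≤ q) (hq1 : q < 1)
    (hy : 0 ≤ y) (j : ℕ)
    {r : ℕ → ℝ} {S : ℝ} (hr : ∀ k : ℕ, Real.Gamma ((d : ℝ) / 2 + j + k)
      = r k * Real.Gamma ((d : ℝ) / 2 + k))
    (hS : HasSum (fun k : ℕ => (q * y / (1 - q)) ^ k / k ! * r k)
      (S * Real.exp (q * y / (1 - q)))) (hS0 : 0 < S) :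
    ∫ ρ in Set.Ioi (0 : ℝ), ρ ^ (d - 1) * Real.exp (-ρ ^ 2) *
        hilleHardy ((d : ℝ) / 2) q y (ρ ^ 2) * ρ ^ (2 * j)
      = Real.Gamma ((d : ℝ) / 2) / 2 * (1 - q) ^ j * S ∧
    IntegrableOn (fun ρ : ℝ => ρ ^ (d - 1) * Real.exp (-ρ ^ 2) *
        hilleHardy ((d : ℝ) / 2) q y (ρ ^ 2) * ρ ^ (2 * j)) (Set.Ioi 0) := by
  have hτ : 0 < 1 - q := by linarith
  have hb : 0 < (d : ℝ) / 2 := by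
    have : (1 : ℝ) ≤ d := by exact_mod_cast hd
    linarith
  have h := integral_besselPhi_moment hd hτ (θ := q * y / (1 - q)) (by positivity) j hr hS
  have h1 : ∫ ρ in Set.Ioi (0 : ℝ), ρ ^ (d - 1) * Real.exp (-ρ ^ 2) *
        hilleHardy ((d : ℝ) / 2) q y (ρ ^ 2) * ρ ^ (2 * j)
      = Real.Gamma ((d : ℝ) / 2) / 2 * (1 - q) ^ j * S := by
    have e : ∀ ρ : ℝ, ρ ^ (d - 1) * Real.exp (-ρ ^ 2) *
        hilleHardy ((d : ℝ) / 2) q y (ρ ^ 2) * ρ ^ (2 * j) =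
        (1 - q) ^ (-((d : ℝ) / 2)) * Real.exp (-(q * y / (1 - q))) *
        (ρ ^ (d - 1) * ρ ^ (2 * j) * (Real.exp (-(ρ ^ 2 / (1 - q))) *
          besselPhi ((d : ℝ) / 2) (q * y / (1 - q) / (1 - q) * ρ ^ 2))) := by
      intro ρ
      have e1 : Real.exp (-ρ ^ 2) * Real.exp (-(q / (1 - q) * (y + ρ ^ 2))) =
          Real.exp (-(q * y / (1 - q))) * Real.exp (-(ρ ^ 2 / (1 - q))) := by
        rw [← Real.exp_add, ← Real.exp_add]
        congr 1
        field_simp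
        ring
      have e2 : q * y / (1 - q) / (1 - q) = q * y / (1 - q) ^ 2 := by field_simp
      rw [hilleHardy, e2]
      linear_combination (ρ ^ (d - 1) * (1 - q) ^ (-((d : ℝ) / 2)) *
        besselPhi ((d : ℝ) / 2) (q * y / (1 - q) ^ 2 * ρ ^ 2) * ρ ^ (2 * j)) * e1
    simp only [e]
    rw [integral_const_mul, h, Real.rpow_add hτ, Real.rpow_natCast, Real.rpow_neg hτ.le,
      Real.exp_neg]
    have : (1 - q) ^ ((d : ℝ) / 2) ≠ 0 := (Real.rpow_pos_of_pos hτ _).ne'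
    have := (Real.exp_pos (q * y / (1 - q))).ne'
    field_simp
  refine ⟨h1, ?_⟩
  -- The integral of a non-integrable function is 0 by convention, whereas the value just found is
  -- positive; integrability follows.
  by_contra hni
  rw [IntegrableOn] at hni
  rw [integral_undef hni] at h1
  have := Real.Gamma_pos_of_pos hb
  have : 0 < Real.Gamma ((d : ℝ) / 2) / 2 * (1 - q) ^ j * S := by positivity
  linarith

lemma integral_hilleHardy_mass {d : ℕ} (hd : 1 ≤ d) {q y : ℝ} (hq : 0 ≤ q) (hq1 : q < 1)
    (hy : 0 ≤ y) :
    ∫ ρ in Set.Ioi (0 : ℝ), ρ ^ (d - 1) * Real.exp (-ρ ^ 2) *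
        hilleHardy ((d : ℝ) / 2) q y (ρ ^ 2) = Real.Gamma ((d : ℝ) / 2) / 2 ∧
    IntegrableOn (fun ρ : ℝ => ρ ^ (d - 1) * Real.exp (-ρ ^ 2) *
        hilleHardy ((d : ℝ) / 2) q y (ρ ^ 2)) (Set.Ioi 0) := by
  have := integral_hilleHardy_moment hd hq hq1 hy 0 (r := fun _ => 1) (S := 1) (by simp)
    (by simpa using (hasSum_exp_euler (q * y / (1 - q))).1) one_pos
  simpa using this

/-- The explicit value tends to 0 as `q → 1`, which is the concentration of the kernel at `y`. It
combines the moments of order 0, 1 and 2 of `ρ²`. -/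
lemma integral_hilleHardy_variance {d : ℕ} (hd : 1 ≤ d) {q y : ℝ} (hq : 0 ≤ q) (hq1 : q < 1)
    (hy : 0 ≤ y) :
    ∫ ρ in Set.Ioi (0 : ℝ), ρ ^ (d - 1) * Real.exp (-ρ ^ 2) *
        hilleHardy ((d : ℝ) / 2) q y (ρ ^ 2) * (ρ ^ 2 - y) ^ 2 =
      Real.Gamma ((d : ℝ) / 2) / 2 * ((1 - q) ^ 2 * y ^ 2
        + 2 * (1 - q) * y * (((d : ℝ) / 2 + 1) * q - (d : ℝ) / 2)
        + (1 - q) ^ 2 * ((d : ℝ) / 2) * ((d : ℝ) / 2 + 1)) ∧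
    IntegrableOn (fun ρ : ℝ => ρ ^ (d - 1) * Real.exp (-ρ ^ 2) *
        hilleHardy ((d : ℝ) / 2) q y (ρ ^ 2) * (ρ ^ 2 - y) ^ 2) (Set.Ioi 0) := by
  have hτ : 0 < 1 - q := by linarith
  have hb : 0 < (d : ℝ) / 2 := by
    have : (1 : ℝ) ≤ d := by exact_mod_cast hd
    linarith
  set b := (d : ℝ) / 2
  set θ := q * y / (1 - q) with hθ
  have hθ0 : 0 ≤ θ := by positivity
  obtain ⟨p0, p1, p2⟩ := hasSum_exp_euler θ
  obtain ⟨m0, i0⟩ := integral_hilleHardy_mass hd hq hq1 hy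
  obtain ⟨m1, i1⟩ := integral_hilleHardy_moment hd hq hq1 hy 1 (r := fun k => b + k) (S := b + θ)
    (fun k => by
      rw [← Real.Gamma_add_one (by positivity)]
      congr 1
      push_cast
      ring)
    (by
      have := (p0.mul_left b).add p1
      rw [← add_mul] at this
      exact this.congr_fun fun k => by ring) (by positivity)
  obtain ⟨m2, i2⟩ := integral_hilleHardy_moment hd hq hq1 hy 2
    (r := fun k => (b + k + 1) * (b + k)) (S := θ * (θ + 1) + (2 * b + 1) * θ + b * (b + 1))
    (fun k => by
      rw [mul_assoc, ← Real.Gamma_add_one (by positivity), ← Real.Gamma_add_one (by positivity)]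
      congr 1
      push_cast
      ring)
    (by
      have := (p2.add (p1.mul_left (2 * b + 1))).add (p0.mul_left (b * (b + 1)))
      rw [← mul_assoc, ← add_mul, ← add_mul] at this
      exact this.congr_fun fun k => by ring) (by positivity)
  have e : ∀ ρ : ℝ, ρ ^ (d - 1) * Real.exp (-ρ ^ 2) * hilleHardy b q y (ρ ^ 2) * (ρ ^ 2 - y) ^ 2
      = (ρ ^ (d - 1) * Real.exp (-ρ ^ 2) * hilleHardy b q y (ρ ^ 2) * ρ ^ (2 * 2)
        - 2 * y * (ρ ^ (d - 1) * Real.exp (-ρ ^ 2) * hilleHardy b q y (ρ ^ 2) * ρ ^ (2 * 1)))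
        + y ^ 2 * (ρ ^ (d - 1) * Real.exp (-ρ ^ 2) * hilleHardy b q y (ρ ^ 2)) := fun ρ => by ring
  simp only [e]
  refine ⟨?_, (i2.sub (i1.const_mul (2 * y))).add (i0.const_mul (y ^ 2))⟩
  refine (integral_add (i2.sub (i1.const_mul (2 * y))) (i0.const_mul (y ^ 2))).trans ?_
  rw [integral_sub' i2 (i1.const_mul (2 * y)), integral_const_mul, integral_const_mul, m0, m1, m2]
  have hθτ : θ * (1 - q) = q * y := by rw [hθ]; field_simp
  linear_combination (Real.Gamma b / 2) * ((θ * (1 - q) + q * y) + 2 * (b + 1) * (1 - q)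
    - 2 * y) * hθτ

end Moments

/-- The Hille-Hardy kernel is an approximation of the identity as `q → 1`. -/
lemma tendsto_integral_hilleHardy {d : ℕ} (hd : 1 ≤ d) {y X L : ℝ} (hX : 0 < X) (hy : 0 ≤ y)
    (hyX : y ≤ X ^ 2) {h : ℝ → ℝ} (hh : Continuous h) (hhX : h (X ^ 2) = 0)
    (hL : ∀ s ∈ Set.Icc 0 (X ^ 2), |h s - h y| ≤ L * |s - y|) :
    Tendsto (fun q => ∫ ρ in (0 : ℝ)..X, ρ ^ (d - 1) * Real.exp (-ρ ^ 2) *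
      hilleHardy ((d : ℝ) / 2) q y (ρ ^ 2) * h (ρ ^ 2)) (𝓝[<] 1)
      (𝓝 (Real.Gamma ((d : ℝ) / 2) / 2 * h y)) := by
  have hb : 0 < (d : ℝ) / 2 := by
    have : (1 : ℝ) ≤ d := by exact_mod_cast hd
    linarith
  set b := (d : ℝ) / 2
  set V : ℝ → ℝ := fun q => Real.Gamma b / 2 * ((1 - q) ^ 2 * y ^ 2
        + 2 * (1 - q) * y * ((b + 1) * q - b) + (1 - q) ^ 2 * b * (b + 1)) with hV
  have hΓ := Real.Gamma_pos_of_pos hb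
  have hL0 : 0 ≤ |L| := abs_nonneg L
  set κ : ℝ → ℝ → ℝ := fun q ρ => ρ ^ (d - 1) * Real.exp (-ρ ^ 2) * hilleHardy b q y (ρ ^ 2) with hκ
  -- A Chebyshev-type bound: the error is at most `|L|` times the kernel average of `|ρ² - y|`,
  -- which is split into total mass and variance by `|z| ≤ δ + z²/δ`.
  have key : ∀ q ∈ Set.Ioo (0 : ℝ) 1, ∀ δ > 0, |(∫ ρ in (0 : ℝ)..X, κ q ρ * h (ρ ^ 2))
      - Real.Gamma b / 2 * h y| ≤ |L| * (δ * (Real.Gamma b / 2) + V q / δ) := by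
    intro q hq δ hδ
    obtain ⟨m0, i0⟩ := integral_hilleHardy_mass hd hq.1.le hq.2 hy
    obtain ⟨mv, iv⟩ := integral_hilleHardy_variance hd hq.1.le hq.2 hy
    have hκc : Continuous (κ q) := by
      have := continuous_hilleHardy hb hq.2 y
      fun_prop
    have hi : IntegrableOn (fun ρ => Set.indicator (Set.Ioc 0 X) (fun ρ => κ q ρ * h (ρ ^ 2)) ρ)
        (Set.Ioi 0) := by
      have h1 : IntegrableOn (fun ρ => κ q ρ * h (ρ ^ 2)) (Set.Ioc 0 X) :=
        ((by fun_prop : Continuous fun ρ => κ q ρ * h (ρ ^ 2)).integrableOn_Icc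
          (a := 0) (b := X)).mono_set Set.Ioc_subset_Icc_self
      exact (h1.integrable_indicator measurableSet_Ioc).integrableOn
    have e1 : ∫ ρ in (0 : ℝ)..X, κ q ρ * h (ρ ^ 2) =
        ∫ ρ in Set.Ioi (0 : ℝ), Set.indicator (Set.Ioc 0 X) (fun ρ => κ q ρ * h (ρ ^ 2)) ρ := by
      rw [intervalIntegral.integral_of_le hX.le, setIntegral_indicator measurableSet_Ioc,
        Set.inter_eq_self_of_subset_right Set.Ioc_subset_Ioi_self]
    have e2 : |L| * (δ * (Real.Gamma b / 2) + V q / δ) =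
        ∫ ρ in Set.Ioi (0 : ℝ), |L| * (δ * κ q ρ + κ q ρ * (ρ ^ 2 - y) ^ 2 / δ) := by
      rw [integral_const_mul, integral_add (i0.const_mul δ) (iv.div_const δ), integral_const_mul,
        integral_div, m0, mv]
    rw [e2, e1, ← m0, ← integral_mul_const, ← integral_sub hi (i0.mul_const _),
      ← Real.norm_eq_abs]
    refine norm_integral_le_of_norm_le
      (((i0.const_mul δ).add (iv.div_const δ)).const_mul _) ?_
    refine (ae_restrict_iff' measurableSet_Ioi).2 (.of_forall fun ρ hρ => ?_)
    have hρ' : 0 < ρ := hρ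
    have hκ0 : 0 ≤ κ q ρ := mul_nonneg (by positivity)
      (hilleHardy_nonneg hb hq.1.le hq.2 hy (by positivity))
    have hlip : |Set.indicator (Set.Ioc 0 X) (fun ρ => h (ρ ^ 2)) ρ - h y| ≤ |L| * |ρ ^ 2 - y| := by
      by_cases hρX : ρ ≤ X
      · have hmem : ρ ∈ Set.Ioc 0 X := ⟨hρ', hρX⟩
        rw [Set.indicator_of_mem hmem]
        refine (hL _ ⟨by positivity, by gcongr⟩).trans ?_
        gcongr
        exact le_abs_self L
      -- Beyond `X` the cut-off function is 0, which equals `h (X²)`. Since `y ≤ X² < ρ²`, the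
      -- Lipschitz bound persists outside the interval, even when `y = X²`; no half-weight appears
      -- at the endpoint.
      · rw [Set.indicator_of_notMem (fun hmem => hρX hmem.2), ← hhX]
        refine (hL _ ⟨by positivity, le_rfl⟩).trans ?_
        have hlt : X ^ 2 ≤ ρ ^ 2 := by
          have := not_le.1 hρX
          gcongr
        refine mul_le_mul (le_abs_self L) ?_ (abs_nonneg _) (abs_nonneg _)
        rw [abs_of_nonneg (by linarith), abs_of_nonneg (by linarith)]
        linarith
    have hamgm : |ρ ^ 2 - y| ≤ δ + (ρ ^ 2 - y) ^ 2 / δ := by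
      rw [← sq_abs (ρ ^ 2 - y)]
      rw [← sub_nonneg]
      have : δ + |ρ ^ 2 - y| ^ 2 / δ - |ρ ^ 2 - y| =
          ((δ - |ρ ^ 2 - y| / 2) ^ 2 + 3 / 4 * |ρ ^ 2 - y| ^ 2) / δ := by
        field_simp
        ring
      rw [this]
      positivity
    have e3 : Set.indicator (Set.Ioc 0 X) (fun ρ => κ q ρ * h (ρ ^ 2)) ρ - κ q ρ * h y =
        κ q ρ * (Set.indicator (Set.Ioc 0 X) (fun ρ => h (ρ ^ 2)) ρ - h y) := by
      by_cases hm : ρ ∈ Set.Ioc 0 X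
      · simp [hm]
        ring
      · simp [hm]
    rw [Real.norm_eq_abs]
    change |Set.indicator (Set.Ioc 0 X) (fun ρ => κ q ρ * h (ρ ^ 2)) ρ - κ q ρ * h y| ≤ _
    rw [e3, abs_mul, abs_of_nonneg hκ0]
    calc κ q ρ * _ ≤ κ q ρ * (|L| * (δ + (ρ ^ 2 - y) ^ 2 / δ)) := by
          gcongr
          exact hlip.trans (by gcongr)
      _ = _ := by ring
  have hV0 : Tendsto V (𝓝[<] 1) (𝓝 0) := by
    have : Continuous V := by fun_prop
    have h2 := this.tendsto 1
    simp only [hV, sub_self] at h2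
    norm_num at h2
    exact h2.mono_left nhdsWithin_le_nhds
  rw [Metric.tendsto_nhds]
  intro ε hε
  -- This `δ` makes the mass term equal to `ε/(2(|L|+1))`; the variance term is then made as small
  -- by taking `q` close to 1.
  set δ := ε / (2 * (|L| + 1) * (Real.Gamma b / 2)) with hδ
  have hδ0 : 0 < δ := by positivity
  have hVs : ∀ᶠ q in 𝓝[<] (1 : ℝ), V q < ε * δ / (2 * (|L| + 1)) :=
    hV0.eventually (gt_mem_nhds (by positivity))
  filter_upwards [hVs, Ioo_mem_nhdsLT (zero_lt_one' ℝ)] with q hq1 hq2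
  rw [Real.dist_eq]
  refine (key q hq2 δ hδ0).trans_lt ?_
  have h1 : V q / δ < ε / (2 * (|L| + 1)) := by
    rw [div_lt_iff₀ hδ0]
    refine hq1.trans_le (le_of_eq ?_)
    ring
  have h2 : δ * (Real.Gamma b / 2) = ε / (2 * (|L| + 1)) := by
    rw [hδ]
    field_simp
  calc |L| * (δ * (Real.Gamma b / 2) + V q / δ)
      ≤ |L| * (ε / (2 * (|L| + 1)) + ε / (2 * (|L| + 1))) := by
        gcongr
        exact h2.le
    _ = ε * (|L| / (|L| + 1)) := by field_simp; ring
    _ < ε * 1 := by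
        gcongr
        rw [div_lt_one (by positivity)]
        linarith
    _ = ε := mul_one ε

end

/-! ### Integral representation of a Kummer function cut off at a zero -/

noncomputable section

section Representation

variable {d : ℕ} (hd : 1 ≤ d)

include hd

lemma half_dim_pos : 0 < (d : ℝ) / 2 := by
  have : (1 : ℝ) ≤ d := by exact_mod_cast hd
  linarith

/-- The equation satisfied by the image of a Kummer function, cut off at one of its zeros, under
the Hille-Hardy kernel. -/
lemma hasDerivAt_integral_hilleHardy_kummerM {a X : ℝ} (hX : kummerM a ((d : ℝ) / 2) (X ^ 2) = 0)
    (y : ℝ) {q : ℝ} (hq : 0 < q) (hq1 : q < 1) :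
    HasDerivAt (fun q => ∫ ρ in (0 : ℝ)..X, ρ ^ (d - 1) * Real.exp (-ρ ^ 2) *
        hilleHardy ((d : ℝ) / 2) q y (ρ ^ 2) * kummerM a ((d : ℝ) / 2) (ρ ^ 2))
      (-(a / q) * ((∫ ρ in (0 : ℝ)..X, ρ ^ (d - 1) * Real.exp (-ρ ^ 2) *
        hilleHardy ((d : ℝ) / 2) q y (ρ ^ 2) * kummerM a ((d : ℝ) / 2) (ρ ^ 2))
        - (∫ ρ in (0 : ℝ)..X, ρ ^ (d - 1) * Real.exp (-ρ ^ 2) * kummerM a ((d : ℝ) / 2) (ρ ^ 2))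
          * hilleHardy ((d : ℝ) / 2) q y (X ^ 2))) q := by
  have hb := half_dim_pos hd
  set b := (d : ℝ) / 2 with hbdef
  have hMc := continuous_kummerM hb a
  have hMc' := continuous_kummerM' hb a
  have hMc'' := continuous_kummerM'' hb a
  have hKc := continuous_hilleHardy hb hq1 y
  have hKq := continuous_hilleHardyQ hb hq1 y
  have hpde := fun s => hilleHardy_pde hb hq1 y s
  have hode := fun s => kummerM_ode hb a s
  have key := hasDerivAt_intervalIntegral_param (c := 1) (X := X)
    (F := fun q ρ => ρ ^ (d - 1) * Real.exp (-ρ ^ 2) * hilleHardy b q y (ρ ^ 2) *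
      kummerM a b (ρ ^ 2))
    (F' := fun q ρ => ρ ^ (d - 1) * Real.exp (-ρ ^ 2) * hilleHardyQ b q y (ρ ^ 2) *
      kummerM a b (ρ ^ 2)) ?_ ?_ ?_ hq1
  · refine key.congr_deriv ?_
    -- Green's identity for `K` and `M`: as `M` vanishes at `X²`, the only boundary term is `K(X²)`
    -- times the flux of `M`. The second application, with the constant 1 in place of `K`, evaluates
    -- that flux as `a I₀`.
    have g1 := integral_green hd (hasDerivAt_hilleHardy_s hb q y) (hasDerivAt_hilleHardyS hb q y)
      (hasDerivAt_kummerM hb a) (hasDerivAt_kummerM' hb a) (by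
        rw [← hbdef]
        have : ∀ s, s * hilleHardySS b q y s + (b - s) * hilleHardyS b q y s
          = -(q * hilleHardyQ b q y s) := fun s => by rw [hpde]; ring
        simp only [this]
        fun_prop) X
    have g2 := integral_green hd (g := fun _ => 1) (g' := fun _ => 0) (g'' := fun _ => 0)
      (fun s => hasDerivAt_const s 1) (fun s => hasDerivAt_const s 0)
      (hasDerivAt_kummerM hb a) (hasDerivAt_kummerM' hb a) (by fun_prop) X
    rw [← hbdef] at g1 g2
    simp only [hode] at g1 g2
    have e1 : ∀ ρ : ℝ, ρ ^ (d - 1) * Real.exp (-ρ ^ 2) *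
        ((ρ ^ 2 * hilleHardySS b q y (ρ ^ 2) + (b - ρ ^ 2) * hilleHardyS b q y (ρ ^ 2)) *
          kummerM a b (ρ ^ 2) - hilleHardy b q y (ρ ^ 2) * (a * kummerM a b (ρ ^ 2))) =
        (-q) * (ρ ^ (d - 1) * Real.exp (-ρ ^ 2) * hilleHardyQ b q y (ρ ^ 2) * kummerM a b (ρ ^ 2))
        - a * (ρ ^ (d - 1) * Real.exp (-ρ ^ 2) * hilleHardy b q y (ρ ^ 2) * kummerM a b (ρ ^ 2)) :=
      fun ρ => by
        linear_combination (ρ ^ (d - 1) * Real.exp (-ρ ^ 2) * kummerM a b (ρ ^ 2)) * hpde (ρ ^ 2)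
    have e2 : ∀ ρ : ℝ, ρ ^ (d - 1) * Real.exp (-ρ ^ 2) *
        ((ρ ^ 2 * 0 + (b - ρ ^ 2) * 0) * kummerM a b (ρ ^ 2) - 1 * (a * kummerM a b (ρ ^ 2))) =
        (-a) * (ρ ^ (d - 1) * Real.exp (-ρ ^ 2) * kummerM a b (ρ ^ 2)) := fun ρ => by ring
    simp only [e1] at g1
    simp only [e2] at g2
    rw [intervalIntegral.integral_sub (Continuous.intervalIntegrable (by fun_prop) _ _)
      (Continuous.intervalIntegrable (by fun_prop) _ _), intervalIntegral.integral_const_mul,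
      intervalIntegral.integral_const_mul, hX] at g1
    rw [intervalIntegral.integral_const_mul] at g2
    field_simp
    linear_combination (-1) * g1 + hilleHardy b q y (X ^ 2) * g2
  · intro p hp ρ
    exact ((hasDerivAt_hilleHardy_q hb hp y (ρ ^ 2)).const_mul _).mul_const _
  · intro p hp
    have := continuous_hilleHardy hb hp y
    fun_prop
  · have h1 : ContinuousOn (fun p : ℝ × ℝ => hilleHardyQ b p.1 y (p.2 ^ 2))
        (Set.Iio 1 ×ˢ Set.univ) :=
      (continuousOn_hilleHardyQ hb y).comp (f := fun p : ℝ × ℝ => (p.1, p.2 ^ 2)) (by fun_prop)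
        fun p hp => ⟨hp.1, trivial⟩
    exact ContinuousOn.mul (ContinuousOn.mul (by fun_prop) h1) (by fun_prop)

/-- Only the existence of the derivative matters: it gives `I(q) - I(0) = O(q)` near 0. -/
lemma exists_hasDerivAt_integral_hilleHardy (X y : ℝ) {h : ℝ → ℝ} (hh : Continuous h) :
    ∃ D, HasDerivAt (fun q => ∫ ρ in (0 : ℝ)..X, ρ ^ (d - 1) * Real.exp (-ρ ^ 2) *
        hilleHardy ((d : ℝ) / 2) q y (ρ ^ 2) * h (ρ ^ 2)) D 0 := by
  have hb := half_dim_pos hd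
  set b := (d : ℝ) / 2 with hbdef
  refine ⟨_, hasDerivAt_intervalIntegral_param (c := 1) (X := X)
    (F := fun q ρ => ρ ^ (d - 1) * Real.exp (-ρ ^ 2) * hilleHardy b q y (ρ ^ 2) * h (ρ ^ 2))
    (F' := fun q ρ => ρ ^ (d - 1) * Real.exp (-ρ ^ 2) * hilleHardyQ b q y (ρ ^ 2) * h (ρ ^ 2))
    ?_ ?_ ?_ one_pos⟩
  · intro p hp ρ
    exact ((hasDerivAt_hilleHardy_q hb hp y (ρ ^ 2)).const_mul _).mul_const _
  · intro p hp
    have := continuous_hilleHardy hb hp y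
    fun_prop
  · have h1 : ContinuousOn (fun p : ℝ × ℝ => hilleHardyQ b p.1 y (p.2 ^ 2))
        (Set.Iio 1 ×ˢ Set.univ) :=
      (continuousOn_hilleHardyQ hb y).comp (f := fun p : ℝ × ℝ => (p.1, p.2 ^ 2)) (by fun_prop)
        fun p hp => ⟨hp.1, trivial⟩
    exact ContinuousOn.mul (ContinuousOn.mul (by fun_prop) h1) (by fun_prop)

/-- The function `u^(2a) (I(u²) - I₀)` has the integrand as derivative, tends to 0 at 0 and to
`Γ(b)/2 · M(y) - I₀` at 1. Integrability is a hypothesis of the first part and the conclusion of the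
second, because the second needs `I₀ ≠ 0`, and that is deduced from the first, whose integrand is
identically zero when `I₀ = 0`. -/
lemma kummerM_sub_eq_integral {a X : ℝ} (ha : -1 < a) (hX0 : 0 < X)
    (hX : kummerM a ((d : ℝ) / 2) (X ^ 2) = 0) {y : ℝ} (hy : y ∈ Set.Icc 0 (X ^ 2)) {I₀ : ℝ}
    (hI₀ : I₀ = ∫ ρ in (0 : ℝ)..X, ρ ^ (d - 1) * Real.exp (-ρ ^ 2) *
      kummerM a ((d : ℝ) / 2) (ρ ^ 2)) :
    (IntervalIntegrable (fun u : ℝ => 2 * a * I₀ *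
        ((hilleHardy ((d : ℝ) / 2) (u ^ 2) (X ^ 2) y - 1) * u ^ (2 * a - 1))) volume 0 1 →
      Real.Gamma ((d : ℝ) / 2) / 2 * kummerM a ((d : ℝ) / 2) y - I₀ =
        ∫ u in (0 : ℝ)..1, 2 * a * I₀ *
          ((hilleHardy ((d : ℝ) / 2) (u ^ 2) (X ^ 2) y - 1) * u ^ (2 * a - 1))) ∧
    (a ≠ 0 → I₀ ≠ 0 → IntervalIntegrable (fun u : ℝ =>
      (hilleHardy ((d : ℝ) / 2) (u ^ 2) (X ^ 2) y - 1) * u ^ (2 * a - 1)) volume 0 1) := by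
  have hb := half_dim_pos hd
  set b := (d : ℝ) / 2 with hbdef
  have hMc := continuous_kummerM hb a
  obtain ⟨I, hI⟩ : ∃ I : ℝ → ℝ, I = fun q => ∫ ρ in (0 : ℝ)..X, ρ ^ (d - 1) * Real.exp (-ρ ^ 2) *
        hilleHardy b q y (ρ ^ 2) * kummerM a b (ρ ^ 2) := ⟨_, rfl⟩
  have hI0 : I 0 = I₀ := by simp [hI, hI₀]
  have hId : ∀ q, 0 < q → q < 1 →
      HasDerivAt I (-(a / q) * (I q - I₀ * hilleHardy b q (X ^ 2) y)) q := by
    intro q hq hq1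
    have := hasDerivAt_integral_hilleHardy_kummerM hd hX y hq hq1
    rwa [← hbdef, ← hI₀, ← hI, hilleHardy_comm b q y, show (∫ ρ in (0 : ℝ)..X, ρ ^ (d - 1) *
      Real.exp (-ρ ^ 2) * hilleHardy b q y (ρ ^ 2) * kummerM a b (ρ ^ 2)) = I q by rw [hI]] at this
  have hsq : ∀ u : ℝ, HasDerivAt (fun u : ℝ => u ^ 2) (2 * u) u := fun u => by
    simpa using hasDerivAt_pow 2 u
  have hGd : ∀ u ∈ Set.Ioo (0 : ℝ) 1, HasDerivAt (fun u : ℝ => u ^ (2 * a) * I (u ^ 2))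
      (2 * a * I₀ * (u ^ (2 * a - 1) * hilleHardy b (u ^ 2) (X ^ 2) y)) u := by
    intro u hu
    have hu0 := hu.1
    have h1 := (Real.hasDerivAt_rpow_const (p := 2 * a) (Or.inl hu0.ne')).mul
      ((hId (u ^ 2) (by positivity) (by nlinarith [hu.1, hu.2])).comp u (hsq u))
    refine h1.congr_deriv ?_
    rw [Real.rpow_sub_one hu0.ne']
    simp only [Function.comp_apply]
    field_simp
    ring
  have hgd : ∀ u ∈ Set.Ioo (0 : ℝ) 1, HasDerivAt (fun u : ℝ => u ^ (2 * a) * I (u ^ 2) -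
      I₀ * u ^ (2 * a)) (2 * a * I₀ *
        ((hilleHardy b (u ^ 2) (X ^ 2) y - 1) * u ^ (2 * a - 1))) u := by
    intro u hu
    refine ((hGd u hu).sub ((Real.hasDerivAt_rpow_const (p := 2 * a)
      (Or.inl hu.1.ne')).const_mul I₀)).congr_deriv ?_
    ring
  have hsq0 : Tendsto (fun u : ℝ => u ^ 2) (𝓝[>] 0) (𝓝 0) := by
    have : Tendsto (fun u : ℝ => u ^ 2) (𝓝 0) (𝓝 (0 ^ 2)) := (continuous_pow 2).tendsto 0
    rw [zero_pow two_ne_zero] at this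
    exact this.mono_left nhdsWithin_le_nhds
  have hlim0 : Tendsto (fun u : ℝ => u ^ (2 * a) * I (u ^ 2) - I₀ * u ^ (2 * a)) (𝓝[>] 0)
      (𝓝 0) := by
    obtain ⟨D, hD⟩ := exists_hasDerivAt_integral_hilleHardy hd X y hMc
    rw [← hbdef, ← hI] at hD
    obtain ⟨C, hC⟩ := hD.isBigO_sub.bound
    -- The bound `I(u²) - I₀ = O(u²)` leaves `u^(2a+2)`, which tends to 0 because `a > -1`.
    have hpow : Tendsto (fun u : ℝ => C * u ^ (2 * a + 2)) (𝓝[>] 0) (𝓝 0) := by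
      have : Tendsto (fun u : ℝ => C * u ^ (2 * a + 2)) (𝓝 0) (𝓝 (C * 0 ^ (2 * a + 2))) :=
        ((Real.continuousAt_rpow_const 0 _ (Or.inr (by linarith))).const_mul C)
      rw [Real.zero_rpow (by linarith), mul_zero] at this
      exact this.mono_left nhdsWithin_le_nhds
    refine squeeze_zero_norm' ?_ hpow
    filter_upwards [hsq0.eventually hC, self_mem_nhdsWithin] with u hu hu0
    have hu0' : (0 : ℝ) < u := hu0
    rw [hI0, sub_zero, Real.norm_of_nonneg (by positivity : (0 : ℝ) ≤ u ^ 2)] at hu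
    rw [show u ^ (2 * a) * I (u ^ 2) - I₀ * u ^ (2 * a) = u ^ (2 * a) * (I (u ^ 2) - I₀) by ring,
      norm_mul, Real.norm_of_nonneg (by positivity), Real.rpow_add hu0', Real.rpow_two]
    calc u ^ (2 * a) * ‖I (u ^ 2) - I₀‖ ≤ u ^ (2 * a) * (C * u ^ 2) := by gcongr
      _ = _ := by ring
  have hsq1 : Tendsto (fun u : ℝ => u ^ 2) (𝓝[<] 1) (𝓝[<] 1) := by
    refine tendsto_nhdsWithin_iff.2 ⟨?_, ?_⟩
    · have : Tendsto (fun u : ℝ => u ^ 2) (𝓝 1) (𝓝 (1 ^ 2)) := (continuous_pow 2).tendsto 1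
      rw [one_pow] at this
      exact this.mono_left nhdsWithin_le_nhds
    · filter_upwards [Ioo_mem_nhdsLT (zero_lt_one' ℝ)] with u hu
      simp only [Set.mem_Iio]
      nlinarith [hu.1, hu.2]
  have hrp1 : Tendsto (fun u : ℝ => u ^ (2 * a)) (𝓝[<] 1) (𝓝 1) := by
    have : Tendsto (fun u : ℝ => u ^ (2 * a)) (𝓝 1) (𝓝 (1 ^ (2 * a))) :=
      Real.continuousAt_rpow_const 1 _ (Or.inl one_ne_zero)
    rw [Real.one_rpow] at this
    exact this.mono_left nhdsWithin_le_nhds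
  have hlimI : Tendsto I (𝓝[<] 1) (𝓝 (Real.Gamma b / 2 * kummerM a b y)) := by
    obtain ⟨L, hL⟩ := (isCompact_Icc (a := (0 : ℝ)) (b := X ^ 2)).exists_bound_of_continuousOn
      (continuous_kummerM' hb a).continuousOn
    rw [hI]
    refine tendsto_integral_hilleHardy hd hX0 hy.1 hy.2 hMc hX (L := L) fun s hs => ?_
    exact Convex.norm_image_sub_le_of_norm_hasDerivWithin_le
      (fun x _ => (hasDerivAt_kummerM hb a x).hasDerivWithinAt) hL (convex_Icc _ _) hy hs
  have hlimG : Tendsto (fun u : ℝ => u ^ (2 * a) * I (u ^ 2)) (𝓝[<] 1)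
      (𝓝 (Real.Gamma b / 2 * kummerM a b y)) := by
    simpa using hrp1.mul (hlimI.comp hsq1)
  refine ⟨fun hint => ?_, fun ha0 hI₀0 => ?_⟩
  · have := intervalIntegral.integral_eq_sub_of_hasDerivAt_of_tendsto one_pos hgd hint hlim0
      (by simpa using hlimG.sub (hrp1.const_mul I₀))
    rw [this, sub_zero]
  · obtain ⟨C, hC⟩ := (hasDerivAt_hilleHardy_q hb one_pos (X ^ 2) y).isBigO_sub.bound
    obtain ⟨ε, hε0, hε⟩ := mem_nhdsGT_iff_exists_Ioc_subset.1 (hsq0.eventually hC)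
    have hε0' : (0 : ℝ) < ε := hε0
    set η := min ε (1 / 2) with hη
    have hη0 : 0 < η := by positivity
    have hη1 : η < 1 := (min_le_right _ _).trans_lt (by norm_num)
    have hcont : ContinuousOn (fun u : ℝ => (hilleHardy b (u ^ 2) (X ^ 2) y - 1) * u ^ (2 * a - 1))
        (Set.Ioo 0 1) := by
      refine ContinuousOn.mul (ContinuousOn.sub ?_ continuousOn_const) ?_
      · refine (continuousOn_hilleHardy hb (X ^ 2)).comp (f := fun u : ℝ => (u ^ 2, y))
          (by fun_prop) fun u hu => ⟨?_, trivial⟩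
        simp only [Set.mem_Iio]
        nlinarith [hu.1, hu.2]
      · exact ContinuousOn.rpow_const continuousOn_id fun u hu => Or.inl hu.1.ne'
    -- Near 0, `K - 1 = O(u²)`, so the integrand is `O(u^(2a+1))`, with exponent greater than -1.
    have h1 : IntervalIntegrable (fun u : ℝ =>
        (hilleHardy b (u ^ 2) (X ^ 2) y - 1) * u ^ (2 * a - 1)) volume 0 η := by
      have hd1 : IntervalIntegrable (fun u : ℝ => C * u ^ (2 * a + 1)) volume 0 η :=
        (intervalIntegral.intervalIntegrable_rpow' (by linarith)).const_mul C
      refine hd1.mono_fun' ?_ ?_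
      · rw [Set.uIoc_of_le hη0.le]
        exact (hcont.mono fun u hu => ⟨hu.1, hu.2.trans_lt hη1⟩).aestronglyMeasurable
          measurableSet_Ioc
      · rw [Set.uIoc_of_le hη0.le]
        refine (ae_restrict_iff' measurableSet_Ioc).2 (.of_forall fun u hu => ?_)
        have hu0 := hu.1
        have := hε ⟨hu.1, hu.2.trans (min_le_left _ _)⟩
        simp only [hilleHardy_zero, sub_zero, Set.mem_ofPred_eq] at this
        rw [Real.norm_of_nonneg (by positivity : (0 : ℝ) ≤ u ^ 2)] at this
        simp only
        rw [norm_mul, Real.norm_of_nonneg (by positivity : (0 : ℝ) ≤ u ^ (2 * a - 1)),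
          show 2 * a + 1 = 2 + (2 * a - 1) by ring, Real.rpow_add hu0, Real.rpow_two]
        calc _ ≤ C * u ^ 2 * u ^ (2 * a - 1) := by gcongr
          _ = _ := by ring
    have h2 : IntervalIntegrable (fun u : ℝ =>
        (hilleHardy b (u ^ 2) (X ^ 2) y - 1) * u ^ (2 * a - 1)) volume η 1 := by
      have hc : 2 * a * I₀ ≠ 0 := by positivity
      -- Near 1 no bound on `K` is needed: `u^(2a-1) K` is nonnegative and has the primitive `G`,
      -- continuous up to 1 once its limit is assigned there. A nonnegative derivative of such a
      -- function is integrable.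
      set G : ℝ → ℝ := Function.update (fun u : ℝ => u ^ (2 * a) * I (u ^ 2) / (2 * a * I₀)) 1
        (Real.Gamma b / 2 * kummerM a b y / (2 * a * I₀)) with hG
      have hGI : ∀ u ∈ Set.Ioo η 1, HasDerivAt G
          (u ^ (2 * a - 1) * hilleHardy b (u ^ 2) (X ^ 2) y) u := by
        intro u hu
        have := (hGd u ⟨hη0.trans hu.1, hu.2⟩).div_const (2 * a * I₀)
        rw [mul_div_cancel_left₀ _ hc] at this
        refine this.congr_of_eventuallyEq ?_
        filter_upwards [eventually_ne_nhds hu.2.ne] with w hw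
        simp [hG, Function.update_of_ne hw]
      have hGc : ContinuousOn G (Set.Icc η 1) := by
        intro u hu
        rcases eq_or_lt_of_le hu.2 with rfl | hu1
        · rw [hG, continuousWithinAt_update_same]
          refine (hlimG.div_const _).mono_left (nhdsWithin_mono _ ?_)
          rintro w ⟨hw1, hw2⟩
          exact lt_of_le_of_ne hw1.2 hw2
        · have := (hGd u ⟨hη0.trans_le hu.1, hu1⟩).div_const (2 * a * I₀)
          refine (this.congr_of_eventuallyEq ?_).continuousAt.continuousWithinAt
          filter_upwards [eventually_ne_nhds hu1.ne] with w hw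
          simp [hG, Function.update_of_ne hw]
      have h3 := intervalIntegral.integrableOn_deriv_of_nonneg hGc hGI fun u hu => by
        have hu0 := hη0.trans hu.1
        exact mul_nonneg (by positivity) (hilleHardy_nonneg hb (by positivity)
          (by nlinarith [hu.1, hu.2]) (by positivity) hy.1)
      have h4 : IntervalIntegrable (fun u : ℝ => u ^ (2 * a - 1)) volume η 1 :=
        intervalIntegral.intervalIntegrable_rpow (Or.inr (by
          rw [Set.uIcc_of_le hη1.le]
          exact fun h => absurd h.1 (not_le.2 hη0)))
      have h5 := ((intervalIntegrable_iff_integrableOn_Ioc_of_le hη1.le).2 h3).sub h4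
      refine h5.congr fun u _ => ?_
      ring
    exact h1.trans h2

/-- The integral representation of a Kummer function on the interval between the origin and one of
its zeros. -/
theorem kummerM_representation {a X : ℝ} (ha : -1 < a) (ha0 : a < 0) (hX0 : 0 < X)
    (hX : kummerM a ((d : ℝ) / 2) (X ^ 2) = 0) {y : ℝ} (hy : y ∈ Set.Icc 0 (X ^ 2)) :
    (∫ ρ in (0 : ℝ)..X, ρ ^ (d - 1) * Real.exp (-ρ ^ 2) * kummerM a ((d : ℝ) / 2) (ρ ^ 2)) ≠ 0 ∧
    IntervalIntegrable (fun u : ℝ =>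
      (hilleHardy ((d : ℝ) / 2) (u ^ 2) (X ^ 2) y - 1) * u ^ (2 * a - 1)) volume 0 1 ∧
    kummerM a ((d : ℝ) / 2) y = 2 / Real.Gamma ((d : ℝ) / 2) *
      (∫ ρ in (0 : ℝ)..X, ρ ^ (d - 1) * Real.exp (-ρ ^ 2) * kummerM a ((d : ℝ) / 2) (ρ ^ 2)) *
      (1 + 2 * a * ∫ u in (0 : ℝ)..1,
        (hilleHardy ((d : ℝ) / 2) (u ^ 2) (X ^ 2) y - 1) * u ^ (2 * a - 1)) := by
  obtain ⟨I₀, hI₀⟩ : ∃ I₀ : ℝ, I₀ = ∫ ρ in (0 : ℝ)..X, ρ ^ (d - 1) * Real.exp (-ρ ^ 2) *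
    kummerM a ((d : ℝ) / 2) (ρ ^ 2) := ⟨_, rfl⟩
  rw [← hI₀]
  have hΓ := Real.Gamma_pos_of_pos (half_dim_pos hd)
  -- If `I₀` were 0, the identity at `y = 0` would read `Γ(b)/2 · M(a,b,0) = 0`, although `M(a,b,0)
  -- = 1`.
  have hI₀0 : I₀ ≠ 0 := by
    intro h0
    have := (kummerM_sub_eq_integral hd ha hX0 hX (y := 0) ⟨le_rfl, by positivity⟩ hI₀).1
    simp only [h0, mul_zero, zero_mul, intervalIntegral.integral_zero, kummerM_zero_right, mul_one,
      sub_zero] at this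
    have h2 := this (by simp)
    linarith
  obtain ⟨h1, h2⟩ := kummerM_sub_eq_integral hd ha hX0 hX hy hI₀
  have h3 := h2 ha0.ne hI₀0
  refine ⟨hI₀0, h3, ?_⟩
  have h4 := h1 (h3.const_mul _)
  rw [intervalIntegral.integral_const_mul] at h4
  field_simp
  linear_combination 2 * h4

end Representation

end

/-! ### Zeros of Kummer's function in its first parameter -/

noncomputable section

open scoped Nat

lemma kummerM_pos {a b x : ℝ} (hb : 0 < b) (ha : 0 ≤ a) (hx : 0 ≤ x) : 0 < kummerM a b x := by
  have h := (entireCoeff_kummerM hb a).hasSum x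
  have h1 := le_hasSum h 0 fun k _ =>
    mul_nonneg (kummerCoeff_nonneg hb (p := fun j => a + j) (fun k => by positivity) k)
      (pow_nonneg hx k)
  simp only [kummerCoeff_zero, pow_zero, mul_one] at h1
  exact one_pos.trans_le h1

/-- Locally in `a`, the coefficients are bounded by those with parameter `|a₀| + 1`, so the
Weierstrass test applies. -/
lemma continuous_kummerM_left {b : ℝ} (hb : 0 < b) (x : ℝ) : Continuous fun a => kummerM a b x := by
  refine continuous_iff_continuousAt.2 fun a₀ => ?_
  have hA : ContinuousOn (fun a => kummerM a b x) (Metric.ball 0 (|a₀| + 1)) := by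
    have hs := (entireCoeff_kummerCoeff hb (p := fun j : ℕ => (|a₀| + 1) + (j : ℝ)) (A := |a₀| + 1)
      fun k => (abs_of_nonneg (by positivity)).le).summable_abs x
    refine continuousOn_tsum (fun k => ?_) hs fun k a ha => ?_
    · refine Continuous.continuousOn (Continuous.mul ?_ continuous_const)
      exact continuous_finsetProd _ fun j _ => by fun_prop
    · rw [norm_mul, norm_pow, Real.norm_eq_abs, Real.norm_eq_abs]
      refine mul_le_mul_of_nonneg_right ?_ (by positivity)
      refine (abs_kummerCoeff_le hb (p' := fun j : ℕ => (|a₀| + 1) + (j : ℝ)) (fun j => ?_) k).trans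
        (le_abs_self _)
      refine (abs_add_le _ _).trans ?_
      rw [abs_of_nonneg (by positivity : (0 : ℝ) ≤ j)]
      gcongr
      simpa using (mem_ball_zero_iff.1 ha).le
  exact hA.continuousAt (Metric.isOpen_ball.mem_nhds (by simp))

/-- The coefficients `(c)_m / m!` of the binomial series of `(1 - q) ^ (-c)`. -/
def binomCoeff (c : ℝ) (m : ℕ) : ℝ := (∏ j ∈ Finset.range m, (c + j)) / m !

lemma binomCoeff_nonneg {c : ℝ} (hc : 0 < c) (m : ℕ) : 0 ≤ binomCoeff c m :=
  div_nonneg (Finset.prod_nonneg fun j _ => by positivity) (by positivity)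

lemma ringChoose_eq_binomCoeff (c : ℝ) (m : ℕ) : Ring.choose (c + m - 1) m = binomCoeff c m := by
  have h1 : Ring.choose (c + m - 1) m = Ring.multichoose c m := by
    rw [Ring.choose]
    congr 1
    ring
  have h2 := Ring.factorial_nsmul_multichoose_eq_ascPochhammer c m
  have h3 : ∀ m : ℕ, (ascPochhammer ℕ m).smeval c = ∏ j ∈ Finset.range m, (c + j) := by
    intro m
    induction m with
    | zero => simp
    | succ m ih =>
      rw [ascPochhammer_succ_right, Polynomial.smeval_mul, ih, Finset.prod_range_succ]
      simp [Polynomial.smeval_natCast]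
  rw [h1, binomCoeff, ← h3, ← h2, nsmul_eq_mul]
  field_simp

lemma hasSum_binomCoeff (c : ℝ) {q : ℝ} (hq : 0 ≤ q) (hq1 : q < 1) :
    HasSum (fun m => binomCoeff c m * q ^ m) ((1 - q) ^ (-c)) := by
  have h := (Real.one_div_one_sub_rpow_hasFPowerSeriesOnBall_zero c).hasSum (y := q) (by
    rw [Metric.mem_eball, edist_zero_right, Real.enorm_eq_ofReal hq]
    simpa using hq1)
  simp only [FormalMultilinearSeries.ofScalars_apply_eq, ringChoose_eq_binomCoeff, smul_eq_mul,
    zero_add] at h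
  rw [Real.rpow_neg (by linarith)]
  simpa using h

/-- This is the coefficient of `x^k` in the Laguerre polynomial of degree `k + m`. Keeping `m` free
lets the induction trade `(k + 1, m)` for `(k, m + 1)` at constant degree. -/
lemma binomCoeff_mul_kummerCoeff {b : ℝ} (hb : 0 < b) (k : ℕ) : ∀ m : ℕ,
    binomCoeff b (k + m) * kummerCoeff (fun j => -((k + m : ℕ) : ℝ) + j) b k
      = (-1) ^ k / k ! * binomCoeff (b + k) m := by
  induction k with
  | zero => simp
  | succ k ih =>
    intro m
    have h1 := ih (m + 1)
    have e : k + 1 + m = k + (m + 1) := by ring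
    rw [e, kummerCoeff_succ, ← mul_assoc, h1]
    have h2 : binomCoeff (b + k) (m + 1) * (m + 1) = (b + k) * binomCoeff (b + (k + 1 : ℕ)) m := by
      rw [binomCoeff, binomCoeff, Finset.prod_range_succ', Nat.factorial_succ]
      have : ∀ j : ℕ, b + k + ((j + 1 : ℕ) : ℝ) = b + ((k + 1 : ℕ) : ℝ) + j := fun j => by
        push_cast
        ring
      simp only [this]
      push_cast
      field_simp
      ring
    have hbk : b + k ≠ 0 := by positivity
    rw [Nat.factorial_succ, pow_succ]
    push_cast at h2 ⊢
    field_simp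
    linear_combination -h2

lemma kummerCoeff_neg_nat {b : ℝ} {n k : ℕ} (h : n < k) :
    kummerCoeff (fun j => -(n : ℝ) + j) b k = 0 :=
  Finset.prod_eq_zero (Finset.mem_range.2 h) (by simp)

lemma kummerM_neg_nat (b x : ℝ) (n : ℕ) : kummerM (-n) b x
    = ∑ p ∈ Finset.HasAntidiagonal.antidiagonal n, kummerCoeff (fun j => -(n : ℝ) + j) b p.1 * x ^ p.1 := by
  rw [Finset.Nat.sum_antidiagonal_eq_sum_range_succ_mk, kummerM, entireSum]
  refine tsum_eq_sum fun k hk => ?_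
  rw [kummerCoeff_neg_nat (by simpa using hk), zero_mul]

/-- The generating function of the Laguerre polynomials. -/
lemma hasSum_laguerre {b : ℝ} (hb : 0 < b) {x : ℝ} (hx : 0 ≤ x) {q : ℝ} (hq : 0 ≤ q)
    (hq1 : q < 1) :
    HasSum (fun n : ℕ => q ^ n * binomCoeff b n * kummerM (-n) b x)
      ((1 - q) ^ (-b) * Real.exp (-(x * q / (1 - q)))) := by
  have hτ : 0 < 1 - q := by linarith
  -- The exponential is expanded first, then each negative power of `1 - q`. The variable `z` is
  -- taken as `x` for an absolutely convergent majorant and as `-x` for the series itself;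
  -- regrouping by antidiagonals then produces the polynomials.
  have hrow : ∀ z : ℝ, ∀ k : ℕ, HasSum (fun m => (z * q) ^ k / k ! * (binomCoeff (b + k) m * q ^ m))
      ((1 - q) ^ (-b) * ((z * q / (1 - q)) ^ k / k !)) := by
    intro z k
    have := (hasSum_binomCoeff (b + k) hq hq1).mul_left ((z * q) ^ k / k !)
    rw [neg_add, Real.rpow_add hτ, Real.rpow_neg hτ.le (k : ℝ), Real.rpow_natCast] at this
    have e : (1 - q) ^ (-b) * ((z * q / (1 - q)) ^ k / k !) =
        (z * q) ^ k / k ! * ((1 - q) ^ (-b) * ((1 - q) ^ k)⁻¹) := by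
      rw [div_pow]
      field_simp
    rwa [e]
  have htot : ∀ z : ℝ, HasSum (fun k : ℕ => (1 - q) ^ (-b) * ((z * q / (1 - q)) ^ k / k !))
      ((1 - q) ^ (-b) * Real.exp (z * q / (1 - q))) := fun z =>
    (hasSum_exp_euler _).1.mul_left _
  have hsum : Summable fun p : ℕ × ℕ =>
      (-x * q) ^ p.1 / p.1 ! * (binomCoeff (b + p.1) p.2 * q ^ p.2) := by
    have hpos : Summable fun p : ℕ × ℕ =>
        (x * q) ^ p.1 / p.1 ! * (binomCoeff (b + p.1) p.2 * q ^ p.2) := by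
      refine (summable_prod_of_nonneg fun p => ?_).2 ⟨fun k => (hrow x k).summable, ?_⟩
      · have := binomCoeff_nonneg (c := b + p.1) (by positivity) p.2
        exact mul_nonneg (by positivity) (by positivity)
      · exact (htot x).summable.congr fun k => ((hrow x k).tsum_eq).symm
    refine Summable.of_norm_bounded hpos fun p => le_of_eq ?_
    have := binomCoeff_nonneg (c := b + p.1) (by positivity) p.2
    rw [norm_mul, norm_div, norm_pow, Real.norm_of_nonneg (by positivity :
      0 ≤ binomCoeff (b + p.1) p.2 * q ^ p.2), neg_mul, norm_neg, Real.norm_of_nonneg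
        (by positivity : 0 ≤ x * q), Real.norm_of_nonneg (by positivity : (0 : ℝ) ≤ p.1 !)]
  have hS : HasSum (fun p : ℕ × ℕ => (-x * q) ^ p.1 / p.1 ! * (binomCoeff (b + p.1) p.2 * q ^ p.2))
      ((1 - q) ^ (-b) * Real.exp (-(x * q / (1 - q)))) := by
    have h1 := hsum.hasSum.prod_fiberwise fun k => hrow (-x) k
    have h2 := h1.unique (htot (-x))
    rw [show -x * q / (1 - q) = -(x * q / (1 - q)) by ring] at h2
    rw [← h2]
    exact hsum.hasSum
  have h3 := (Finset.HasAntidiagonal.sigmaAntidiagonalEquivProd.hasSum_iff.2 hS).sigma fun n =>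
    hasSum_fintype _
  refine h3.congr_fun fun n => ?_
  rw [kummerM_neg_nat, Finset.mul_sum, Finset.univ_eq_attach,
    ← Finset.sum_attach (Finset.HasAntidiagonal.antidiagonal n)]
  refine Finset.sum_congr rfl fun p _ => ?_
  obtain ⟨⟨k, m⟩, hp⟩ := p
  obtain rfl : k + m = n := Finset.HasAntidiagonal.mem_antidiagonal.1 hp
  simp only [Function.comp_apply, Finset.HasAntidiagonal.sigmaAntidiagonalEquivProd_apply]
  have := binomCoeff_mul_kummerCoeff hb k m
  rw [show q ^ (k + m) * binomCoeff b (k + m) *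
    (kummerCoeff (fun j => -((k + m : ℕ) : ℝ) + j) b k * x ^ k) = q ^ (k + m) * x ^ k *
    (binomCoeff b (k + m) * kummerCoeff (fun j => -((k + m : ℕ) : ℝ) + j) b k) by ring, this,
    pow_add, mul_pow, neg_pow x]
  ring

/-- If every value were nonnegative, the generating function would be at least its zeroth term 1 for
all `q < 1`. With `q = 1 - 1/t` it equals `t^b e^{-xt} e^x`, which tends to 0 as `t → ∞`. -/
lemma exists_kummerM_neg_nat_neg {b : ℝ} (hb : 0 < b) {x : ℝ} (hx : 0 < x) :
    ∃ n : ℕ, kummerM (-n) b x < 0 := by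
  by_contra! hcon
  have hge : ∀ t : ℝ, 1 < t → 1 ≤ t ^ b * Real.exp (-x * t) * Real.exp x := by
    intro t ht
    have ht0 : 0 < t := by linarith
    have hq : 0 ≤ 1 - 1 / t := by
      rw [sub_nonneg, div_le_one ht0]
      exact ht.le
    have hq1 : 1 - 1 / t < 1 := by
      have : 0 < 1 / t := by positivity
      linarith
    have h := le_hasSum (hasSum_laguerre hb hx.le hq hq1) 0 fun n _ =>
      mul_nonneg (mul_nonneg (by positivity) (binomCoeff_nonneg hb n)) (hcon n)
    have h0 : kummerM (-((0 : ℕ) : ℝ)) b x = 1 := by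
      rw [kummerM_neg_nat]
      simp
    rw [h0] at h
    have e1 : (1 - (1 - 1 / t)) = t⁻¹ := by ring
    rw [e1, Real.rpow_neg (by positivity), Real.inv_rpow ht0.le, inv_inv] at h
    have e2 : -(x * (1 - 1 / t) / t⁻¹) = -x * t + x := by
      field_simp
      ring
    rw [e2, Real.exp_add, ← mul_assoc] at h
    simpa [binomCoeff] using h
  have hlim := (tendsto_rpow_mul_exp_neg_mul_atTop_nhds_zero b x hx).mul_const (Real.exp x)
  rw [zero_mul] at hlim
  have h1 := hlim.eventually (gt_mem_nhds one_pos)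
  obtain ⟨t, ht1, ht2⟩ := (h1.and (eventually_gt_atTop 1)).exists
  exact absurd (hge t ht2) (not_le.2 ht1)

lemma exists_greatest_zero_kummerM {b : ℝ} (hb : 0 < b) {x : ℝ} (hx : 0 < x) :
    ∃ a < 0, kummerM a b x = 0 ∧ ∀ a', kummerM a' b x = 0 → a' ≤ a := by
  obtain ⟨n, hn⟩ := exists_kummerM_neg_nat_neg hb hx
  have hc := continuous_kummerM_left hb x
  have h0 := kummerM_pos hb le_rfl hx.le
  have hn0 : -(n : ℝ) ≤ 0 := by simp
  obtain ⟨a₁, ha₁, ha₁'⟩ := intermediate_value_Icc hn0 hc.continuousOn ⟨hn.le, h0.le⟩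
  have hcomp : IsCompact (Set.Icc (-(n : ℝ)) 0 ∩ {a | kummerM a b x = 0}) :=
    isCompact_Icc.inter_right (isClosed_singleton.preimage hc)
  obtain ⟨a, ⟨ha1, ha2⟩, ha3⟩ := hcomp.exists_isGreatest ⟨a₁, ha₁, ha₁'⟩
  have hneg : ∀ a', kummerM a' b x = 0 → a' < 0 := fun a' h => by
    by_contra! h'
    exact (kummerM_pos hb h' hx.le).ne' h
  refine ⟨a, hneg a ha2, ha2, fun a' ha' => ?_⟩
  rcases le_total (-(n : ℝ)) a' with h | h
  · exact ha3 ⟨⟨h, (hneg a' ha').le⟩, ha'⟩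
  · exact h.trans ha1.1

end

/-! ### Asymptotics of the greatest zero -/

noncomputable section

section Asymptotic

variable {b : ℝ} (hb : 0 < b)

include hb

/-- Equivalently, `(x^b e^{-x} M(1,b+1,x))' = b x^{b-1} e^{-x}` for `x > 0`: the product is `b`
times an incomplete Gamma integral, whence the limit in `tendsto_kummerM_one`. -/
lemma kummerM_one_succ_ode (x : ℝ) :
    x * kummerM' 1 (b + 1) x + b * kummerM 1 (b + 1) x = b + x * kummerM 1 (b + 1) x := by
  have hb1 : 0 < b + 1 := by linarith
  have hc := entireCoeff_kummerM hb1 1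
  have h1 := (hc.hasSum_euler x).add ((hc.hasSum x).mul_left b)
  have h2 : HasSum (fun k : ℕ => (k + b) * kummerCoeff (fun j => 1 + (j : ℝ)) (b + 1) k * x ^ k)
      (x * kummerM' 1 (b + 1) x + b * kummerM 1 (b + 1) x) :=
    h1.congr_fun fun k => by ring
  rw [← hasSum_nat_add_iff' 1] at h2
  have h3 := h2.unique (((hc.hasSum x).mul_left x).congr_fun fun k => by
    have hr := kummerCoeff_rec hb1 (fun j => 1 + (j : ℝ)) k
    rw [derivCoeff] at hr
    have hk : (1 : ℝ) + k ≠ 0 := by positivity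
    have hr' : (b + 1 + k) * kummerCoeff (fun j => 1 + (j : ℝ)) (b + 1) (k + 1)
        = kummerCoeff (fun j => 1 + (j : ℝ)) (b + 1) k := by
      refine mul_left_cancel₀ hk ?_
      rw [← hr]
      ring
    rw [← hr']
    push_cast
    ring)
  simp only [Finset.range_one, Finset.sum_singleton, kummerCoeff_zero] at h3
  norm_num at h3
  simp only [kummerM]
  simp only [kummerM] at h3
  linarith

lemma tendsto_kummerM_one : Tendsto (fun x => x ^ b * Real.exp (-x) * kummerM 1 (b + 1) x) atTop
    (𝓝 (b * Real.Gamma b)) := by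
  have hb1 : 0 < b + 1 := by linarith
  have hint : IntegrableOn (fun x : ℝ => b * (Real.exp (-x) * x ^ (b - 1))) (Set.Ioi 0) :=
    (Real.GammaIntegral_convergent hb).const_mul b
  have hlim := intervalIntegral_tendsto_integral_Ioi 0 hint tendsto_id
  rw [integral_const_mul, ← Real.Gamma_eq_integral hb] at hlim
  refine hlim.congr' ?_
  filter_upwards [eventually_gt_atTop 0] with x hx
  have hMc := continuous_kummerM hb1 1
  have h := intervalIntegral.integral_eq_sub_of_hasDerivAt_of_le hx.le
    (f := fun x => x ^ b * Real.exp (-x) * kummerM 1 (b + 1) x)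
    (f' := fun x => b * (Real.exp (-x) * x ^ (b - 1))) ?_ ?_ ?_
  · rw [Real.zero_rpow hb.ne'] at h
    simpa using h
  · exact ContinuousOn.mul (ContinuousOn.mul
      (continuousOn_id.rpow_const fun y _ => Or.inr hb.le) (by fun_prop)) hMc.continuousOn
  · intro y hy
    have hy0 : 0 < y := hy.1
    refine (((Real.hasDerivAt_rpow_const (p := b) (Or.inl hy0.ne')).mul
      (hasDerivAt_neg y).exp).mul (hasDerivAt_kummerM hb1 1 y)).congr_deriv ?_
    have hode := kummerM_one_succ_ode hb y
    have hp : y ^ b = y ^ (b - 1) * y := by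
      rw [← Real.rpow_add_one hy0.ne']
      congr 1
      ring
    simp only [Pi.mul_apply, hp]
    linear_combination (y ^ (b - 1) * Real.exp (-y)) * hode
  · exact (intervalIntegrable_iff_integrableOn_Ioc_of_le hx.le).2
      (hint.mono_set Set.Ioc_subset_Ioi_self)

lemma kummerCoeff_one_add (k : ℕ) :
    kummerCoeff (fun j => 1 + (j : ℝ)) b (k + 1) * (b + k) =
      kummerCoeff (fun j => 1 + (j : ℝ)) b k := by
  have h : b + k ≠ 0 := by positivity
  have hk : (1 : ℝ) + k ≠ 0 := by positivity
  rw [kummerCoeff_succ, add_comm (k : ℝ) 1]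
  field_simp

/-- Both sides are reciprocals of Pochhammer products: `1/(b+1)_k = b/(b)_{k+1}`. This lets
`M(1,b+1,·)` serve as comparison for series with parameter `b`. -/
lemma kummerCoeff_one_add_succ (k : ℕ) :
    kummerCoeff (fun j => 1 + (j : ℝ)) (b + 1) k
      = b * kummerCoeff (fun j => 1 + (j : ℝ)) b (k + 1) := by
  have hb1 : 0 < b + 1 := by linarith
  induction k with
  | zero =>
    have := kummerCoeff_one_add hb 0
    simp at this ⊢
    linarith
  | succ k ih =>
    have h1 := kummerCoeff_one_add hb1 k
    have h2 := kummerCoeff_one_add hb (k + 1)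
    have hne : b + 1 + k ≠ 0 := by positivity
    refine mul_right_cancel₀ hne ?_
    rw [h1, ih, ← h2]
    push_cast
    ring

/-- For `-1 < a < 0`, bounds of the coefficients of the Kummer function by those of its expansion
to second order in `a`. -/
lemma kummerCoeff_bounds {t : ℝ} (ht : 0 < t) (ht1 : t < 1) (k : ℕ) :
    t * (kummerCoeff (fun j => 1 + (j : ℝ)) b (k + 1) / (k + 1)) * (1 - t * (k + 1))
        ≤ -kummerCoeff (fun j => -t + (j : ℝ)) b (k + 1) ∧
      0 ≤ -kummerCoeff (fun j => -t + (j : ℝ)) b (k + 1) ∧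
      -kummerCoeff (fun j => -t + (j : ℝ)) b (k + 1)
        ≤ t * (kummerCoeff (fun j => 1 + (j : ℝ)) b (k + 1) / (k + 1)) := by
  induction k with
  | zero =>
    rw [kummerCoeff_succ, kummerCoeff_succ]
    simp only [kummerCoeff_zero, Nat.cast_zero, add_zero, zero_add, mul_one, one_mul, div_one,
      neg_div, neg_neg]
    have : 0 ≤ t / b := by positivity
    refine ⟨?_, this, le_of_eq (by ring)⟩
    rw [mul_one_div]
    nlinarith
  | succ k ih =>
    obtain ⟨h1, h2, h3⟩ := ih
    set c := -kummerCoeff (fun j => -t + (j : ℝ)) b (k + 1) with hc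
    set e := kummerCoeff (fun j => 1 + (j : ℝ)) b (k + 1) with he
    have e0 : 0 ≤ e := kummerCoeff_nonneg hb (fun j => by positivity) _
    set K : ℝ := (k : ℝ) + 1 with hK
    have hK1 : 1 ≤ K := by simp [hK]
    have hK0 : 0 < K := by linarith
    have hcast : ((k + 1 : ℕ) : ℝ) = K := by push_cast; rfl
    set D : ℝ := (b + K) * (K + 1) with hD
    have hD0 : 0 < D := by positivity
    -- Passing to the next index multiplies the coefficient by `(K - t)/D` and its first-order
    -- approximation by `K/D`. The loss `t K` in the lower bound is crude, but it cancels the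
    -- division by `K`, so the error later sums to a Kummer series.
    have hc' : -kummerCoeff (fun j => -t + (j : ℝ)) b (k + 1 + 1) = c * ((K - t) / D) := by
      rw [kummerCoeff_succ, hcast, hc]
      ring
    have he' : kummerCoeff (fun j => 1 + (j : ℝ)) b (k + 1 + 1) / (K + 1) = e / K * (K / D) := by
      rw [kummerCoeff_succ, hcast, ← he, hD]
      field_simp
      ring
    rw [hc', hcast, he']
    have hKt : 0 ≤ (K - t) / D := div_nonneg (by linarith) hD0.le
    refine ⟨?_, mul_nonneg h2 hKt, ?_⟩
    · rw [show t * (e / K * (K / D)) * (1 - t * (K + 1)) =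
        (t * (e / K)) * (K * (1 - t * (K + 1))) / D by ring,
        show c * ((K - t) / D) = c * (K - t) / D by ring]
      refine div_le_div_of_nonneg_right ?_ hD0.le
      set g := t * (e / K) with hg
      have hg0 : 0 ≤ g := by positivity
      have : c * (K - t) = c * K - t * c := by ring
      rw [this]
      have h4 : g * (1 - t * K) * K ≤ c * K := by gcongr
      have h5 : t * c ≤ t * g := by gcongr
      have h6 : t * g ≤ t * g * K := by
        have : 0 ≤ t * g := by positivity
        nlinarith
      linarith [show g * (K * (1 - t * (K + 1))) = g * (1 - t * K) * K - t * g * K by ring]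
    · calc c * ((K - t) / D) ≤ t * (e / K) * (K / D) := by
            gcongr
            linarith
        _ = _ := by ring

/-- Bounds of `M(-t, b, x)` for small `t`, in terms of a function equivalent to
`Γ(b) x ^ (-b) exp x`. -/
lemma exists_kummerM_bounds {x : ℝ} (hx : 0 < x) :
    ∃ N : ℝ, (kummerM 1 (b + 1) x - 1) / b ≤ N ∧
      N ≤ kummerM 1 (b + 1) x / b + (b + 2) * kummerM 1 (b + 1) x / x ∧
      ∀ t, 0 < t → t < 1 → 1 - t * N ≤ kummerM (-t) b x ∧
        kummerM (-t) b x ≤ 1 - t * N + t ^ 2 * (x * kummerM 1 (b + 1) x / b) := by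
  have hb1 : 0 < b + 1 := by linarith
  obtain ⟨e, he⟩ : ∃ e : ℕ → ℝ, e = kummerCoeff (fun j => 1 + (j : ℝ)) b := ⟨_, rfl⟩
  have e0 : ∀ k, 0 ≤ e k := fun k => by
    rw [he]
    exact kummerCoeff_nonneg hb (fun j => by positivity) _
  obtain ⟨S, hSdef⟩ : ∃ S : ℝ, S = kummerM 1 (b + 1) x := ⟨_, rfl⟩
  have hS : HasSum (fun k : ℕ => b * e (k + 1) * x ^ k) S := by
    rw [hSdef]
    exact ((entireCoeff_kummerM hb1 1).hasSum x).congr_fun fun k => by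
      rw [kummerCoeff_one_add_succ hb, he]
  have hS1 : HasSum (fun k : ℕ => e (k + 1) * x ^ (k + 1)) (x * S / b) := by
    have h1 := hS.mul_left (x / b)
    rw [show x / b * S = x * S / b by ring] at h1
    refine h1.congr_fun fun k => ?_
    field_simp
    ring
  have hsum : Summable fun k : ℕ => e (k + 1) / (k + 1) * x ^ (k + 1) := by
    refine Summable.of_nonneg_of_le (fun k => ?_) (fun k => ?_) hS1.summable
    · have := e0 (k + 1)
      positivity
    · gcongr
      exact div_le_self (e0 _) (by simp)
  refine ⟨∑' k : ℕ, e (k + 1) / (k + 1) * x ^ (k + 1), ?_, ?_, fun t ht ht1 => ?_⟩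
  -- Lower bound: `1/K ≥ 1/(b + K)` with `K = k + 1`, and dividing `e K` by `b + K` gives `e (K +
  -- 1)`.
  · rw [← hSdef]
    have h1 := (hasSum_nat_add_iff' 1).2 hS
    have h2 := h1.div_const b
    have he1 : b * e 1 = 1 := by
      have := kummerCoeff_one_add hb 0
      rw [← he] at this
      simp [he] at this ⊢
      linarith
    simp only [Finset.range_one, Finset.sum_singleton, pow_zero, zero_add, he1, mul_one] at h2
    refine hasSum_le (fun k => ?_) h2 hsum.hasSum
    have h3 := kummerCoeff_one_add hb (k + 1)
    rw [← he] at h3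
    rw [← h3]
    have := e0 (k + 1 + 1)
    push_cast
    rw [show b * e (k + 1 + 1) * x ^ (k + 1) / b = e (k + 1 + 1) * x ^ (k + 1) by field_simp]
    gcongr
    rw [le_div_iff₀ (by positivity)]
    exact mul_le_mul_of_nonneg_left (by linarith) this
  -- Upper bound: `e K / K ≤ e (K + 1) + b(b + 2) e (K + 2)`, which reduces to `b + K + 1 ≤ (b + 2)
  -- K` for `K ≥ 1`. The shift by two indices yields the factor `1/x` in the correction.
  · rw [← hSdef]
    have hSa : HasSum (fun k : ℕ => e (k + 1 + 1) * x ^ (k + 1)) ((S - 1) / b) := by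
      have h1 := (hasSum_nat_add_iff' 1).2 hS
      have h2 := h1.div_const b
      have he1 : b * e 1 = 1 := by
        have := kummerCoeff_one_add hb 0
        rw [← he] at this
        simp [he] at this ⊢
        linarith
      simp only [Finset.range_one, Finset.sum_singleton, pow_zero, zero_add, he1, mul_one] at h2
      exact h2.congr_fun fun k => by field_simp
    have hSb : HasSum (fun k : ℕ => e (k + 2 + 1) * x ^ (k + 2))
        (S / b - (e 1 + e 2 * x)) := by
      have h1 := (hasSum_nat_add_iff' 2).2 hS
      have h2 := h1.div_const b
      simp only [Finset.sum_range_succ, Finset.range_zero, Finset.sum_empty, pow_zero, zero_add,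
        mul_one, pow_one] at h2
      rw [show (S - (b * e 1 + b * e (1 + 1) * x)) / b = S / b - (e 1 + e 2 * x) by field_simp] at h2
      exact h2.congr_fun fun k => by field_simp
    have hSc := hSa.add (hSb.mul_left (b * (b + 2) / x))
    have h4 := hasSum_le (fun k => ?_) hsum.hasSum hSc
    · refine h4.trans ?_
      have e1 := e0 1
      have e2 := e0 2
      have h5 : b * (b + 2) / x * (S / b - (e 1 + e 2 * x)) ≤ b * (b + 2) / x * (S / b) := by
        gcongr
        have : 0 ≤ e 2 * x := by positivity
        linarith
      have h6 : (S - 1) / b ≤ S / b := by gcongr; linarith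
      have h7 : b * (b + 2) / x * (S / b) = (b + 2) * S / x := by field_simp
      linarith
    · have h3 := kummerCoeff_one_add hb (k + 1)
      have h3' := kummerCoeff_one_add hb (k + 1 + 1)
      rw [← he] at h3 h3'
      have e3 := e0 (k + 1 + 1 + 1)
      rw [← h3, ← h3']
      push_cast
      set K : ℝ := (k : ℝ) + 1 with hK
      have hK1 : 1 ≤ K := by simp [hK]
      rw [show b * (b + 2) / x * (e (k + 2 + 1) * x ^ (k + 2)) =
        b * (b + 2) * e (k + 1 + 1 + 1) * x ^ (k + 1) by
          rw [show k + 2 + 1 = k + 1 + 1 + 1 by ring, show k + 2 = k + 1 + 1 by ring, pow_succ x (k+1)]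
          field_simp, ← add_mul]
      gcongr
      rw [div_le_iff₀ (by positivity)]
      nlinarith [mul_nonneg e3 (mul_nonneg hb.le (by linarith : 0 ≤ K - 1)),
        mul_nonneg e3 (mul_nonneg (mul_nonneg hb.le hb.le) (by linarith : 0 ≤ K - 1))]
  · rw [← hSdef]
    have hM := (hasSum_nat_add_iff' 1).2 ((entireCoeff_kummerM hb (-t)).hasSum x)
    simp only [Finset.range_one, Finset.sum_singleton, pow_zero, kummerCoeff_zero, mul_one] at hM
    have hbd := fun k => kummerCoeff_bounds hb ht ht1 k
    rw [← he] at hbd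
    rw [show kummerM (-t) b x = entireSum (kummerCoeff (fun j => -t + (j : ℝ)) b) x from rfl]
    constructor
    · have h1 := hasSum_le (fun k => ?_) (hsum.hasSum.mul_left (-t)) hM
      · linarith
      · have := (hbd k).2.2
        have h2 : 0 ≤ x ^ (k + 1) := by positivity
        nlinarith
    · have h1 := hasSum_le (fun k => ?_) hM ((hsum.hasSum.mul_left (-t)).add (hS1.mul_left (t ^ 2)))
      · linarith
      · have h3 := (hbd k).1
        have h2 : 0 ≤ x ^ (k + 1) := by positivity
        have h4 : t * (e (k + 1) / (k + 1)) * (1 - t * (k + 1)) =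
          t * (e (k + 1) / (k + 1)) - t ^ 2 * e (k + 1) := by
          field_simp
        rw [h4] at h3
        nlinarith

/-- Asymptotic behaviour of the largest zero of `a ↦ M(a, b, x)` as `x → ∞`. -/
theorem eventually_kummerM_zero {ε : ℝ} (hε : 0 < ε) (hε1 : ε < 1) :
    ∀ᶠ x in atTop, (1 + ε) * (x ^ b * Real.exp (-x) / Real.Gamma b) < 1 ∧
      (∀ a, kummerM a b x = 0 → a ≤ -((1 - ε) * (x ^ b * Real.exp (-x) / Real.Gamma b))) ∧
      ∃ a, -((1 + ε) * (x ^ b * Real.exp (-x) / Real.Gamma b)) ≤ a ∧ kummerM a b x = 0 := by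
  have hΓ := Real.Gamma_pos_of_pos hb
  set A : ℝ → ℝ := fun x => x ^ b * Real.exp (-x) / Real.Gamma b with hA
  have hA0 : Tendsto A atTop (𝓝 0) := by
    have := (tendsto_rpow_mul_exp_neg_mul_atTop_nhds_zero b 1 one_pos).div_const (Real.Gamma b)
    simpa [hA] using this
  have hxA : Tendsto (fun x => x * A x) atTop (𝓝 0) := by
    have := (tendsto_rpow_mul_exp_neg_mul_atTop_nhds_zero (b + 1) 1 one_pos).div_const
      (Real.Gamma b)
    rw [zero_div] at this
    refine this.congr' ?_
    filter_upwards [eventually_gt_atTop 0] with x hx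
    rw [Real.rpow_add_one hx.ne', hA]
    simp only [neg_mul, one_mul]
    ring
  have hAS : Tendsto (fun x => A x * (kummerM 1 (b + 1) x / b)) atTop (𝓝 1) := by
    have := (tendsto_kummerM_one hb).div_const (b * Real.Gamma b)
    rw [div_self (by positivity)] at this
    refine this.congr fun x => ?_
    simp only [hA]
    field_simp
  have hlow : Tendsto (fun x => A x * ((kummerM 1 (b + 1) x - 1) / b)) atTop (𝓝 1) := by
    have := hAS.sub (hA0.div_const b)
    rw [zero_div, sub_zero] at this
    exact this.congr fun x => by ring
  have hup : Tendsto (fun x => A x * (kummerM 1 (b + 1) x / b + (b + 2) * kummerM 1 (b + 1) x / x))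
      atTop (𝓝 1) := by
    have := hAS.add ((hAS.mul (tendsto_inv_atTop_zero (𝕜 := ℝ))).const_mul (b * (b + 2)))
    rw [mul_zero, mul_zero, add_zero] at this
    refine this.congr fun x => ?_
    field_simp
  -- Multiplied by `1 + ε`, this is the linear term minus the quadratic error at `t = (1 + ε) A x`.
  -- The error is negligible because `x A x → 0` while `A x · S/b → 1`, where `S = M(1,b+1,x)`.
  have hquad : Tendsto (fun x => A x * ((kummerM 1 (b + 1) x - 1) / b) - (1 + ε) *
      ((x * A x) * (A x * (kummerM 1 (b + 1) x / b)))) atTop (𝓝 1) := by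
    have := hlow.sub ((hxA.mul hAS).const_mul (1 + ε))
    simpa using this
  have hs1 : 1 / (1 + ε) < 1 := by
    rw [div_lt_one (by positivity)]
    linarith
  have hs2 : 1 < 1 / (1 - ε) := by
    rw [lt_div_iff₀ (by linarith)]
    linarith
  filter_upwards [eventually_gt_atTop 0, hA0.eventually (gt_mem_nhds (by positivity :
    (0 : ℝ) < 1 / (1 + ε))), hup.eventually (gt_mem_nhds hs2), hquad.eventually (lt_mem_nhds hs1)]
    with x hx h1 h2 h3
  have hAx : 0 < A x := by simp only [hA]; positivity
  change (1 + ε) * A x < 1 ∧ (∀ a, kummerM a b x = 0 → a ≤ -((1 - ε) * A x)) ∧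
    ∃ a, -((1 + ε) * A x) ≤ a ∧ kummerM a b x = 0
  have hlt1 : (1 + ε) * A x < 1 := by
    rw [lt_div_iff₀ (by positivity)] at h1
    linarith
  obtain ⟨N, hN1, hN2, hN⟩ := exists_kummerM_bounds hb hx
  refine ⟨hlt1, fun a ha => ?_, ?_⟩
  -- For `-a < (1 - ε) A x` the lower bound `1 - tN` is still positive, so no zero lies there.
  · by_contra! hcon
    have ha0 : a < 0 := by
      by_contra! h
      exact (kummerM_pos hb h hx.le).ne' ha
    have hta : -a < (1 - ε) * A x := by linarith
    have hta1 : -a < 1 := by nlinarith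
    have h4 := (hN (-a) (by linarith) hta1).1
    rw [neg_neg, ha] at h4
    have h5 : A x * N < 1 / (1 - ε) := (mul_le_mul_of_nonneg_left hN2 hAx.le).trans_lt h2
    rw [lt_div_iff₀ (by linarith)] at h5
    have hNpos : 0 < N := by
      by_contra! hN0
      nlinarith
    nlinarith
  -- At this `t` the upper bound is nonpositive, and the intermediate value theorem gives a zero in
  -- `[-t, 0]`.
  · set t := (1 + ε) * A x with ht
    have ht0 : 0 < t := by positivity
    have h4 := (hN t ht0 hlt1).2
    rw [div_lt_iff₀ (by positivity)] at h3
    have h5 : t * ((kummerM 1 (b + 1) x - 1) / b) ≤ t * N := by gcongr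
    have hneg : kummerM (-t) b x ≤ 0 := by
      have e : (A x * ((kummerM 1 (b + 1) x - 1) / b) - (1 + ε) *
          ((x * A x) * (A x * (kummerM 1 (b + 1) x / b)))) * (1 + ε) =
          t * ((kummerM 1 (b + 1) x - 1) / b) - t ^ 2 * (x * kummerM 1 (b + 1) x / b) := by
        rw [ht]
        ring
      linarith
    have h0 := kummerM_pos hb le_rfl hx.le
    obtain ⟨a, ha, ha'⟩ := intermediate_value_Icc (by linarith : -t ≤ 0)
      (continuous_kummerM_left hb x).continuousOn ⟨hneg, h0.le⟩
    exact ⟨a, ha.1, ha'⟩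

end Asymptotic

end

/-! ### Radial eigenfunctions and the eigenvalue condition -/

noncomputable section

open scoped RealInnerProductSpace

lemma EntireCoeff.contDiff (n : ℕ) : ∀ {c : ℕ → ℝ}, EntireCoeff c → ContDiff ℝ n (entireSum c) := by
  induction n with
  | zero => exact fun hc => contDiff_zero.2 hc.continuous
  | succ n ih =>
    intro c hc
    push_cast
    refine contDiff_succ_iff_deriv.2 ⟨fun x => (hc.hasDerivAt x).differentiableAt, by simp, ?_⟩
    rw [funext fun x => (hc.hasDerivAt x).deriv]
    exact ih hc.deriv

section Radial

variable {d : ℕ}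

lemma hasFDerivAt_comp_norm_sq {g : ℝ → ℝ} {g' : ℝ} {v : Vel d}
    (hg : HasDerivAt g g' (‖v‖ ^ 2)) :
    HasFDerivAt (fun w : Vel d => g (‖w‖ ^ 2)) (g' • ((2 : ℝ) • innerSL ℝ v)) v := by
  have h := (hasStrictFDerivAt_norm_sq v).hasFDerivAt
  have h2 := hg.comp_hasFDerivAt v h
  refine h2.congr_fderiv ?_
  ext w
  simp [two_smul]

lemma gradient_comp_norm_sq {g : ℝ → ℝ} {g' : ℝ} {v : Vel d} (hg : HasDerivAt g g' (‖v‖ ^ 2)) :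
    gradient (fun w : Vel d => g (‖w‖ ^ 2)) v = (2 * g') • v := by
  refine HasGradientAt.gradient ?_
  rw [hasGradientAt_iff_hasFDerivAt]
  refine (hasFDerivAt_comp_norm_sq hg).congr_fderiv ?_
  ext w
  simp
  ring

lemma vdiv_comp_norm_sq_smul {k : ℝ → ℝ} {k' : ℝ} {v : Vel d} (hk : HasDerivAt k k' (‖v‖ ^ 2)) :
    vdiv (fun w : Vel d => k (‖w‖ ^ 2) • w) v = d * k (‖v‖ ^ 2) + 2 * ‖v‖ ^ 2 * k' := by
  have h := (hasFDerivAt_comp_norm_sq hk).smul (hasFDerivAt_id v)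
  have h2 : HasFDerivAt (fun w : Vel d => k (‖w‖ ^ 2) • w) _ v := h
  rw [vdiv, h2.fderiv]
  have h3 : ∀ i : Fin d, ((k (‖v‖ ^ 2) • ContinuousLinearMap.id ℝ (Vel d) +
      (k' • ((2 : ℝ) • innerSL ℝ v)).smulRight (id v)) (EuclideanSpace.single i 1)) i
      = k (‖v‖ ^ 2) + 2 * k' * (v i) ^ 2 := by
    intro i
    simp [EuclideanSpace.inner_single_right]
    ring
  rw [Finset.sum_congr rfl fun i _ => h3 i, Finset.sum_add_distrib, ← Finset.mul_sum,
    EuclideanSpace.norm_sq_eq]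
  simp
  ring

/-- The Fokker-Planck operator on radial functions, in the variable `t = |v|²`. -/
lemma fpOperator_radial {β : ℝ} {f : Vel d → ℝ} {g g' : ℝ → ℝ} {g'' : ℝ} {v : Vel d}
    (hf : f =ᶠ[𝓝 v] fun w => g (‖w‖ ^ 2)) (hg : ∀ᶠ t in 𝓝 (‖v‖ ^ 2), HasDerivAt g (g' t) t)
    (hg' : HasDerivAt g' g'' (‖v‖ ^ 2)) :
    fpOperator β f v = d * (2 * g' (‖v‖ ^ 2) + β * g (‖v‖ ^ 2))
      + 2 * ‖v‖ ^ 2 * (2 * g'' + β * g' (‖v‖ ^ 2)) := by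
  have hcont : Tendsto (fun w : Vel d => ‖w‖ ^ 2) (𝓝 v) (𝓝 (‖v‖ ^ 2)) :=
    (by fun_prop : Continuous fun w : Vel d => ‖w‖ ^ 2).tendsto v
  have heq : (fun w => gradient f w + (β * f w) • w) =ᶠ[𝓝 v]
      fun w => (2 * g' (‖w‖ ^ 2) + β * g (‖w‖ ^ 2)) • w := by
    filter_upwards [eventually_eventually_nhds.2 hf, hcont.eventually hg] with w hw1 hw2
    have : gradient f w = gradient (fun w : Vel d => g (‖w‖ ^ 2)) w := by
      rw [gradient, gradient, Filter.EventuallyEq.fderiv_eq hw1]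
    rw [this, gradient_comp_norm_sq hw2, hw1.self_of_nhds, add_smul]
  have hk := (hg'.const_mul 2).add (hg.self_of_nhds.const_mul β)
  rw [fpOperator, vdiv, Filter.EventuallyEq.fderiv_eq heq]
  exact vdiv_comp_norm_sq_smul (k := fun t => 2 * g' t + β * g t) hk

end Radial

/-- The radial profile `e^{-βt/2} M(μ/(2β), d/2, βt/2)`, with `t = |v|²`, of the eigenfunctions. -/
def fpProfile (d : ℕ) (β μ : ℝ) (t : ℝ) : ℝ :=
  Real.exp (-(β * t / 2)) * kummerM (μ / (2 * β)) ((d : ℝ) / 2) (β * t / 2)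

section Profile

variable {d : ℕ} (hd : 1 ≤ d) {β : ℝ} (hβ : 0 < β) (μ : ℝ)

include hd

lemma contDiff_fpProfile : ContDiff ℝ 2 (fpProfile d β μ) := by
  have h : ContDiff ℝ 2 (kummerM (μ / (2 * β)) ((d : ℝ) / 2)) :=
    (entireCoeff_kummerM (half_dim_pos hd) _).contDiff 2
  unfold fpProfile
  refine ContDiff.mul (by fun_prop) (h.comp ?_)
  fun_prop

include hβ

lemma fpOperator_fpProfile (v : Vel d) :
    fpOperator β (fun w : Vel d => fpProfile d β μ (‖w‖ ^ 2)) v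
      = μ * fpProfile d β μ (‖v‖ ^ 2) := by
  have hb := half_dim_pos hd
  set b := (d : ℝ) / 2 with hbdef
  set a := μ / (2 * β) with ha
  have hlin : ∀ t : ℝ, HasDerivAt (fun t : ℝ => β * t / 2) (β / 2) t := fun t => by
    simpa using ((hasDerivAt_id t).const_mul β).div_const 2
  have hexp : ∀ t : ℝ, HasDerivAt (fun t : ℝ => Real.exp (-(β * t / 2)))
      (Real.exp (-(β * t / 2)) * (-(β / 2))) t := fun t => (hlin t).neg.exp
  have hM : ∀ t, HasDerivAt (fun t : ℝ => kummerM a b (β * t / 2))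
      (kummerM' a b (β * t / 2) * (β / 2)) t := fun t =>
    (hasDerivAt_kummerM hb a _).comp t (hlin t)
  have hM' : ∀ t, HasDerivAt (fun t : ℝ => kummerM' a b (β * t / 2))
      (kummerM'' a b (β * t / 2) * (β / 2)) t := fun t =>
    (hasDerivAt_kummerM' hb a _).comp t (hlin t)
  have h1 : ∀ t, HasDerivAt (fpProfile d β μ) (Real.exp (-(β * t / 2)) * (-(β / 2)) *
      kummerM a b (β * t / 2) + Real.exp (-(β * t / 2)) * (kummerM' a b (β * t / 2) * (β / 2))) t :=
    fun t => (hexp t).mul (hM t)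
  have h2 := fun t => (((hexp t).mul_const (-(β / 2))).mul (hM t)).add
    ((hexp t).mul ((hM' t).mul_const (β / 2)))
  rw [fpOperator_radial (.of_forall fun _ => rfl) (.of_forall h1) (h2 _)]
  have hode := kummerM_ode hb a (β * ‖v‖ ^ 2 / 2)
  have hμ : μ = 2 * β * a := by
    rw [ha]
    field_simp
  have hdb : (d : ℝ) = 2 * b := by rw [hbdef]; ring
  rw [fpProfile, ← hbdef, ← ha, hμ, hdb]
  linear_combination (2 * β * Real.exp (-(β * ‖v‖ ^ 2 / 2))) * hode

end Profile

section Uniqueness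

variable {d : ℕ} {β R μ : ℝ} {f : Vel d → ℝ}

/-- The ordinary differential equation satisfied by radial solutions of `Q f = μ f`. -/
lemma radial_ode (hiso : ∀ v ∈ Metric.ball (0 : Vel d) R, ∀ w ∈ Metric.ball (0 : Vel d) R,
      ‖v‖ = ‖w‖ → f v = f w) (hf : ContDiffOn ℝ 2 f (Metric.ball (0 : Vel d) R))
    (heig : ∀ v ∈ Metric.ball (0 : Vel d) R, fpOperator β f v = μ * f v) (hR : 0 < R) {e : Vel d}
    (he : ‖e‖ = 1) :
    ∃ φ' φ'' : ℝ → ℝ, (∀ r ∈ Set.Ioo (-R) R, HasDerivAt (fun r : ℝ => f (r • e)) (φ' r) r) ∧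
      (∀ r ∈ Set.Ioo (-R) R, HasDerivAt φ' (φ'' r) r) ∧ φ' 0 = 0 ∧
      ∀ r ∈ Set.Ioo 0 R, φ'' r + ((d - 1) / r + β * r) * φ' r + d * β * f (r • e)
        = μ * f (r • e) := by
  set φ : ℝ → ℝ := fun r => f (r • e) with hφ
  have hnorm : ∀ r : ℝ, ‖r • e‖ = |r| := fun r => by rw [norm_smul, he, mul_one, Real.norm_eq_abs]
  have hmem : ∀ r ∈ Set.Ioo (-R) R, r • e ∈ Metric.ball (0 : Vel d) R := fun r hr => by
    rw [mem_ball_zero_iff, hnorm]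
    exact abs_lt.2 hr
  have hφc : ∀ r ∈ Set.Ioo (-R) R, ContDiffAt ℝ 2 φ r := fun r hr =>
    ContDiffAt.comp r (hf.contDiffAt (Metric.isOpen_ball.mem_nhds (hmem r hr))) (by fun_prop)
  have hφ1 : ∀ r ∈ Set.Ioo (-R) R, HasDerivAt φ (deriv φ r) r := fun r hr =>
    ((hφc r hr).differentiableAt (by norm_num)).hasDerivAt
  have hφ2 : ∀ r ∈ Set.Ioo (-R) R, HasDerivAt (deriv φ) (deriv (deriv φ) r) r := fun r hr =>
    (((hφc r hr).derivWithin (m := 1) (by norm_num)).differentiableAt (by norm_num)).hasDerivAt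
  refine ⟨deriv φ, deriv (deriv φ), hφ1, hφ2, ?_, fun r hr => ?_⟩
  -- Isotropy makes `r ↦ f (r • e)` even, so its derivative vanishes at 0.
  · have h0 : (0 : ℝ) ∈ Set.Ioo (-R) R := ⟨by linarith, hR⟩
    have h1 := hφ1 0 h0
    have h2 : HasDerivAt (fun r => φ (-r)) (deriv φ 0 * (-1)) 0 := by
      have h1' : HasDerivAt φ (deriv φ 0) (-0) := by simpa using h1
      exact h1'.comp 0 (hasDerivAt_neg 0)
    have h3 : (fun r => φ (-r)) =ᶠ[𝓝 0] φ := by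
      filter_upwards [Ioo_mem_nhds h0.1 h0.2] with r hr
      have hr' : -r ∈ Set.Ioo (-R) R := ⟨by linarith [hr.2], by linarith [hr.1]⟩
      exact hiso _ (hmem _ hr') _ (hmem _ hr) (by rw [hnorm, hnorm, abs_neg])
    have h4 := (h2.congr_of_eventuallyEq h3.symm).unique h1
    linarith
  · have hr0 := hr.1
    have hrR : r ∈ Set.Ioo (-R) R := ⟨by linarith, hr.2⟩
    have hnr : ‖r • e‖ = r := by rw [hnorm, abs_of_pos hr0]
    have hsqrt : ∀ t : ℝ, 0 < t → HasDerivAt Real.sqrt (1 / (2 * √t)) t := fun t ht =>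
      Real.hasDerivAt_sqrt ht.ne'
    have hrad : f =ᶠ[𝓝 (r • e)] fun w => (φ ∘ Real.sqrt) (‖w‖ ^ 2) := by
      filter_upwards [Metric.isOpen_ball.mem_nhds (hmem r hrR)] with w hw
      have hw' : ‖w‖ < R := mem_ball_zero_iff.1 hw
      simp only [Function.comp_apply, Real.sqrt_sq (norm_nonneg w)]
      refine hiso _ hw _ (hmem _ ⟨by linarith [norm_nonneg w], hw'⟩) ?_
      rw [hnorm, abs_of_nonneg (norm_nonneg w)]
    have hg : ∀ᶠ t in 𝓝 (‖r • e‖ ^ 2), HasDerivAt (φ ∘ Real.sqrt)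
        (deriv φ (√t) * (1 / (2 * √t))) t := by
      rw [hnr]
      have : r ^ 2 ∈ Set.Ioo 0 (R ^ 2) := ⟨by positivity, by
        have := hr.2
        gcongr⟩
      filter_upwards [Ioo_mem_nhds this.1 this.2] with t ht
      have hts : √t < R := (Real.sqrt_lt' hR).2 ht.2
      exact (hφ1 _ ⟨by linarith [Real.sqrt_nonneg t], hts⟩).comp t (hsqrt t ht.1)
    have hg' : HasDerivAt (fun t => deriv φ (√t) * (1 / (2 * √t)))
        (deriv (deriv φ) r * (1 / (2 * r)) * (1 / (2 * r))
          + deriv φ r * (-(2 * (1 / (2 * r))) / (2 * r) ^ 2)) (‖r • e‖ ^ 2) := by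
      rw [hnr]
      have hs := hsqrt (r ^ 2) (by positivity)
      have e1 : √(r ^ 2) = r := Real.sqrt_sq hr0.le
      have h1 := (show HasDerivAt (deriv φ) (deriv (deriv φ) r) (√(r ^ 2)) by
        rw [e1]; exact hφ2 r hrR).comp (r ^ 2) hs
      have h2 := (hs.const_mul 2).inv (by rw [e1]; positivity)
      have h3 := h1.mul h2
      simp only [Function.comp_apply, Pi.inv_apply, e1] at h3
      simp only [one_div] at h3 ⊢
      exact h3
    have h := fpOperator_radial (β := β) hrad hg hg'
    rw [heig _ (hmem r hrR), hnr] at h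
    simp only [Function.comp_apply, Real.sqrt_sq hr0.le] at h
    rw [show φ r = f (r • e) from rfl] at h
    rw [h]
    field_simp
    ring

/-- A solution of `w'' + ((d - 1) / r + β r) w' = ν w` with `w(0) = w'(0) = 0` vanishes. -/
lemma radial_ode_unique (hd : 1 ≤ d) (hβ : 0 < β) {ν : ℝ} {w w' w'' : ℝ → ℝ}
    (hw : ∀ r ∈ Set.Ioo (-R) R, HasDerivAt w (w' r) r)
    (hw' : ∀ r ∈ Set.Ioo (-R) R, HasDerivAt w' (w'' r) r) (h0 : w 0 = 0) (h0' : w' 0 = 0)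
    (hode : ∀ r ∈ Set.Ioo 0 R, w'' r + ((d - 1) / r + β * r) * w' r = ν * w r) :
    ∀ r ∈ Set.Ico 0 R, w r = 0 := by
  intro r hr
  set K := |ν + 1| with hK
  have hd' : (0 : ℝ) ≤ d - 1 := by
    have : (1 : ℝ) ≤ d := by exact_mod_cast hd
    linarith
  have hder : ∀ s ∈ Set.Ico 0 R, HasDerivAt (fun s => (w' s ^ 2 + w s ^ 2) * Real.exp (-(K * s)))
      ((2 * w' s * w'' s + 2 * w s * w' s) * Real.exp (-(K * s))
        + (w' s ^ 2 + w s ^ 2) * (Real.exp (-(K * s)) * (-(K * 1)))) s := by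
    intro s hs
    have hs' : s ∈ Set.Ioo (-R) R := ⟨by linarith [hs.1, hs.2], hs.2⟩
    refine ((((hw' s hs').pow 2).add ((hw s hs').pow 2)).mul
      ((hasDerivAt_id s).const_mul K).neg.exp).congr_deriv ?_
    simp
  -- Energy estimate: the coefficient `(d - 1)/r + β r` is nonnegative and acts as friction, so its
  -- singularity at 0 only helps. The remaining cross term is absorbed by `exp(-K s)`.
  have hanti : AntitoneOn (fun s => (w' s ^ 2 + w s ^ 2) * Real.exp (-(K * s))) (Set.Ico 0 R) := by
    refine antitoneOn_of_deriv_nonpos (convex_Ico 0 R)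
      (fun s hs => (hder s hs).continuousAt.continuousWithinAt) ?_ ?_
    · rw [interior_Ico]
      exact fun s hs => (hder s ⟨hs.1.le, hs.2⟩).differentiableAt.differentiableWithinAt
    · rw [interior_Ico]
      intro s hs
      rw [(hder s ⟨hs.1.le, hs.2⟩).deriv]
      have hs0 := hs.1
      have e1 : w'' s = ν * w s - ((d - 1) / s + β * s) * w' s := by linarith [hode s hs]
      have h1 : 0 ≤ ((d - 1) / s + β * s) * w' s ^ 2 := by positivity
      have h2 : 2 * (ν + 1) * (w s * w' s) ≤ K * (w' s ^ 2 + w s ^ 2) := by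
        have h3 : 2 * |w s * w' s| ≤ w' s ^ 2 + w s ^ 2 := by
          rw [abs_mul]
          nlinarith [sq_nonneg (|w s| - |w' s|), sq_abs (w s), sq_abs (w' s)]
        calc 2 * (ν + 1) * (w s * w' s) ≤ |2 * (ν + 1) * (w s * w' s)| := le_abs_self _
          _ = K * (2 * |w s * w' s|) := by
            rw [abs_mul, abs_mul, abs_two, hK]
            ring
          _ ≤ _ := by gcongr
      have h4 : (2 * w' s * w'' s + 2 * w s * w' s) * Real.exp (-(K * s))
        + (w' s ^ 2 + w s ^ 2) * (Real.exp (-(K * s)) * (-(K * 1))) =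
        Real.exp (-(K * s)) * (2 * (ν + 1) * (w s * w' s) - K * (w' s ^ 2 + w s ^ 2)
          - 2 * (((d - 1) / s + β * s) * w' s ^ 2)) := by
        rw [e1]
        ring
      rw [h4]
      exact mul_nonpos_of_nonneg_of_nonpos (Real.exp_nonneg _) (by linarith)
  have h := hanti ⟨le_rfl, by linarith [hr.1, hr.2]⟩ hr hr.1
  simp only [h0, h0', mul_zero, neg_zero, Real.exp_zero, mul_one] at h
  norm_num at h
  have hE := Real.exp_pos (-(K * r))
  have h5 : w' r ^ 2 + w r ^ 2 ≤ 0 := by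
    by_contra! hcon
    have := mul_pos hcon hE
    linarith
  have h6 : w r ^ 2 = 0 := by nlinarith [sq_nonneg (w' r), sq_nonneg (w r)]
  exact pow_eq_zero_iff two_ne_zero |>.1 h6

lemma exists_unit_vel (hd : 1 ≤ d) : ∃ e : Vel d, ‖e‖ = 1 :=
  ⟨EuclideanSpace.single ⟨0, hd⟩ 1, by simp⟩

/-- The eigenfunctions are the multiples of the profile. -/
theorem IsFPEigenfunction.eq_profile (hd : 1 ≤ d) (hβ : 0 < β) (hR : 0 < R)
    (h : IsFPEigenfunction d β R μ f) {v : Vel d} (hv : v ∈ Metric.closedBall (0 : Vel d) R) :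
    f v = f 0 * fpProfile d β μ (‖v‖ ^ 2) := by
  obtain ⟨e, he⟩ := exists_unit_vel hd
  have hsub := Metric.ball_subset_closedBall (x := (0 : Vel d)) (ε := R)
  have hiso : ∀ v ∈ Metric.ball (0 : Vel d) R, ∀ w ∈ Metric.ball (0 : Vel d) R,
      ‖v‖ = ‖w‖ → f v = f w := fun v hv w hw => h.isotropic v (hsub hv) w (hsub hw)
  have hcd : ContDiff ℝ 2 fun w : Vel d => fpProfile d β μ (‖w‖ ^ 2) :=
    (contDiff_fpProfile hd μ).comp (contDiff_norm_sq ℝ)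
  obtain ⟨φ', φ'', h1, h2, h3, h4⟩ := radial_ode hiso h.contDiffOn h.eigen hR he
  obtain ⟨ψ', ψ'', g1, g2, g3, g4⟩ := radial_ode (f := fun w : Vel d => fpProfile d β μ (‖w‖ ^ 2))
    (R := R) (fun v _ w _ hvw => by simp only [hvw]) hcd.contDiffOn
    (fun v _ => fpOperator_fpProfile hd hβ μ v) hR he
  -- The profile equals 1 at the origin, so subtracting `f 0` times it leaves a solution with zero
  -- value and zero slope at 0.
  have key := radial_ode_unique (R := R) hd hβ (ν := μ - d * β)
    (w := fun r => f (r • e) - f 0 * fpProfile d β μ (‖r • e‖ ^ 2))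
    (w' := fun r => φ' r - f 0 * ψ' r) (w'' := fun r => φ'' r - f 0 * ψ'' r)
    (fun r hr => (h1 r hr).sub ((g1 r hr).const_mul _))
    (fun r hr => (h2 r hr).sub ((g2 r hr).const_mul _)) (by simp [fpProfile]) (by simp [h3, g3])
    (fun r hr => by linear_combination h4 r hr - f 0 * g4 r hr)
  have hball : Set.EqOn f (fun v => f 0 * fpProfile d β μ (‖v‖ ^ 2))
      (Metric.ball (0 : Vel d) R) := by
    intro w hw
    have hw' : ‖w‖ < R := mem_ball_zero_iff.1 hw
    have hn : ‖‖w‖ • e‖ = ‖w‖ := by rw [norm_smul, he, mul_one, norm_norm]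
    have h5 := key ‖w‖ ⟨norm_nonneg w, hw'⟩
    simp only [hn] at h5
    simp only
    rw [hiso w hw (‖w‖ • e) (by rw [mem_ball_zero_iff, hn]; exact hw') hn.symm]
    linarith
  refine hball.of_subset_closure h.continuousOn
    (continuous_const.mul hcd.continuous).continuousOn hsub ?_ hv
  rw [closure_ball _ hR.ne']

theorem isFPEigenfunction_profile (hd : 1 ≤ d) (hβ : 0 < β) (hR : 0 < R)
    (hzero : kummerM (μ / (2 * β)) ((d : ℝ) / 2) (β * R ^ 2 / 2) = 0) :
    IsFPEigenfunction d β R μ fun w => fpProfile d β μ (‖w‖ ^ 2) := by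
  have hcd : ContDiff ℝ 2 fun w : Vel d => fpProfile d β μ (‖w‖ ^ 2) :=
    (contDiff_fpProfile hd μ).comp (contDiff_norm_sq ℝ)
  refine ⟨?_, fun v _ w _ hvw => by simp only [hvw], hcd.contDiffOn, hcd.continuous.continuousOn,
    fun v hv => ?_, ⟨0, Metric.mem_ball_self hR, by simp [fpProfile]⟩,
    fun v _ => fpOperator_fpProfile hd hβ μ v⟩
  · have hfin : IsFiniteMeasure ((volume.restrict (Metric.ball (0 : Vel d) R)).withDensity
        (fun v => ENNReal.ofReal (Real.exp (‖v‖ ^ 2 / 2)))) := by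
      refine isFiniteMeasure_withDensity_ofReal ?_
      have hc : Continuous fun v : Vel d => Real.exp (‖v‖ ^ 2 / 2) := by fun_prop
      exact ((hc.continuousOn.integrableOn_compact (isCompact_closedBall (0 : Vel d) R)).mono_set
        Metric.ball_subset_closedBall).2
    obtain ⟨C, hC⟩ := (isCompact_closedBall (0 : Vel d) R).exists_bound_of_continuousOn
      hcd.continuous.continuousOn
    refine MemLp.of_bound hcd.continuous.aestronglyMeasurable C ?_
    refine (withDensity_absolutelyContinuous _ _).ae_le ?_
    refine (ae_restrict_iff' measurableSet_ball).2 (.of_forall fun v hv => ?_)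
    exact hC v (Metric.ball_subset_closedBall hv)
  · have : ‖v‖ = R := by simpa using hv
    simp only [this, fpProfile, hzero, mul_zero]

/-- A nontrivial eigenfunction is `f 0` times the profile with `f 0 ≠ 0`, so the Dirichlet condition
falls on `M`. The requirement `μ ≠ 0` is automatic, since `M(0,b,·)` has no zero on the positive
axis. -/
theorem mem_fpNonzeroEigenvalues_iff (hd : 1 ≤ d) (hβ : 0 < β) (hR : 0 < R) :
    μ ∈ fpNonzeroEigenvalues d β R ↔
      kummerM (μ / (2 * β)) ((d : ℝ) / 2) (β * R ^ 2 / 2) = 0 := by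
  constructor
  · rintro ⟨-, f, hf⟩
    obtain ⟨e, he⟩ := exists_unit_vel hd
    obtain ⟨v, hv, hv0⟩ := hf.nontrivial
    rw [hf.eq_profile hd hβ hR (Metric.ball_subset_closedBall hv)] at hv0
    have hn : ‖R • e‖ = R := by rw [norm_smul, he, mul_one, Real.norm_of_nonneg hR.le]
    have h1 := hf.eq_profile hd hβ hR (v := R • e) (by rw [mem_closedBall_zero_iff, hn])
    rw [hf.boundary _ (by rw [mem_sphere_zero_iff_norm, hn]), hn] at h1
    have h2 := (mul_eq_zero.1 h1.symm).resolve_left (left_ne_zero_of_mul hv0)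
    exact (mul_eq_zero.1 h2).resolve_left (Real.exp_pos _).ne'
  · intro h
    refine ⟨?_, _, isFPEigenfunction_profile hd hβ hR h⟩
    rintro rfl
    rw [zero_div] at h
    exact (kummerM_pos (half_dim_pos hd) le_rfl (by positivity)).ne' h

end Uniqueness

end

/-! ### Return to `λ(R)` and `G`, and the final assembly -/

noncomputable section

section Main

variable {d : ℕ} {β R μ : ℝ} {f : Vel d → ℝ}

lemma fpLambda_spec (hd : 1 ≤ d) (hβ : 0 < β) (hR : 0 < R) :
    ∃ a < 0, fpLambda d β R = 2 * β * a ∧ kummerM a ((d : ℝ) / 2) (β * R ^ 2 / 2) = 0 ∧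
      (∀ a', kummerM a' ((d : ℝ) / 2) (β * R ^ 2 / 2) = 0 → a' ≤ a) ∧
      IsGreatest (fpNonzeroEigenvalues d β R) (fpLambda d β R) := by
  obtain ⟨a, ha0, ha, hmax⟩ := exists_greatest_zero_kummerM (half_dim_pos hd)
    (x := β * R ^ 2 / 2) (by positivity)
  have hg : IsGreatest (fpNonzeroEigenvalues d β R) (2 * β * a) := by
    refine ⟨(mem_fpNonzeroEigenvalues_iff hd hβ hR).2 ?_, fun μ hμ => ?_⟩
    · rwa [mul_div_cancel_left₀ _ (by positivity)]
    · have := hmax _ ((mem_fpNonzeroEigenvalues_iff hd hβ hR).1 hμ)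
      rw [div_le_iff₀ (by positivity)] at this
      linarith
  have he : fpLambda d β R = 2 * β * a := hg.csSup_eq
  exact ⟨a, ha0, he, ha, hmax, he ▸ hg⟩

lemma integral_ball_fpProfile (hd : 1 ≤ d) (hβ : 0 < β) (hR : 0 < R) {X : ℝ}
    (hX : X = √(β / 2) * R) :
    ∫ w in Metric.ball (0 : Vel d) R, fpProfile d β μ (‖w‖ ^ 2) =
      (2 * Real.pi / β) ^ ((d : ℝ) / 2) * (2 / Real.Gamma ((d : ℝ) / 2) *
        ∫ ρ in (0 : ℝ)..X, ρ ^ (d - 1) * Real.exp (-ρ ^ 2) *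
          kummerM (μ / (2 * β)) ((d : ℝ) / 2) (ρ ^ 2)) := by
  set k := √(β / 2) with hk
  have hk0 : 0 < k := Real.sqrt_pos.2 (by positivity)
  have hk2 : k ^ 2 = β / 2 := Real.sq_sqrt (by positivity)
  rw [← integral_indicator measurableSet_ball,
    integral_polar_mul hd _ (fun _ => 1)
      (Set.indicator (Set.Iio R) fun r => fpProfile d β μ (r ^ 2))]
  · have e1 : ∫ r in Set.Ioi (0 : ℝ), r ^ (d - 1) *
        Set.indicator (Set.Iio R) (fun r => fpProfile d β μ (r ^ 2)) r =
        ∫ r in (0 : ℝ)..R, r ^ (d - 1) * fpProfile d β μ (r ^ 2) := by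
      have : ∀ r, r ^ (d - 1) * Set.indicator (Set.Iio R) (fun r => fpProfile d β μ (r ^ 2)) r =
          Set.indicator (Set.Iio R) (fun r => r ^ (d - 1) * fpProfile d β μ (r ^ 2)) r := fun r => by
        by_cases h : r ∈ Set.Iio R <;> simp [h]
      simp only [this]
      rw [setIntegral_indicator measurableSet_Iio, intervalIntegral.integral_of_le hR.le,
        integral_Ioc_eq_integral_Ioo]
      rfl
    have e2 : ∫ r in (0 : ℝ)..R, r ^ (d - 1) * fpProfile d β μ (r ^ 2) =
        (k ^ d)⁻¹ * ∫ ρ in (0 : ℝ)..X, ρ ^ (d - 1) * Real.exp (-ρ ^ 2) *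
          kummerM (μ / (2 * β)) ((d : ℝ) / 2) (ρ ^ 2) := by
      have h := intervalIntegral.mul_integral_comp_mul_left (a := 0) (b := R) (c := k)
        (f := fun ρ => ρ ^ (d - 1) * Real.exp (-ρ ^ 2) *
          kummerM (μ / (2 * β)) ((d : ℝ) / 2) (ρ ^ 2))
      rw [mul_zero, ← hX] at h
      rw [← h, ← intervalIntegral.integral_const_mul, ← intervalIntegral.integral_const_mul]
      refine intervalIntegral.integral_congr fun r _ => ?_
      simp only [fpProfile, mul_pow, hk2]
      have hkd : k ^ d = k ^ (d - 1) * k := by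
        rw [← pow_succ]
        congr
        omega
      rw [hkd, show β / 2 * r ^ 2 = β * r ^ 2 / 2 by ring]
      field_simp
    have e3 : (k ^ d)⁻¹ = (2 / β) ^ ((d : ℝ) / 2) := by
      have : k ^ d = (β / 2) ^ ((d : ℝ) / 2) := by
        rw [← hk2, ← Real.rpow_natCast k 2, ← Real.rpow_mul hk0.le, ← Real.rpow_natCast]
        congr 1
        push_cast
        ring
      rw [this, ← Real.inv_rpow (by positivity), inv_div]
    rw [e1, e2, e3, integral_const, surfaceMeasure_real_univ hd, smul_eq_mul, mul_one,
      show 2 * Real.pi / β = Real.pi * (2 / β) by ring,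
      Real.mul_rpow Real.pi_pos.le (by positivity)]
    ring
  · intro σ r hr
    have h1 : ‖r • (σ : Vel d)‖ = r := by simp [norm_smul, abs_of_pos hr]
    by_cases h : r < R
    · rw [Set.indicator_of_mem (by rw [mem_ball_zero_iff, h1]; exact h),
        Set.indicator_of_mem (by exact h), h1, one_mul]
    · rw [Set.indicator_of_notMem (by rw [mem_ball_zero_iff, h1]; exact h),
        Set.indicator_of_notMem (by exact h), mul_zero]

lemma fpIntegrand_eq (hd : 1 ≤ d) (hβ : 0 < β) (a : ℝ) (v : Vel d) {u : ℝ}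
    (hu : u ∈ Set.Ico (0 : ℝ) 1) :
    fpIntegrand d β R (2 * β * a) v u =
      (β / (2 * Real.pi)) ^ ((d : ℝ) / 2) * Real.exp (-(β * ‖v‖ ^ 2 / 2)) *
      ((hilleHardy ((d : ℝ) / 2) (u ^ 2) (β * R ^ 2 / 2) (β * ‖v‖ ^ 2 / 2) - 1)
        * u ^ (2 * a - 1)) := by
  rw [fpIntegrand, fpG_eq_hilleHardy hd hβ R v hu, fpG_eq_hilleHardy hd hβ R v ⟨le_rfl, one_pos⟩,
    show 2 * β * a / β = 2 * a by field_simp]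
  simp only [ne_eq, OfNat.ofNat_ne_zero, not_false_eq_true, zero_pow, hilleHardy_zero]
  ring

/-- The integral formula in terms of the profile. -/
lemma fpG_formula (hd : 1 ≤ d) (hβ : 0 < β) (hR : 0 < R) {a : ℝ} (ha : -1 < a) (ha0 : a < 0)
    (hzero : kummerM a ((d : ℝ) / 2) (β * R ^ 2 / 2) = 0) {v : Vel d}
    (hv : v ∈ Metric.closedBall (0 : Vel d) R) :
    (∫ w in Metric.ball (0 : Vel d) R, fpProfile d β (2 * β * a) (‖w‖ ^ 2)) ≠ 0 ∧
    IntervalIntegrable (fpIntegrand d β R (2 * β * a) v) volume 0 1 ∧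
    fpProfile d β (2 * β * a) (‖v‖ ^ 2) =
      (∫ w in Metric.ball (0 : Vel d) R, fpProfile d β (2 * β * a) (‖w‖ ^ 2)) *
      (fpG d β R v 0 + 2 * β * a / β * ∫ u in (0 : ℝ)..1, fpIntegrand d β R (2 * β * a) v u) := by
  have hv' : ‖v‖ ≤ R := mem_closedBall_zero_iff.1 hv
  set X := √(β / 2) * R with hX
  have hX0 : 0 < X := mul_pos (Real.sqrt_pos.2 (by positivity)) hR
  have hX2 : X ^ 2 = β * R ^ 2 / 2 := by
    rw [hX, mul_pow, Real.sq_sqrt (by positivity)]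
    ring
  have hy : β * ‖v‖ ^ 2 / 2 ∈ Set.Icc 0 (X ^ 2) := ⟨by positivity, by rw [hX2]; gcongr⟩
  obtain ⟨h1, h2, h3⟩ := kummerM_representation hd ha ha0 hX0 (by rw [hX2]; exact hzero) hy
  have hΓ := Real.Gamma_pos_of_pos (half_dim_pos hd)
  have hπ := Real.pi_pos
  have haa : 2 * β * a / (2 * β) = a := mul_div_cancel_left₀ _ (by positivity)
  have hint := integral_ball_fpProfile (μ := 2 * β * a) hd hβ hR hX
  rw [haa] at hint
  -- The kernel formula holds for `u < 1` only; the endpoint `u = 1` is a null set.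
  have hae : ∀ᵐ u, u ∈ Set.uIoc (0 : ℝ) 1 → fpIntegrand d β R (2 * β * a) v u =
      (β / (2 * Real.pi)) ^ ((d : ℝ) / 2) * Real.exp (-(β * ‖v‖ ^ 2 / 2)) *
      ((hilleHardy ((d : ℝ) / 2) (u ^ 2) (X ^ 2) (β * ‖v‖ ^ 2 / 2) - 1) * u ^ (2 * a - 1)) := by
    filter_upwards [Measure.ae_ne volume (1 : ℝ)] with u hu1 hu
    rw [Set.uIoc_of_le zero_le_one] at hu
    rw [fpIntegrand_eq hd hβ a v ⟨hu.1.le, lt_of_le_of_ne hu.2 hu1⟩, hX2]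
  refine ⟨?_, ?_, ?_⟩
  · rw [hint]
    have : (0 : ℝ) < (2 * Real.pi / β) ^ ((d : ℝ) / 2) := by positivity
    positivity
  · refine (h2.const_mul ((β / (2 * Real.pi)) ^ ((d : ℝ) / 2) *
      Real.exp (-(β * ‖v‖ ^ 2 / 2)))).congr_ae ?_
    rw [EventuallyEq, ae_restrict_iff' measurableSet_uIoc]
    filter_upwards [hae] with u hu hu'
    exact (hu hu').symm
  · rw [intervalIntegral.integral_congr_ae hae, intervalIntegral.integral_const_mul, hint,
      fpG_eq_hilleHardy hd hβ R v ⟨le_rfl, one_pos⟩, fpProfile, haa, h3]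
    have hP : (2 * Real.pi / β) ^ ((d : ℝ) / 2) * (β / (2 * Real.pi)) ^ ((d : ℝ) / 2) = 1 := by
      rw [← Real.mul_rpow (by positivity) (by positivity),
        show 2 * Real.pi / β * (β / (2 * Real.pi)) = 1 by field_simp, Real.one_rpow]
    simp only [ne_eq, OfNat.ofNat_ne_zero, not_false_eq_true, zero_pow, hilleHardy_zero, mul_one]
    rw [show 2 * β * a / β = 2 * a by field_simp]
    set I₀ := ∫ ρ in (0 : ℝ)..X, ρ ^ (d - 1) * Real.exp (-ρ ^ 2) *
      kummerM a ((d : ℝ) / 2) (ρ ^ 2)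
    set J := ∫ u in (0 : ℝ)..1, (hilleHardy ((d : ℝ) / 2) (u ^ 2) (X ^ 2) (β * ‖v‖ ^ 2 / 2) - 1) *
      u ^ (2 * a - 1)
    linear_combination (-(Real.exp (-(β * ‖v‖ ^ 2 / 2)) *
      (2 / Real.Gamma ((d : ℝ) / 2) * I₀ * (1 + 2 * a * J)))) * hP

/-- For every small `ε`, `eventually_kummerM_zero` pins `λ/(2β)` between `-(1 + ε) A` and `-(1 - ε)
A`. The case `ε = 1/2`, with `(1 + ε) A < 1`, also gives `λ + 2β > 0` for large `R`. -/
lemma fpLambda_isEquivalent (hd : 1 ≤ d) (hβ : 0 < β) :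
    (fun R : ℝ => fpLambda d β R) ~[atTop]
      (fun R : ℝ => -(2 * β / Real.Gamma ((d : ℝ) / 2)) *
        (β * R ^ 2 / 2) ^ ((d : ℝ) / 2) * Real.exp (-(β * R ^ 2) / 2)) ∧
    ∀ᶠ R : ℝ in atTop, 0 < fpLambda d β R + 2 * β := by
  have hb := half_dim_pos hd
  have hΓ := Real.Gamma_pos_of_pos hb
  have hx : Tendsto (fun R : ℝ => β * R ^ 2 / 2) atTop atTop :=
    ((tendsto_pow_atTop two_ne_zero).const_mul_atTop hβ).atTop_div_const two_pos
  set A : ℝ → ℝ := fun R => (β * R ^ 2 / 2) ^ ((d : ℝ) / 2) * Real.exp (-(β * R ^ 2 / 2)) /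
    Real.Gamma ((d : ℝ) / 2) with hA
  have key : ∀ ε, 0 < ε → ε < 1 → ∀ᶠ R : ℝ in atTop, (1 + ε) * A R < 1 ∧ 0 < A R ∧
      ∃ a, fpLambda d β R = 2 * β * a ∧ -((1 + ε) * A R) ≤ a ∧ a ≤ -((1 - ε) * A R) := by
    intro ε hε hε1
    filter_upwards [hx.eventually (eventually_kummerM_zero hb hε hε1), eventually_gt_atTop 0]
      with R hR hR0
    obtain ⟨h1, h2, a', h3, h3'⟩ := hR
    obtain ⟨a, -, ha, ha0, hmax, -⟩ := fpLambda_spec hd hβ hR0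
    exact ⟨h1, by simp only [hA]; positivity, a, ha, h3.trans (hmax a' h3'), h2 a ha0⟩
  have hV : ∀ R : ℝ, -(2 * β / Real.Gamma ((d : ℝ) / 2)) *
      (β * R ^ 2 / 2) ^ ((d : ℝ) / 2) * Real.exp (-(β * R ^ 2) / 2) = -(2 * β) * A R := fun R => by
    rw [hA, show -(β * R ^ 2) / 2 = -(β * R ^ 2 / 2) by ring]
    ring
  constructor
  · simp only [hV]
    rw [IsEquivalent, isLittleO_iff]
    intro ε hε
    filter_upwards [key (min ε (1 / 2)) (by positivity) ((min_le_right _ _).trans_lt (by norm_num))]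
      with R hR
    obtain ⟨-, h1, a, ha, h2, h3⟩ := hR
    have h4 : min ε (1 / 2) * A R ≤ ε * A R := by
      gcongr
      exact min_le_left _ _
    simp only [Pi.sub_apply]
    rw [ha, show 2 * β * a - -(2 * β) * A R = (2 * β) * (a + A R) by ring,
      norm_mul (2 * β), norm_mul (-(2 * β)), norm_neg, Real.norm_eq_abs (a + A R),
      Real.norm_of_nonneg h1.le, mul_left_comm]
    refine mul_le_mul_of_nonneg_left ?_ (norm_nonneg _)
    rw [abs_le]
    constructor <;> linarith
  · filter_upwards [key (1 / 2) (by norm_num) (by norm_num)] with R hR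
    obtain ⟨h0, -, a, ha, h2, -⟩ := hR
    rw [ha]
    nlinarith

end Main

end

theorem proposition3 (d : ℕ) (hd : 1 ≤ d) (β : ℝ) (hβ : 0 < β) :
    -- `λ(R)` is well defined: a largest nonzero eigenvalue exists
    (∀ R : ℝ, 0 < R → IsGreatest (fpNonzeroEigenvalues d β R) (fpLambda d β R)) ∧
    -- (i) negativity, `λ(R) + 2β > 0` for large `R`, and the exact relation
    (∀ R : ℝ, 0 < R → fpLambda d β R < 0) ∧
    (∀ᶠ R : ℝ in atTop, 0 < fpLambda d β R + 2 * β) ∧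
    (∀ R : ℝ, 0 < R → 0 < fpLambda d β R + 2 * β →
      ∀ ω : Vel d, ‖ω‖ = 1 →
        IntervalIntegrable (fpIntegrand d β R (fpLambda d β R) (R • ω)) volume 0 1 ∧
        fpG d β R (R • ω) 0 + fpLambda d β R / β *
          ∫ u in (0 : ℝ)..1, fpIntegrand d β R (fpLambda d β R) (R • ω) u = 0) ∧
    -- the terms of the relation do not depend on `ω`
    (∀ R : ℝ, 0 < R → ∀ ω ω' : Vel d, ‖ω‖ = 1 → ‖ω'‖ = 1 → ∀ u ∈ Set.Ico (0 : ℝ) 1,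
      fpG d β R (R • ω) u = fpG d β R (R • ω') u) ∧
    -- (ii) the eigenfunction
    (∀ R : ℝ, 0 < R → 0 < fpLambda d β R + 2 * β →
      ∀ f : Vel d → ℝ, IsFPEigenfunction d β R (fpLambda d β R) f →
        ∀ v ∈ Metric.closedBall (0 : Vel d) R,
          IntervalIntegrable (fpIntegrand d β R (fpLambda d β R) v) volume 0 1 ∧
          f v = (∫ w in Metric.ball (0 : Vel d) R, f w) *
            (fpG d β R v 0 + fpLambda d β R / β *
              ∫ u in (0 : ℝ)..1, fpIntegrand d β R (fpLambda d β R) v u)) ∧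
    -- (iii) the asymptotic behavior of the eigenvalue
    (fun R : ℝ => fpLambda d β R) ~[atTop]
      (fun R : ℝ => -(2 * β / Real.Gamma ((d : ℝ) / 2)) *
        (β * R ^ 2 / 2) ^ ((d : ℝ) / 2) * Real.exp (-(β * R ^ 2) / 2)) := by
  have hspec : ∀ R : ℝ, 0 < R → 0 < fpLambda d β R + 2 * β → ∃ a, -1 < a ∧ a < 0 ∧
      fpLambda d β R = 2 * β * a ∧ kummerM a ((d : ℝ) / 2) (β * R ^ 2 / 2) = 0 := by
    intro R hR hlam
    obtain ⟨a, ha0, ha, hz, -, -⟩ := fpLambda_spec hd hβ hR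
    rw [ha] at hlam
    exact ⟨a, by nlinarith, ha0, ha, hz⟩
  have hnorm : ∀ R : ℝ, 0 < R → ∀ ω : Vel d, ‖ω‖ = 1 → ‖R • ω‖ = R := fun R hR ω hω => by
    rw [norm_smul, hω, mul_one, Real.norm_of_nonneg hR.le]
  refine ⟨fun R hR => ?_, fun R hR => ?_, (fpLambda_isEquivalent hd hβ).2, fun R hR hlam ω hω => ?_,
    fun R hR ω ω' hω hω' u hu => ?_, fun R hR hlam f hf v hv => ?_, (fpLambda_isEquivalent hd hβ).1⟩
  · obtain ⟨a, -, -, -, -, h⟩ := fpLambda_spec hd hβ hR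
    exact h
  · obtain ⟨a, ha0, ha, -⟩ := fpLambda_spec hd hβ hR
    rw [ha]
    exact mul_neg_of_pos_of_neg (by positivity) ha0
  · obtain ⟨a, ha, ha0, he, hz⟩ := hspec R hR hlam
    rw [he]
    obtain ⟨h1, h2, h3⟩ := fpG_formula hd hβ hR ha ha0 hz (v := R • ω)
      (by rw [mem_closedBall_zero_iff, hnorm R hR ω hω])
    refine ⟨h2, ?_⟩
    -- On the boundary the profile vanishes while its mass is nonzero, so the bracket itself must
    -- vanish.
    rw [hnorm R hR ω hω, fpProfile, mul_div_cancel_left₀ _ (by positivity), hz, mul_zero] at h3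
    exact (mul_eq_zero.1 h3.symm).resolve_left h1
  · rw [fpG_eq_hilleHardy hd hβ R _ hu, fpG_eq_hilleHardy hd hβ R _ hu, hnorm R hR ω hω,
      hnorm R hR ω' hω']
  · obtain ⟨a, ha, ha0, he, hz⟩ := hspec R hR hlam
    rw [he] at hf ⊢
    obtain ⟨-, h2, h3⟩ := fpG_formula hd hβ hR ha ha0 hz hv
    refine ⟨h2, ?_⟩
    have hint : ∫ w in Metric.ball (0 : Vel d) R, f w =
        f 0 * ∫ w in Metric.ball (0 : Vel d) R, fpProfile d β (2 * β * a) (‖w‖ ^ 2) := by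
      rw [← integral_const_mul]
      exact setIntegral_congr_fun measurableSet_ball fun w hw =>
        hf.eq_profile hd hβ hR (Metric.ball_subset_closedBall hw)
    rw [hint, mul_assoc, ← h3]
    exact hf.eq_profile hd hβ hR hv
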